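/- All graphs are finite, simple and undirected. A stable cutset of a graph $G$ is a set $S$ of pairwise non-adjacent vertices of $G$ (possibly empty) such that $G-S$ is disconnected. Let $\mathcal{G}_{sc}$ be the smallest isomorphism-closed class of graphs such that $K_3$ and the triangular prism $\overline{C_6}$ belong to $\mathcal{G}_{sc}$, and, whenever $G,H\in\mathcal{G}_{sc}$ and the graph $G\cap H$ is isomorphic to $K_2$ or $K_3$, also $G\cup H\in\mathcal{G}_{sc}$. Theorem. Let $G$ be a graph of order $n$ with at most $2n-3$ edges that is not isomorphic to $K_2$. Then $G$ has a stable cutset or belongs to $\mathcal{G}_{sc}$. -/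

import Mathlib

/-- A stable cutset of `G`: a stable (independent) set `S` of vertices such that `G - S` is
disconnected, that is, some two vertices of `G - S` are not joined by a path in `G - S`
(the graph without vertices is not disconnected). -/
def IsStableCutset {V : Type*} (G : SimpleGraph V) (S : Set V) : Prop :=
  G.IsIndepSet S ∧ ¬ (G.induce Sᶜ).Preconnected

/-- The class `𝒢_sc`: the smallest class of graphs, closed under isomorphism, that contains `K₃`
and the triangular prism (the complement of `C₆`), and that contains `G = A ∪ B` whenever it
contains the graphs `A` and `B` and `A ∩ B` is isomorphic to `K₂` or to `K₃`. -/
inductive InGsc.{u} : ∀ {V : Type u}, SimpleGraph V → Prop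
  | triangle {V : Type u} {G : SimpleGraph V}
      (h : Nonempty (G ≃g SimpleGraph.completeGraph (Fin 3))) : InGsc G
  | prism {V : Type u} {G : SimpleGraph V}
      (h : Nonempty (G ≃g (SimpleGraph.cycleGraph 6)ᶜ)) : InGsc G
  | glue {V : Type u} {G : SimpleGraph V} (A B : G.Subgraph)
      (hA : InGsc A.coe) (hB : InGsc B.coe) (hunion : A ⊔ B = ⊤)
      (hinter : Nonempty ((A ⊓ B).coe ≃g SimpleGraph.completeGraph (Fin 2)) ∨
        Nonempty ((A ⊓ B).coe ≃g SimpleGraph.completeGraph (Fin 3))) : InGsc G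

/-!
The proof studies a counterexample `G` of minimal order (`SimpleGraph.Crit`), on `n` vertices.

*Cutting off connected sets.* If `Y` is a connected set of vertices and `K ⊆ Y` satisfies
`e(Y) + |K| + 2 ≤ 2 |Y|`, then a stable set cuts off a nonempty part of `Y` that avoids `K`
(`exists_stable_cut_avoiding`). With `K` the two ends of an edge, this gives a stable cutset in each
graph with at most `2n - 4` edges, so `G` has exactly `2n - 3` edges. A cutset of `G` that is a
clique on two or three vertices would split `G` into smaller graphs of the class, so there is none
(`Crit.not_separates_of_clique`). With `K` the set of vertices of `Y` that have neighbours outside,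
it follows that each edge lies in at most one triangle (`Crit.eq_of_common_of_adj`) and that a path
on three vertices with nonadjacent ends is no cutset (`Crit.not_separates_path`). Moreover, each
vertex has degree at least three and lies in a triangle.

*Two vertices have two common neighbours* (`Crit.not_uniqueCommon`). Suppose not. Then `G` contains
a ring, a cycle of edges that lie in triangles, with one edge exempt from this condition. Among the
connected sets disjoint from a ring let `M` be largest, and let `X` be a shortest ring disjoint from
`M`. Each ring disjoint from `M` contains all neighbours of `M`, of which there are at least three.
The graph `G - X` is not connected, again by the cutting lemma, since each triangle on `X` has its
apex off `X`. So there are vertices outside `X` and `M`. If one of them lies in two triangles, a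
longest path through such vertices attaches to `X` at its ends and yields two rings with at most two
common vertices on `X`; otherwise the triangles of these vertices have an edge on `X` and yield a
ring shorter than `X`.

*Identification.* So there are vertices `a`, `z` with two common neighbours, and these four vertices
form an induced cycle. Identifying `a` with `z` loses two edges and one vertex and creates no stable
cutset, so the result lies in the class. In graphs of the class, each proper clique misses a vertex
of degree two or the inner vertices of a piece, which is part of a prism (`exists_leaf_or_piece`).
Hence either `G` contains a piece, or both common neighbours have degree three
(`Crit.exists_thirdNbr`). In the second case, the same holds for `a` and `z`, and `G` is a prism or
has a cutset with two vertices.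

*Pieces.* Let `y₁ y₂ s` be a triangle in which `y₁` and `y₂` have one further neighbour each, `u`
and `w`, with `u` adjacent to `w`. Deleting `y₁` and `y₂` and adding the edge `s w`, or
symmetrically `s u`, gives graphs without stable cutsets, hence graphs of the class. In a graph of
the class, a vertex lies in a clique cutset, or has degree two, or has the neighbourhood of a vertex
in a prism (`atomAt_of_inGsc`). Comparing what this says about `s` in the two reductions gives a
contradiction (`Crit.not_piece`).
-/

open Finset

set_option linter.unusedSectionVars false

namespace SimpleGraph

universe u

variable {V : Type*}

/-! ### Separators and stable cutsets -/

/-- `K` separates `G`: the vertices outside `K` split into two nonempty parts without edges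
between them. One of the parts, `C`, is given; the other consists of the remaining vertices. -/
def Separates (G : SimpleGraph V) (K : Set V) : Prop :=
  ∃ C : Set V, C.Nonempty ∧ (∀ a ∈ C, a ∉ K) ∧ (∃ q, q ∉ C ∧ q ∉ K) ∧
    ∀ a ∈ C, ∀ b, G.Adj a b → b ∈ C ∨ b ∈ K

/-- `G` has a stable cutset, phrased through `Separates`. -/
def HasStableCut (G : SimpleGraph V) : Prop :=
  ∃ S : Set V, G.IsIndepSet S ∧ G.Separates S

theorem Separates.isStableCutset {G : SimpleGraph V} {S : Set V} (hS : G.IsIndepSet S)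
    (h : G.Separates S) : IsStableCutset G S := by
  refine ⟨hS, fun hp => ?_⟩
  obtain ⟨C, ⟨c, hc⟩, hCS, ⟨q, hqC, hqS⟩, hcl⟩ := h
  obtain ⟨w⟩ := hp ⟨c, hCS c hc⟩ ⟨q, hqS⟩
  have key : ∀ (x y : (Sᶜ : Set V)), (G.induce Sᶜ).Walk x y → (x : V) ∈ C → (y : V) ∈ C := by
    intro x y w
    induction w with
    | nil => exact id
    | @cons u v _ hadj _ ih =>
      intro hx
      refine ih ?_
      rcases hcl _ hx _ hadj with h | h
      · exact h
      · exact absurd h v.2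
  exact hqC (key _ _ w hc)

/-- A stable cutset pulls back along a surjective homomorphism. -/
theorem HasStableCut.comap {W : Type*} {G : SimpleGraph V} {H : SimpleGraph W} (f : V → W)
    (hf : Function.Surjective f) (hom : ∀ a b, G.Adj a b → H.Adj (f a) (f b))
    (h : H.HasStableCut) : G.HasStableCut := by
  obtain ⟨S, hS, C, ⟨c, hc⟩, hCS, ⟨q, hq, hq'⟩, hcl⟩ := h
  refine ⟨f ⁻¹' S, ?_, f ⁻¹' C, ?_, fun a ha => hCS _ ha, ?_, fun a ha b hab =>
    hcl _ ha _ (hom _ _ hab)⟩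
  · intro a ha b hb _ hab
    exact hS ha hb (hom _ _ hab).ne (hom _ _ hab)
  · obtain ⟨a, rfl⟩ := hf c
    exact ⟨a, hc⟩
  · obtain ⟨a, rfl⟩ := hf q
    exact ⟨a, hq, hq'⟩

/-- Stability, in the form in which it is used. -/
theorem isIndepSet_of_forall {G : SimpleGraph V} {S : Set V}
    (h : ∀ a ∈ S, ∀ b ∈ S, ¬ G.Adj a b) : G.IsIndepSet S := fun a ha b hb _ => h a ha b hb

theorem IsIndepSet.not_adj {G : SimpleGraph V} {S : Set V} (h : G.IsIndepSet S) {a b : V}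
    (ha : a ∈ S) (hb : b ∈ S) : ¬ G.Adj a b := fun hab => h ha hb hab.ne hab

/-! ### Counting edges -/

open Classical in
/-- The number of ordered pairs `(a, b) ∈ A × B` of adjacent vertices. For `A = B` this is twice
the number of edges inside `A`. -/
noncomputable def ec (G : SimpleGraph V) (A B : Finset V) : ℕ :=
  ∑ a ∈ A, ∑ b ∈ B, if G.Adj a b then 1 else 0

theorem ec_comm (G : SimpleGraph V) (A B : Finset V) : G.ec A B = G.ec B A := by
  unfold ec
  rw [Finset.sum_comm]
  refine Finset.sum_congr rfl fun a _ => Finset.sum_congr rfl fun b _ => ?_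
  rw [G.adj_comm]

section DecEq
variable [DecidableEq V] (G : SimpleGraph V)

theorem ec_union_left {A B : Finset V} (C : Finset V) (h : Disjoint A B) :
    G.ec (A ∪ B) C = G.ec A C + G.ec B C := Finset.sum_union h

theorem ec_union_right {A B : Finset V} (C : Finset V) (h : Disjoint A B) :
    G.ec C (A ∪ B) = G.ec C A + G.ec C B := by
  rw [ec_comm, ec_union_left G C h, ec_comm G A, ec_comm G B]

theorem ec_union_self {A B : Finset V} (h : Disjoint A B) :
    G.ec (A ∪ B) (A ∪ B) = G.ec A A + G.ec B B + 2 * G.ec A B := by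
  rw [ec_union_left G _ h, ec_union_right G _ h, ec_union_right G _ h, ec_comm G B A]
  ring

theorem ec_singleton_left_le (a : V) (B : Finset V) : G.ec {a} B ≤ B.card := by
  unfold ec
  rw [Finset.sum_singleton, Finset.card_eq_sum_ones]
  exact Finset.sum_le_sum fun b _ => by split <;> simp

theorem ec_singleton_self (a : V) : G.ec {a} {a} = 0 := by simp [ec]

open Classical in
theorem ec_singleton_left (a : V) (B : Finset V) : G.ec {a} B = (B.filter (G.Adj a)).card := by
  rw [ec, Finset.sum_singleton, Finset.card_filter]

theorem ec_insert_self {a : V} {A : Finset V} (h : a ∉ A) :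
    G.ec (insert a A) (insert a A) = G.ec A A + 2 * G.ec {a} A := by
  rw [Finset.insert_eq, ec_union_self G (by simpa using h), ec_singleton_self, zero_add]

theorem even_ec_self (A : Finset V) : Even (G.ec A A) := by
  induction A using Finset.induction_on with
  | empty => simp [ec]
  | insert a A h ih => rw [ec_insert_self G h]; exact ih.add (even_two_mul _)

theorem ec_eq_zero {A B : Finset V} (h : ∀ a ∈ A, ∀ b ∈ B, ¬ G.Adj a b) : G.ec A B = 0 :=
  Finset.sum_eq_zero fun a ha => Finset.sum_eq_zero fun b hb => if_neg (h a ha b hb)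

theorem card_le_ec_singleton {a : V} {B D : Finset V} (hD : D ⊆ B) (h : ∀ d ∈ D, G.Adj a d) :
    D.card ≤ G.ec {a} B := by
  classical
  rw [ec_singleton_left]
  exact Finset.card_le_card fun d hd => Finset.mem_filter.2 ⟨hD hd, h d hd⟩

theorem ec_clique {K : Finset V} (hK : ∀ a ∈ K, ∀ b ∈ K, a ≠ b → G.Adj a b) :
    G.ec K K = K.card * (K.card - 1) := by
  unfold ec
  refine Finset.sum_const_nat fun a ha => ?_
  rw [← Finset.card_erase_of_mem ha, Finset.card_eq_sum_ones, ← Finset.sum_filter]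
  refine Finset.sum_congr ?_ fun _ _ => rfl
  ext b
  simp only [Finset.mem_filter, Finset.mem_erase]
  exact ⟨fun h => ⟨h.2.ne', h.1⟩, fun h => ⟨h.2, hK a ha b h.2 h.1.symm⟩⟩

end DecEq

theorem ec_map {W : Type*} {G : SimpleGraph V} {H : SimpleGraph W} (f : W ↪ V)
    (h : ∀ a b, H.Adj a b ↔ G.Adj (f a) (f b)) (A B : Finset W) :
    H.ec A B = G.ec (A.map f) (B.map f) := by
  unfold ec
  rw [Finset.sum_map]
  refine Finset.sum_congr rfl fun a _ => ?_
  rw [Finset.sum_map]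
  refine Finset.sum_congr rfl fun b _ => ?_
  rw [h]

theorem ec_univ [Fintype V] (G : SimpleGraph V) :
    G.ec univ univ = 2 * G.edgeSet.ncard := by
  classical
  rw [← coe_edgeFinset, Set.ncard_coe_finset, ← sum_degrees_eq_twice_card_edges]
  unfold ec
  refine Finset.sum_congr rfl fun a _ => ?_
  rw [← card_neighborFinset_eq_degree, ← Finset.card_filter]
  congr 1
  ext b
  simp

/-! ### Connected sets of vertices -/

/-- `Y` induces a connected subgraph (or is empty): no nonempty proper subset of `Y` is closed under
adjacency within `Y`. -/
def SetConn (G : SimpleGraph V) (Y : Finset V) : Prop :=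
  ∀ A ⊆ Y, A.Nonempty → (∀ a ∈ A, ∀ b ∈ Y, G.Adj a b → b ∈ A) → A = Y

section CY
variable [DecidableEq V] {G : SimpleGraph V}

/-- A set that is not connected splits into two nonempty parts without edges between them. -/
theorem exists_split_of_not_setConn {Y : Finset V} (h : ¬ G.SetConn Y) :
    ∃ A B : Finset V, A.Nonempty ∧ B.Nonempty ∧ Disjoint A B ∧ A ∪ B = Y ∧
      ∀ a ∈ A, ∀ b ∈ B, ¬ G.Adj a b := by
  unfold SetConn at h
  push Not at h
  obtain ⟨A, hAY, hA, hcl, hne⟩ := h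
  refine ⟨A, Y \ A, hA, ?_, Finset.disjoint_sdiff, Finset.union_sdiff_of_subset hAY, ?_⟩
  · rw [Finset.sdiff_nonempty]
    exact fun h => hne (hAY.antisymm h)
  · intro a ha b hb hab
    rw [Finset.mem_sdiff] at hb
    exact hb.2 (hcl a ha b hb.1 hab)

/-- If deleting `y` from a connected set leaves parts `A` and `B` without edges between them, then
each part together with `y` is connected. -/
theorem SetConn.insert_part {Y A B : Finset V} {y : V} (hY : G.SetConn Y) (hyY : y ∈ Y)
    (hAB : A ∪ B = Y.erase y) (hd : Disjoint A B) (hno : ∀ a ∈ A, ∀ b ∈ B, ¬ G.Adj a b) :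
    G.SetConn (insert y A) := by
  have hAY : ∀ a ∈ A, a ≠ y ∧ a ∈ Y := fun a ha => by
    have : a ∈ Y.erase y := hAB ▸ Finset.mem_union_left _ ha
    simpa using this
  have hBY : ∀ a ∈ B, a ≠ y ∧ a ∈ Y := fun a ha => by
    have : a ∈ Y.erase y := hAB ▸ Finset.mem_union_right _ ha
    simpa using this
  have hYc : ∀ b ∈ Y, b = y ∨ b ∈ A ∨ b ∈ B := fun b hb => by
    by_cases h : b = y
    · exact Or.inl h
    · have : b ∈ A ∪ B := hAB ▸ Finset.mem_erase.2 ⟨h, hb⟩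
      exact Or.inr (Finset.mem_union.1 this)
  intro X hX hne hcl
  by_cases hy : y ∈ X
  · have h1 : X ∪ B = Y := by
      refine hY _ ?_ (hne.mono Finset.subset_union_left) ?_
      · intro b hb
        rcases Finset.mem_union.1 hb with h | h
        · rcases Finset.mem_insert.1 (hX h) with rfl | h
          · exact hyY
          · exact (hAY b h).2
        · exact (hBY b h).2
      · intro a ha b hb hab
        rcases hYc b hb with rfl | h | h
        · exact Finset.mem_union_left _ hy
        · rcases Finset.mem_union.1 ha with h' | h'
          · exact Finset.mem_union_left _ (hcl a h' b (Finset.mem_insert_of_mem h) hab)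
          · exact absurd hab.symm (hno b h a h')
        · exact Finset.mem_union_right _ h
    refine hX.antisymm fun a ha => ?_
    rcases Finset.mem_insert.1 ha with rfl | ha
    · exact hy
    · have : a ∈ X ∪ B := h1 ▸ (hAY a ha).2
      rcases Finset.mem_union.1 this with h | h
      · exact h
      · exact absurd h (Finset.disjoint_left.1 hd ha)
  · exfalso
    have hXA : ∀ a ∈ X, a ∈ A := fun a ha => by
      rcases Finset.mem_insert.1 (hX ha) with rfl | h
      · exact absurd ha hy
      · exact h
    have h1 : X = Y := by
      refine hY _ (fun a ha => (hAY a (hXA a ha)).2) hne ?_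
      intro a ha b hb hab
      rcases hYc b hb with rfl | h | h
      · exact hcl a ha _ (Finset.mem_insert_self _ _) hab
      · exact hcl a ha b (Finset.mem_insert_of_mem h) hab
      · exact absurd hab (hno a (hXA a ha) b h)
    exact hy (h1 ▸ hyY)

/-- The engine of the argument: a sparse connected set `Y` (with `e(Y) + |K| + 2 ≤ 2 |Y|`) has a
stable set `S` that cuts off a nonempty part `C` of `Y` avoiding the prescribed set `K`. -/
theorem exists_stable_cut_avoiding (Y K : Finset V) (hY : G.SetConn Y) (hK : K ⊆ Y)
    (hcard : G.ec Y Y + 2 * K.card + 4 ≤ 4 * Y.card) :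
    ∃ S C : Finset V, S ⊆ Y ∧ C ⊆ Y ∧ C.Nonempty ∧ G.IsIndepSet (S : Set V) ∧ Disjoint C S ∧
      Disjoint C K ∧ ∀ a ∈ C, ∀ b ∈ Y, G.Adj a b → b ∈ C ∨ b ∈ S := by
  classical
  induction hn : Y.card using Nat.strong_induction_on generalizing Y K with
  | _ n IH =>
  subst hn
  by_cases hst : ∀ a ∈ K, ∀ b ∈ K, ¬ G.Adj a b
  · refine ⟨K, Y \ K, hK, Finset.sdiff_subset, ?_, isIndepSet_of_forall hst,
      Finset.sdiff_disjoint, Finset.sdiff_disjoint, ?_⟩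
    · rw [Finset.sdiff_nonempty]
      intro hYK
      obtain rfl := hYK.antisymm hK
      obtain ⟨y, hy⟩ : Y.Nonempty := Finset.card_pos.1 (by omega)
      have h1 := hY {y} (by simpa using hy) (by simp) (fun a ha b hb hab => by
        rw [Finset.mem_singleton] at ha
        subst ha
        exact absurd hab (hst _ hy _ hb))
      rw [← h1] at hcard
      simp at hcard
    · intro a _ b hb _
      by_cases h : b ∈ K
      · exact Or.inr h
      · exact Or.inl (Finset.mem_sdiff.2 ⟨hb, h⟩)
  push Not at hst
  obtain ⟨y, hy, y', hy', hyy⟩ := hst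
  have hyY := hK hy
  have hYcard : (Y.erase y).card + 1 = Y.card := Finset.card_erase_add_one hyY
  have hec : G.ec Y Y = G.ec (Y.erase y) (Y.erase y) + 2 * G.ec {y} (Y.erase y) := by
    conv_lhs => rw [← Finset.insert_erase hyY]
    exact ec_insert_self G (Finset.notMem_erase _ _)
  by_cases hc : G.SetConn (Y.erase y)
  · set N := (Y.erase y).filter (G.Adj y) with hN
    have hy'N : y' ∈ N := by
      simp only [hN, Finset.mem_filter, Finset.mem_erase]
      exact ⟨⟨hyy.ne', hK hy'⟩, hyy⟩
    have hNc : N.card = G.ec {y} (Y.erase y) := (ec_singleton_left G y _).symm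
    have hsub : K.erase y ∪ N = K.erase y ∪ N.erase y' := by
      ext b
      simp only [Finset.mem_union, Finset.mem_erase]
      by_cases hb : b = y'
      · subst hb; simp [hyy.ne', hy']
      · simp [hb]
    have h1 : (K.erase y ∪ N).card ≤ (K.card - 1) + (N.card - 1) := by
      rw [hsub, ← Finset.card_erase_of_mem hy, ← Finset.card_erase_of_mem hy'N]
      exact Finset.card_union_le _ _
    have hKpos : 0 < K.card := Finset.card_pos.2 ⟨y, hy⟩
    have hNpos : 0 < N.card := Finset.card_pos.2 ⟨y', hy'N⟩
    obtain ⟨S, C, hS, hC, hCne, hSs, hCS, hCK, hcl⟩ := IH _ (by omega) (Y.erase y)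
      (K.erase y ∪ N) hc (Finset.union_subset (Finset.erase_subset_erase _ hK)
        (Finset.filter_subset _ _)) (by omega) rfl
    refine ⟨S, C, hS.trans (Finset.erase_subset _ _), hC.trans (Finset.erase_subset _ _), hCne,
      hSs, hCS, ?_, ?_⟩
    · rw [Finset.disjoint_left] at hCK ⊢
      intro a ha haK
      refine hCK ha (Finset.mem_union_left _ (Finset.mem_erase.2 ⟨?_, haK⟩))
      exact (Finset.mem_erase.1 (hC ha)).1
    · intro a ha b hb hab
      by_cases hby : b = y
      · subst hby
        exact absurd (Finset.mem_union_right _ (Finset.mem_filter.2 ⟨hC ha, hab.symm⟩))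
          (Finset.disjoint_left.1 hCK ha)
      · exact hcl a ha b (Finset.mem_erase.2 ⟨hby, hb⟩) hab
  · obtain ⟨A, B, hA, hB, hd, hAB, hno⟩ := exists_split_of_not_setConn hc
    -- one part, with `y` added, satisfies the hypothesis for the trace of `K`
    have main : ∀ A B : Finset V, B.Nonempty → Disjoint A B → A ∪ B = Y.erase y →
        (∀ a ∈ A, ∀ b ∈ B, ¬ G.Adj a b) →
        G.ec (insert y A) (insert y A) + 2 * (K ∩ insert y A).card + 4 ≤ 4 * (insert y A).card →
        ∃ S C : Finset V, S ⊆ Y ∧ C ⊆ Y ∧ C.Nonempty ∧ G.IsIndepSet (S : Set V) ∧ Disjoint C S ∧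
          Disjoint C K ∧ ∀ a ∈ C, ∀ b ∈ Y, G.Adj a b → b ∈ C ∨ b ∈ S := by
      intro A B hB hd hAB hno hle
      have hyA : y ∉ A := fun h => by
        have : y ∈ Y.erase y := hAB ▸ Finset.mem_union_left _ h
        simp at this
      have hcd : A.card + B.card = (Y.erase y).card := by
        rw [← hAB, Finset.card_union_of_disjoint hd]
      have hBp := hB.card_pos
      have hAY : insert y A ⊆ Y := Finset.insert_subset hyY fun a ha =>
        Finset.mem_of_mem_erase (hAB ▸ Finset.mem_union_left _ ha : a ∈ Y.erase y)
      obtain ⟨S, C, hS, hC, hCne, hSs, hCS, hCK, hcl⟩ := IH _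
        (by rw [Finset.card_insert_of_notMem hyA]; omega) (insert y A) (K ∩ insert y A)
        (hY.insert_part hyY hAB hd hno) Finset.inter_subset_right hle rfl
      rw [Finset.disjoint_left] at hCK
      refine ⟨S, C, hS.trans hAY, hC.trans hAY, hCne, hSs, hCS, ?_, ?_⟩
      · rw [Finset.disjoint_left]
        exact fun a ha haK => hCK ha (Finset.mem_inter.2 ⟨haK, hC ha⟩)
      · intro a ha b hb hab
        by_cases hbA : b ∈ insert y A
        · exact hcl a ha b hbA hab
        · exfalso
          rw [Finset.mem_insert, not_or] at hbA
          have hbB : b ∈ B := by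
            have : b ∈ A ∪ B := hAB ▸ Finset.mem_erase.2 ⟨hbA.1, hb⟩
            exact (Finset.mem_union.1 this).resolve_left hbA.2
          rcases Finset.mem_insert.1 (hC ha) with rfl | haA
          · exact hCK ha (Finset.mem_inter.2 ⟨hy, Finset.mem_insert_self _ _⟩)
          · exact hno a haA b hbB hab
    have hyA : y ∉ A := fun h => by
      have : y ∈ Y.erase y := hAB ▸ Finset.mem_union_left _ h
      simp at this
    have hyB : y ∉ B := fun h => by
      have : y ∈ Y.erase y := hAB ▸ Finset.mem_union_right _ h
      simp at this
    have hcd : A.card + B.card = (Y.erase y).card := by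
      rw [← hAB, Finset.card_union_of_disjoint hd]
    have hAB0 := ec_eq_zero (G := G) hno
    have e1 : G.ec (Y.erase y) (Y.erase y) = G.ec A A + G.ec B B := by
      rw [← hAB, ec_union_self G hd, hAB0]; rfl
    have e2 : G.ec {y} (Y.erase y) = G.ec {y} A + G.ec {y} B := by
      rw [← hAB, ec_union_right G _ hd]
    have e3 := ec_insert_self G hyA
    have e4 := ec_insert_self G hyB
    have hKs : (K ∩ insert y A).card + (K ∩ insert y B).card = K.card + 1 := by
      rw [← Finset.card_union_add_card_inter]
      have i1 : K ∩ insert y A ∪ K ∩ insert y B = K := by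
        rw [← Finset.inter_union_distrib_left, Finset.inter_eq_left]
        intro a ha
        by_cases h : a = y
        · simp [h]
        · have : a ∈ A ∪ B := hAB ▸ Finset.mem_erase.2 ⟨h, hK ha⟩
          rcases Finset.mem_union.1 this with h | h <;> simp [h]
      have i2 : K ∩ insert y A ∩ (K ∩ insert y B) = {y} := by
        ext a
        simp only [Finset.mem_inter, Finset.mem_insert, Finset.mem_singleton]
        constructor
        · rintro ⟨⟨_, h1 | h1⟩, ⟨_, h2 | h2⟩⟩
          · exact h1
          · exact h1
          · exact h2
          · exact absurd h2 (Finset.disjoint_left.1 hd h1)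
        · rintro rfl
          exact ⟨⟨hy, Or.inl rfl⟩, ⟨hy, Or.inl rfl⟩⟩
      rw [i1, i2]; rfl
    have c1 := Finset.card_insert_of_notMem hyA
    have c2 := Finset.card_insert_of_notMem hyB
    obtain ⟨r1, hr1⟩ := even_ec_self G (insert y A)
    obtain ⟨r2, hr2⟩ := even_ec_self G (insert y B)
    by_cases hle : G.ec (insert y A) (insert y A) + 2 * (K ∩ insert y A).card + 4 ≤
        4 * (insert y A).card
    · exact main A B hB hd hAB hno hle
    · refine main B A hA hd.symm (by rw [Finset.union_comm, hAB])
        (fun b hb a ha hab => hno a ha b hb hab.symm) ?_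
      omega

end CY

/-! ### Minimal counterexamples -/

/-- Sparse graphs, with at most `2n - 4` edges, have a stable cutset. -/
theorem hasStableCut_of_ec_le {V : Type*} [Fintype V] {G : SimpleGraph V}
    (h : G.ec univ univ + 8 ≤ 4 * Fintype.card V) : G.HasStableCut := by
  classical
  by_cases hc : G.SetConn univ
  · obtain ⟨x, y, hxy⟩ : ∃ x y, G.Adj x y := by
      by_contra hno
      push Not at hno
      obtain ⟨x⟩ : Nonempty V := Fintype.card_pos_iff.1 (by omega)
      have := hc {x} (by simp) (by simp) (fun a _ b _ hab => absurd hab (hno a b))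
      have h2 := congrArg Finset.card this
      rw [Finset.card_singleton, Finset.card_univ] at h2
      omega
    obtain ⟨S, C, -, -, hC, hS, hCS, hCK, hcl⟩ := exists_stable_cut_avoiding univ {x, y} hc
      (by simp) (by rw [Finset.card_pair hxy.ne, Finset.card_univ]; omega)
    rw [Finset.disjoint_left] at hCS hCK
    refine ⟨S, hS, C, hC, fun a ha => hCS ha, ?_, fun a ha b hab => hcl a ha b (by simp) hab⟩
    by_cases hx : x ∈ S
    · exact ⟨y, fun h => hCK h (by simp), fun hy => hS.not_adj hx hy hxy⟩
    · exact ⟨x, fun h => hCK h (by simp), hx⟩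
  · obtain ⟨A, B, ⟨a, ha⟩, ⟨b, hb⟩, hd, hAB, hno⟩ := exists_split_of_not_setConn hc
    refine ⟨∅, isIndepSet_of_forall (by simp), A, ⟨a, ha⟩, by simp,
      ⟨b, fun h => Finset.disjoint_left.1 hd h hb, by simp⟩, fun a ha b hab => Or.inl ?_⟩
    have : b ∈ A ∪ B := by rw [hAB]; simp
    exact (Finset.mem_union.1 this).resolve_right fun h => hno a ha b h hab

/-- A graph without a stable cutset has at least `2n - 3` edges. -/
theorem le_ec_of_not_hasStableCut {V : Type*} [Fintype V] {G : SimpleGraph V}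
    (h : ¬ G.HasStableCut) : 4 * Fintype.card V ≤ G.ec univ univ + 6 := by
  classical
  by_contra hlt
  obtain ⟨r, hr⟩ := even_ec_self G univ
  exact h (hasStableCut_of_ec_le (by omega))

/-- A counterexample to the theorem of minimal order. -/
structure Crit {V : Type u} [Fintype V] (G : SimpleGraph V) : Prop where
  not_cut : ¬ G.HasStableCut
  not_gsc : ¬ InGsc G
  edges : G.ec univ univ + 6 ≤ 4 * Fintype.card V
  four_le : 4 ≤ Fintype.card V
  min : ∀ (W : Type u) [Fintype W] (H : SimpleGraph W), Fintype.card W < Fintype.card V →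
    3 ≤ Fintype.card W → ¬ H.HasStableCut → H.ec univ univ + 6 ≤ 4 * Fintype.card W → InGsc H

theorem coe_eq_top_of_clique {V : Type*} {G : SimpleGraph V} (S : G.Subgraph)
    (h : ∀ a ∈ S.verts, ∀ b ∈ S.verts, a ≠ b → S.Adj a b) : S.coe = completeGraph S.verts := by
  ext a b
  simp only [Subgraph.coe_adj, completeGraph, top_adj]
  exact ⟨fun h' hab => h'.ne (congrArg Subtype.val hab), fun hab =>
    h a a.2 b b.2 fun h' => hab (Subtype.ext h')⟩

theorem nonempty_iso_completeGraph {V : Type*} {G : SimpleGraph V} (S : G.Subgraph) (K : Finset V)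
    (k : ℕ) (hK : K.card = k) (hS : S.verts = K)
    (h : ∀ a ∈ K, ∀ b ∈ K, a ≠ b → S.Adj a b) :
    Nonempty (S.coe ≃g completeGraph (Fin k)) := by
  rw [coe_eq_top_of_clique S (by rw [hS]; simpa using h)]
  have hcard : Nat.card S.verts = k := by rw [hS]; simp [hK]
  have : Finite S.verts := by rw [hS]; exact Finset.finite_toSet K
  exact ⟨Iso.completeGraph (Finite.equivFinOfCardEq hcard)⟩

section
variable {V : Type*} [Fintype V] [DecidableEq V] {G : SimpleGraph V}

/-- If a clique `K` with at least two vertices separates off `C`, then a stable cutset of the graph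
induced on `C ∪ K` is one of `G`. -/
theorem not_hasStableCut_induce_of_clique (hG : ¬ G.HasStableCut) {K C : Set V}
    (hK : ∀ a ∈ K, ∀ b ∈ K, a ≠ b → G.Adj a b) (hK2 : ∃ a ∈ K, ∃ b ∈ K, a ≠ b)
    (hcl : ∀ a ∈ C, ∀ b, G.Adj a b → b ∈ C ∨ b ∈ K) :
    ¬ (G.induce (C ∪ K)).HasStableCut := by
  rintro ⟨S, hS, D, ⟨d, hd⟩, hDS, ⟨q, hqD, hqS⟩, hDcl⟩
  apply hG
  have hS' : G.IsIndepSet ((↑) '' S : Set V) := by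
    apply isIndepSet_of_forall
    rintro _ ⟨a, ha, rfl⟩ _ ⟨b, hb, rfl⟩ hab
    exact hS.not_adj ha hb hab
  obtain ⟨a, ha, b, hb, hab⟩ := hK2
  have hmem : ∀ {x : ↑(C ∪ K)} {T : Set ↑(C ∪ K)}, (x : V) ∈ (Subtype.val '' T : Set V) ↔ x ∈ T :=
    fun {x T} => Subtype.val_injective.mem_set_image
  obtain ⟨c, hcK, hcS⟩ : ∃ c : ↑(C ∪ K), (c : V) ∈ K ∧ c ∉ S := by
    by_contra hno
    push Not at hno
    exact hS.not_adj (hno ⟨a, Or.inr ha⟩ ha) (hno ⟨b, Or.inr hb⟩ hb) (hK a ha b hb hab)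
  -- replacing `D` by the other side of the cut if necessary, `D` misses `K`
  have main : ∀ D : Set ↑(C ∪ K), D.Nonempty → (∀ a ∈ D, a ∉ S) → c ∉ D →
      (∀ a ∈ D, ∀ b, (G.induce (C ∪ K)).Adj a b → b ∈ D ∨ b ∈ S) → G.HasStableCut := by
    rintro D ⟨d, hd⟩ hDS hcD hDcl
    have hDK : ∀ a ∈ D, (a : V) ∉ K := fun a ha haK => by
      have hac : (a : V) ≠ c := fun h => hcD (Subtype.ext h ▸ ha)
      rcases hDcl a ha c (hK a haK c hcK hac) with h | h
      · exact hcD h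
      · exact hcS h
    refine ⟨_, hS', (↑) '' D, ⟨d, hmem.2 hd⟩, ?_, ⟨c, fun h => hcD (hmem.1 h), fun h =>
      hcS (hmem.1 h)⟩, ?_⟩
    · rintro _ ⟨a, ha, rfl⟩ h
      exact hDS a ha (hmem.1 h)
    · rintro _ ⟨a, ha, rfl⟩ b hab
      have hb : b ∈ C ∪ K := hcl a (a.2.resolve_right (hDK a ha)) b hab
      rcases hDcl a ha ⟨b, hb⟩ hab with h | h
      · exact Or.inl ⟨_, h, rfl⟩
      · exact Or.inr ⟨_, h, rfl⟩
  by_cases hcD : c ∈ D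
  · refine main {x | x ∉ D ∧ x ∉ S} ⟨q, hqD, hqS⟩ (fun a ha => ha.2) (fun h => h.1 hcD) ?_
    intro x hx y hxy
    by_cases hyS : y ∈ S
    · exact Or.inr hyS
    · refine Or.inl ⟨fun hyD => ?_, hyS⟩
      rcases hDcl y hyD x hxy.symm with h | h
      · exact hx.1 h
      · exact hx.2 h
  · exact main D ⟨d, hd⟩ hDS hcD hDcl

end

theorem ec_induce {V : Type*} [DecidableEq V] (G : SimpleGraph V) (A : Finset V) :
    (G.induce (A : Set V)).ec univ univ = G.ec A A := by
  rw [ec_map (Function.Embedding.subtype _) (fun a b => by rfl)]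
  have : (univ : Finset (A : Set V)).map (Function.Embedding.subtype _) = A := by
    ext a
    simp
  rw [this]

namespace Crit

variable {V : Type u} [Fintype V] [DecidableEq V] {G : SimpleGraph V}

theorem not_separates_of_stable (hG : G.Crit) {K : Set V} (hK : ∀ a ∈ K, ∀ b ∈ K, ¬ G.Adj a b) :
    ¬ G.Separates K := fun h => hG.not_cut ⟨K, isIndepSet_of_forall hK, h⟩

/-- One side of a cutset that is a clique on two or three vertices is smaller than `G`, so it lies
in the class. -/
theorem inGsc_side (hG : G.Crit) {K P Q : Finset V} (hP : P.Nonempty) (hQ : Q.Nonempty)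
    (hPK : Disjoint P K) (hQK : Disjoint Q K) (hPQ : Disjoint P Q)
    (huniv : P ∪ Q ∪ K = univ) (hno : ∀ a ∈ P, ∀ b ∈ Q, ¬ G.Adj a b)
    (hK : ∀ a ∈ K, ∀ b ∈ K, a ≠ b → G.Adj a b) (hc : K.card = 2 ∨ K.card = 3) :
    InGsc (G.induce ((P ∪ K : Finset V) : Set V)) := by
  have hK2 : ∃ a ∈ (K : Set V), ∃ b ∈ (K : Set V), a ≠ b := by
    have := Finset.one_lt_card.1 (by omega : 1 < K.card)
    simpa using this
  have hcov : ∀ b, b ∈ P ∨ b ∈ Q ∨ b ∈ K := fun b => by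
    have : b ∈ P ∪ Q ∪ K := huniv ▸ Finset.mem_univ b
    simpa [or_assoc] using this
  have n1 : ¬ (G.induce ((P ∪ K : Finset V) : Set V)).HasStableCut := by
    rw [Finset.coe_union]
    refine not_hasStableCut_induce_of_clique hG.not_cut (by simpa using hK) hK2 ?_
    intro a ha b hab
    rcases hcov b with h | h | h
    · exact Or.inl h
    · exact absurd hab (hno a ha b h)
    · exact Or.inr h
  have n2 : ¬ (G.induce ((Q ∪ K : Finset V) : Set V)).HasStableCut := by
    rw [Finset.coe_union]
    refine not_hasStableCut_induce_of_clique hG.not_cut (by simpa using hK) hK2 ?_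
    intro a ha b hab
    rcases hcov b with h | h | h
    · exact absurd hab.symm (hno b h a ha)
    · exact Or.inl h
    · exact Or.inr h
  have hn := hP.card_pos
  have hn' := hQ.card_pos
  have hPQK : Disjoint (P ∪ Q) K := Finset.disjoint_union_left.2 ⟨hPK, hQK⟩
  have c1 : Fintype.card V = P.card + Q.card + K.card := by
    rw [← Finset.card_univ, ← huniv, Finset.card_union_of_disjoint hPQK,
      Finset.card_union_of_disjoint hPQ]
  have c2 := Finset.card_union_of_disjoint hPK
  have c3 := Finset.card_union_of_disjoint hQK
  have e1 : G.ec univ univ = G.ec P P + G.ec Q Q + G.ec K K + 2 * G.ec P K + 2 * G.ec Q K := by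
    rw [← huniv, ec_union_self G hPQK, ec_union_self G hPQ, ec_union_left G _ hPQ,
      ec_eq_zero G hno]
    ring
  have e2 := ec_union_self G hPK
  have e3 := ec_union_self G hQK
  have e4 := ec_clique G hK
  have e5 := hG.edges
  have e6 := le_ec_of_not_hasStableCut n2
  have cc : ∀ A : Finset V, Fintype.card ((A : Finset V) : Set V) = A.card := fun A => by simp
  rw [ec_induce, cc] at e6
  refine hG.min _ _ (by rw [cc]; omega) (by rw [cc]; omega) n1 ?_
  rw [ec_induce, cc]
  rcases hc with hc | hc <;> rw [hc] at e4 <;> norm_num at e4 <;> omega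

/-- A minimal counterexample has no cutset that is a clique on two or three vertices. -/
theorem not_separates_of_clique (hG : G.Crit) {K : Finset V}
    (hK : ∀ a ∈ K, ∀ b ∈ K, a ≠ b → G.Adj a b) (hc : K.card = 2 ∨ K.card = 3) :
    ¬ G.Separates (K : Set V) := by
  classical
  rintro ⟨C, ⟨c, hc'⟩, hCK, ⟨q, hqC, hqK⟩, hcl⟩
  set P : Finset V := univ.filter (· ∈ C) with hPdef
  set Q : Finset V := univ.filter (fun v => v ∉ C ∧ v ∉ K) with hQdef
  have mP : ∀ v, v ∈ P ↔ v ∈ C := fun v => by simp [P]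
  have mQ : ∀ v, v ∈ Q ↔ v ∉ C ∧ v ∉ K := fun v => by simp [Q]
  have hP : P.Nonempty := ⟨c, (mP c).2 hc'⟩
  have hQ : Q.Nonempty := ⟨q, (mQ q).2 ⟨hqC, hqK⟩⟩
  have hPK : Disjoint P K := Finset.disjoint_left.2 fun a ha => hCK a ((mP a).1 ha)
  have hQK : Disjoint Q K := Finset.disjoint_left.2 fun a ha => ((mQ a).1 ha).2
  have hPQ : Disjoint P Q := Finset.disjoint_left.2 fun a ha hb => ((mQ a).1 hb).1 ((mP a).1 ha)
  have hcov : ∀ b, b ∈ P ∨ b ∈ Q ∨ b ∈ K := fun b => by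
    rw [mP, mQ]; tauto
  have huniv : P ∪ Q ∪ K = univ := by
    ext b
    have := hcov b
    simp only [Finset.mem_union, Finset.mem_univ, iff_true]
    tauto
  have hno : ∀ a ∈ P, ∀ b ∈ Q, ¬ G.Adj a b := fun a ha b hb hab => by
    rw [mP] at ha
    rw [mQ] at hb
    rcases hcl a ha b hab with h | h
    · exact hb.1 h
    · exact hb.2 h
  have g1 := hG.inGsc_side hP hQ hPK hQK hPQ huniv hno hK hc
  have g2 := hG.inGsc_side hQ hP hQK hPK hPQ.symm (by rw [Finset.union_comm Q P, huniv])
    (fun a ha b hb hab => hno b hb a ha hab.symm) hK hc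
  rw [induce_eq_coe_induce_top] at g1 g2
  refine hG.not_gsc (InGsc.glue _ _ g1 g2 ?_ ?_)
  · ext a b
    · simp only [Subgraph.verts_sup, Subgraph.induce_verts, Subgraph.verts_top, Set.mem_univ,
        iff_true, Set.mem_union, Finset.mem_coe, Finset.mem_union]
      have := hcov a
      tauto
    · simp only [Subgraph.sup_adj, Subgraph.induce_adj, Subgraph.top_adj, Finset.mem_coe,
        Finset.mem_union]
      have h1 := hcov a
      have h2 := hcov b
      have h3 : a ∈ P → b ∈ Q → ¬ G.Adj a b := fun h h' => hno a h b h'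
      have h4 : a ∈ Q → b ∈ P → ¬ G.Adj a b := fun h h' h'' => hno b h' a h h''.symm
      constructor
      · rintro (h | h)
        · exact h.2.2
        · exact h.2.2
      · intro hab
        rcases h1 with h1 | h1 | h1 <;> rcases h2 with h2 | h2 | h2
        · exact Or.inl ⟨Or.inl h1, Or.inl h2, hab⟩
        · exact absurd hab (h3 h1 h2)
        · exact Or.inl ⟨Or.inl h1, Or.inr h2, hab⟩
        · exact absurd hab (h4 h1 h2)
        · exact Or.inr ⟨Or.inl h1, Or.inl h2, hab⟩
        · exact Or.inr ⟨Or.inl h1, Or.inr h2, hab⟩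
        · exact Or.inl ⟨Or.inr h1, Or.inl h2, hab⟩
        · exact Or.inr ⟨Or.inr h1, Or.inl h2, hab⟩
        · exact Or.inl ⟨Or.inr h1, Or.inr h2, hab⟩
  · have hv : ∀ k, K.card = k → Nonempty ((((⊤ : G.Subgraph).induce ((P ∪ K : Finset V) : Set V)) ⊓
        ((⊤ : G.Subgraph).induce ((Q ∪ K : Finset V) : Set V))).coe ≃g completeGraph (Fin k)) := by
      intro k hk
      refine nonempty_iso_completeGraph _ K k hk ?_ ?_
      · ext a
        simp only [Subgraph.verts_inf, Subgraph.induce_verts, Set.mem_inter_iff, Finset.mem_coe,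
          Finset.mem_union]
        have : a ∈ P → a ∈ Q → False := fun h h' => Finset.disjoint_left.1 hPQ h h'
        tauto
      · intro a ha b hb hab
        simp only [Subgraph.inf_adj, Subgraph.induce_adj, Subgraph.top_adj, Finset.mem_coe,
          Finset.mem_union]
        have := hK a ha b hb hab
        tauto
    rcases hc with h | h
    · exact Or.inl (hv _ h)
    · exact Or.inr (hv _ h)

theorem not_separates_pair (hG : G.Crit) (a b : V) : ¬ G.Separates {a, b} := by
  by_cases hab : G.Adj a b
  · have := hG.not_separates_of_clique (K := {a, b}) (by
      intro x hx y hy hxy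
      simp only [Finset.mem_insert, Finset.mem_singleton] at hx hy
      rcases hx with rfl | rfl <;> rcases hy with rfl | rfl
      · exact absurd rfl hxy
      · exact hab
      · exact hab.symm
      · exact absurd rfl hxy) (Or.inl (Finset.card_pair hab.ne))
    simpa using this
  · refine hG.not_separates_of_stable ?_
    rintro x (rfl | rfl) y (rfl | rfl) h
    · exact h.ne rfl
    · exact hab h
    · exact hab h.symm
    · exact h.ne rfl

end Crit

/-! ### Local structure of a minimal counterexample -/

section
variable {V : Type*} [DecidableEq V] {G : SimpleGraph V}

theorem SetConn.insert {Y : Finset V} (hY : G.SetConn Y) {v c : V} (hc : c ∈ Y)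
    (hvc : G.Adj v c) : G.SetConn (insert v Y) := by
  intro A hA hne hcl
  have h1 : (A ∩ Y).Nonempty → Y ⊆ A := fun h => by
    have := hY (A ∩ Y) Finset.inter_subset_right h (fun a ha b hb hab =>
      Finset.mem_inter.2 ⟨hcl a (Finset.mem_inter.1 ha).1 b (Finset.mem_insert_of_mem hb) hab, hb⟩)
    exact Finset.inter_eq_right.1 this
  by_cases hv : v ∈ A
  · have := h1 ⟨c, Finset.mem_inter.2 ⟨hcl v hv c (Finset.mem_insert_of_mem hc) hvc, hc⟩⟩
    exact hA.antisymm (Finset.insert_subset hv this)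
  · obtain ⟨a, ha⟩ := hne
    have haY : a ∈ Y := (Finset.mem_insert.1 (hA ha)).resolve_left fun h => hv (h ▸ ha)
    have := h1 ⟨a, Finset.mem_inter.2 ⟨ha, haY⟩⟩
    exact absurd (hcl c (this hc) v (Finset.mem_insert_self _ _) hvc.symm) hv

theorem separates_of_not_setConn [Fintype V] {X : Finset V} (h : ¬ G.SetConn (univ \ X)) :
    G.Separates (X : Set V) := by
  obtain ⟨A, B, ⟨a, ha⟩, ⟨b, hb⟩, hd, hAB, hno⟩ := exists_split_of_not_setConn h
  have key : ∀ v, v ∈ A ∨ v ∈ B ↔ v ∉ X := fun v => by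
    rw [← Finset.mem_union, hAB]; simp
  refine ⟨A, ⟨a, ha⟩, fun a ha => (key a).1 (Or.inl ha),
    ⟨b, fun h => Finset.disjoint_left.1 hd h hb, (key b).1 (Or.inr hb)⟩, fun a ha b hab => ?_⟩
  by_cases hbX : b ∈ X
  · exact Or.inr hbX
  · exact Or.inl (((key b).2 hbX).resolve_right fun h => hno a ha b h hab)

/-- `G` with the edges from `z` also attached to `a`. Deleting `z` from it identifies `a` and `z`. -/
def mergeInto (G : SimpleGraph V) (a z : V) : SimpleGraph V where
  Adj x y := x ≠ y ∧ (G.Adj x y ∨ (x = a ∧ G.Adj z y) ∨ (y = a ∧ G.Adj z x))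
  symm := ⟨fun x y h => ⟨h.1.symm, by rw [G.adj_comm y x]; tauto⟩⟩
  loopless := ⟨fun _ h => h.1 rfl⟩

/-- Identifying two nonadjacent vertices is a homomorphism, so it creates no stable cutset. -/
theorem not_hasStableCut_merge [Fintype V] (hG : ¬ G.HasStableCut) {a z : V} (haz : a ≠ z)
    (hna : ¬ G.Adj a z) :
    ¬ ((G.mergeInto a z).induce ((univ.erase z : Finset V) : Set V)).HasStableCut := by
  intro h
  refine hG (h.comap (fun v => if hv : v = z then ⟨a, by simpa using haz⟩ else
    ⟨v, by simpa using hv⟩) ?_ ?_)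
  · rintro ⟨v, hv⟩
    have hv' : v ≠ z := by simpa using hv
    exact ⟨v, by simp [hv']⟩
  · intro x y hxy
    by_cases hx : x = z <;> by_cases hy : y = z
    · subst hx hy; exact absurd hxy (G.irrefl)
    · subst hx
      have : y ≠ a := fun h => hna (h ▸ hxy.symm)
      simp [hy, mergeInto, hxy, this.symm]
    · subst hy
      have : x ≠ a := fun h => hna (h ▸ hxy)
      simp [hx, mergeInto, hxy.symm, this]
    · simp [hx, hy, mergeInto, hxy, hxy.ne]

theorem ec_merge [Fintype V] {a z : V} (haz : a ≠ z) (hna : ¬ G.Adj a z) {D : Finset V}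
    (hD : ∀ d ∈ D, G.Adj a d ∧ G.Adj z d) :
    (G.mergeInto a z).ec (univ.erase z) (univ.erase z) + 2 * D.card ≤ G.ec univ univ := by
  classical
  set R : Finset V := (univ.erase z).erase a with hR
  have hRa : a ∉ R := Finset.notMem_erase _ _
  have hRz : z ∉ R := fun h => Finset.notMem_erase z univ (Finset.mem_of_mem_erase h)
  have hz : insert a R = univ.erase z := Finset.insert_erase (by simpa using haz)
  have hu : insert z (insert a R) = univ := by rw [hz]; exact Finset.insert_erase (Finset.mem_univ z)
  have hRm : ∀ v, v ∈ R → v ≠ a ∧ v ≠ z := fun v hv => by simpa [hR] using hv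
  have e1 := ec_insert_self (G.mergeInto a z) hRa
  have e2 := ec_insert_self G hRa
  have e3 := ec_insert_self G (a := z) (A := insert a R) (by simpa [hRz] using haz.symm)
  have e4 : G.ec {z} (insert a R) = G.ec {z} R := by
    rw [Finset.insert_eq, ec_union_right G _ (by simpa using hRa),
      ec_eq_zero G (A := {z}) (B := {a}), zero_add]
    simpa using fun h => hna h.symm
  have e5 : (G.mergeInto a z).ec R R = G.ec R R := by
    unfold ec
    refine Finset.sum_congr rfl fun x hx => Finset.sum_congr rfl fun y hy => ?_
    have : (G.mergeInto a z).Adj x y ↔ G.Adj x y := by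
      simp only [mergeInto, (hRm x hx).1, (hRm y hy).1, false_and, or_false]
      exact ⟨fun h => h.2, fun h => ⟨h.ne, h⟩⟩
    simp only [this]
  have e6 : (G.mergeInto a z).ec {a} R + D.card ≤ G.ec {a} R + G.ec {z} R := by
    rw [ec_singleton_left, ec_singleton_left, ec_singleton_left,
      ← Finset.card_union_add_card_inter (R.filter (G.Adj a))]
    refine Nat.add_le_add (Finset.card_le_card fun v hv => ?_) (Finset.card_le_card fun v hv => ?_)
    · rw [Finset.mem_filter] at hv
      simp only [Finset.mem_union, Finset.mem_filter]
      have h1 := hRm v hv.1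
      have h2 := hv.2.2
      simp only [true_and, h1.1, false_and, or_false] at h2
      tauto
    · have h1 := hD v hv
      have hvR : v ∈ R := by
        simp only [hR, Finset.mem_erase, Finset.mem_univ, and_true]
        exact ⟨h1.1.ne', h1.2.ne'⟩
      simp [hvR, h1]
  rw [← hz, ← hu]
  rw [e1, e3, e2, e4, e5]
  omega

end

namespace Crit

variable {V : Type u} [Fintype V] [DecidableEq V] {G : SimpleGraph V}

/-- In a minimal counterexample, no connected proper set is sparse relative to the set of its
vertices that have neighbours outside. -/
theorem lt_of_setConn (hG : G.Crit) {Y K : Finset V} (hY : G.SetConn Y) (hKY : K ⊆ Y)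
    (hout : ∀ a ∈ Y, a ∉ K → ∀ b, G.Adj a b → b ∈ Y) (hq : ∃ q, q ∉ Y) :
    4 * Y.card < G.ec Y Y + 2 * K.card + 4 := by
  by_contra hlt
  obtain ⟨S, C, hSY, hCY, hC, hS, hCS, hCK, hcl⟩ :=
    exists_stable_cut_avoiding Y K hY hKY (by omega)
  obtain ⟨q, hq⟩ := hq
  rw [Finset.disjoint_left] at hCS hCK
  refine hG.not_cut ⟨S, hS, C, hC, fun a ha => hCS ha, ⟨q, fun h => hq (hCY h),
    fun h => hq (hSY h)⟩, fun a ha b hab => ?_⟩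
  exact hcl a ha b (hout a (hCY ha) (hCK ha) b hab) hab

/-- Each edge lies in at most one triangle. -/
theorem eq_of_common_of_adj (hG : G.Crit) {a b x y : V} (hab : G.Adj a b) (hax : G.Adj a x)
    (hbx : G.Adj b x) (hay : G.Adj a y) (hby : G.Adj b y) : x = y := by
  classical
  by_contra hxy
  set Y : Finset V := univ \ {a, b} with hYdef
  have mY : ∀ v, v ∈ Y ↔ v ≠ a ∧ v ≠ b := fun v => by simp [hYdef]
  have hd : Disjoint ({a, b} : Finset V) Y := Finset.disjoint_sdiff
  by_cases hc : G.SetConn Y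
  · have h1 := hG.lt_of_setConn (K := Y.filter (G.Adj a) ∪ Y.filter (G.Adj b)) hc
      (Finset.union_subset (Finset.filter_subset _ _) (Finset.filter_subset _ _)) (by
        intro v hv hvK w hvw
        rw [mY]
        simp only [Finset.mem_union, Finset.mem_filter, hv, true_and, not_or] at hvK
        constructor
        · rintro rfl; exact hvK.1 hvw.symm
        · rintro rfl; exact hvK.2 hvw.symm) ⟨a, by simp [mY]⟩
    have h2 := Finset.card_union_add_card_inter (Y.filter (G.Adj a)) (Y.filter (G.Adj b))
    have h3 : 2 ≤ (Y.filter (G.Adj a) ∩ Y.filter (G.Adj b)).card := by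
      rw [← Finset.card_pair hxy]
      refine Finset.card_le_card ?_
      intro v hv
      simp only [Finset.mem_insert, Finset.mem_singleton] at hv
      simp only [Finset.mem_inter, Finset.mem_filter, mY]
      rcases hv with rfl | rfl
      · exact ⟨⟨⟨hax.ne', hbx.ne'⟩, hax⟩, ⟨hax.ne', hbx.ne'⟩, hbx⟩
      · exact ⟨⟨⟨hay.ne', hby.ne'⟩, hay⟩, ⟨hay.ne', hby.ne'⟩, hby⟩
    rw [← ec_singleton_left, ← ec_singleton_left] at h2
    have hu : {a, b} ∪ Y = univ := by rw [hYdef]; simp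
    have e1 := ec_union_self G hd
    have e2 : G.ec {a, b} Y = G.ec {a} Y + G.ec {b} Y := by
      rw [Finset.insert_eq, ec_union_left G _ (by simpa using hab.ne)]
    have e3 : G.ec {a, b} {a, b} = 2 * G.ec {a} {b} := by
      rw [Finset.insert_eq, ec_union_self G (by simpa using hab.ne), ec_singleton_self,
        ec_singleton_self]; ring
    have e4 : G.ec {a} {b} ≤ 1 := ec_singleton_left_le G a {b}
    have e4' : 1 ≤ G.ec {a} {b} := by
      have := card_le_ec_singleton G (a := a) (B := {b}) (D := {b}) (by simp) (by simpa using hab)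
      simpa using this
    have c1 : Y.card + 2 = Fintype.card V := by
      rw [← Finset.card_pair hab.ne, ← Finset.card_univ, ← hu, Finset.card_union_of_disjoint hd]
      ring
    have := hG.edges
    rw [hu] at e1
    omega
  · have := separates_of_not_setConn hc
    exact hG.not_separates_pair a b (by simpa using this)

/-- Nonadjacent vertices have at most two common neighbours. -/
theorem card_common_le (hG : G.Crit) {a z : V} (haz : a ≠ z) (hna : ¬ G.Adj a z) {D : Finset V}
    (hD : ∀ d ∈ D, G.Adj a d ∧ G.Adj z d) : D.card ≤ 2 := by
  by_contra hlt
  refine not_hasStableCut_merge hG.not_cut haz hna (hasStableCut_of_ec_le ?_)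
  have h1 := ec_merge haz hna hD
  have h2 := hG.edges
  have h3 : Fintype.card ((univ.erase z : Finset V) : Set V) + 1 = Fintype.card V := by
    rw [← Finset.card_univ (α := V), ← Finset.card_erase_add_one (Finset.mem_univ z)]
    simp
  rw [ec_induce]
  omega

theorem not_subset_pair_of_adj (hG : G.Crit) {v x y : V} (hvx : v ≠ x) (hvy : v ≠ y)
    (h : ∀ u, G.Adj v u → u = x ∨ u = y) : False := by
  refine hG.not_separates_pair x y ⟨{v}, ⟨v, rfl⟩, by simp [hvx, hvy], ?_, ?_⟩
  · by_contra hno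
    push Not at hno
    have : (univ : Finset V) ⊆ {v, x, y} := fun q _ => by
      have := hno q
      simp only [Set.mem_singleton_iff, Set.mem_insert_iff] at this
      simp only [Finset.mem_insert, Finset.mem_singleton]
      tauto
    have h1 := Finset.card_le_card this
    have h2 := hG.four_le
    have h3 := Finset.card_le_three (a := v) (b := x) (c := y)
    rw [Finset.card_univ] at h1
    omega
  · rintro a rfl b hab
    exact Or.inr (by simpa using h b hab)

theorem exists_ne (hG : G.Crit) (x y z : V) : ∃ v, v ≠ x ∧ v ≠ y ∧ v ≠ z := by
  by_contra hno
  push Not at hno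
  have : (univ : Finset V) ⊆ {x, y, z} := fun q _ => by
    have := hno q
    simp only [Finset.mem_insert, Finset.mem_singleton]
    tauto
  have h1 := Finset.card_le_card this
  have h2 := hG.four_le
  have h3 := Finset.card_le_three (a := x) (b := y) (c := z)
  rw [Finset.card_univ] at h1
  omega

/-- Each vertex has degree at least three. -/
theorem exists_adj_ne (hG : G.Crit) (v x y : V) : ∃ u, G.Adj v u ∧ u ≠ x ∧ u ≠ y := by
  by_contra hno
  push Not at hno
  have hno' : ∀ u, G.Adj v u → u = x ∨ u = y := fun u hu => by
    have := hno u hu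
    tauto
  obtain ⟨r, hr, -, -⟩ := hG.exists_ne v v v
  -- a value equal to `v` itself is replaced by one that is not
  have : ∀ x y, v ≠ x → (∀ u, G.Adj v u → u = x ∨ u = y) → False := by
    intro x y hvx h
    by_cases hvy : v = y
    · subst hvy
      exact hG.not_subset_pair_of_adj hvx hvx fun u hu => Or.inl ((h u hu).resolve_right hu.ne')
    · exact hG.not_subset_pair_of_adj hvx hvy h
  by_cases hvx : v = x
  · subst hvx
    exact this r y hr.symm fun u hu => Or.inr ((hno' u hu).resolve_left hu.ne')
  · exact this x y hvx hno'

/-- Each vertex lies in a triangle. -/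
theorem exists_triangle (hG : G.Crit) (v : V) : ∃ p q, G.Adj v p ∧ G.Adj v q ∧ G.Adj p q := by
  by_contra hno
  push Not at hno
  have hst : ∀ a ∈ {u | G.Adj v u}, ∀ b ∈ {u | G.Adj v u}, ¬ G.Adj a b := fun a ha b hb =>
    hno a b ha hb
  obtain ⟨x, hx, -, -⟩ := hG.exists_adj_ne v v v
  obtain ⟨y, hy, hyv, -⟩ := hG.exists_adj_ne x v v
  exact hG.not_separates_of_stable hst ⟨{v}, ⟨v, rfl⟩, by simp,
    ⟨y, hyv, fun h => hno x y hx h hy⟩, by rintro a rfl b hab; exact Or.inr hab⟩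

/-- A path on three vertices whose ends are not adjacent is not a cutset. -/
theorem not_separates_path (hG : G.Crit) {s x w : V} (hsx : G.Adj s x) (hxw : G.Adj x w)
    (hsw : s ≠ w) (hnsw : ¬ G.Adj s w) : ¬ G.Separates {s, x, w} := by
  classical
  -- every part cut off has many edges, inside or to the cutset
  have claim : ∀ n, ∀ C : Finset V, C.card = n → C.Nonempty → s ∉ C → x ∉ C → w ∉ C →
      (∀ a ∈ C, ∀ b, G.Adj a b → b ∈ C ∨ b = s ∨ b = x ∨ b = w) →
      4 * C.card + 2 ≤ G.ec C C + 2 * (G.ec {s} C + G.ec {x} C + G.ec {w} C) := by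
    intro n
    induction n using Nat.strong_induction_on with
    | _ n IH =>
    intro C hCn hC hs hx hw hcl
    obtain ⟨c, hc⟩ := hC
    by_cases hconn : G.SetConn C
    · have fs : ∃ d ∈ C, G.Adj s d := by
        by_contra hno
        push Not at hno
        refine hG.not_separates_pair x w ⟨C, ⟨c, hc⟩, ?_, ⟨s, hs, by simp [hsx.ne, hsw]⟩, ?_⟩
        · rintro a ha (rfl | rfl)
          · exact hx ha
          · exact hw ha
        · intro a ha b hab
          rcases hcl a ha b hab with h | rfl | rfl | rfl
          · exact Or.inl h
          · exact absurd hab.symm (hno a ha)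
          · simp
          · simp
      have fw : ∃ d ∈ C, G.Adj w d := by
        by_contra hno
        push Not at hno
        refine hG.not_separates_pair s x ⟨C, ⟨c, hc⟩, ?_, ⟨w, hw, by simp [hxw.ne', hsw.symm]⟩, ?_⟩
        · rintro a ha (rfl | rfl)
          · exact hs ha
          · exact hx ha
        · intro a ha b hab
          rcases hcl a ha b hab with h | rfl | rfl | rfl
          · exact Or.inl h
          · simp
          · simp
          · exact absurd hab.symm (hno a ha)
      obtain ⟨d, hd, hsd⟩ := fs
      obtain ⟨d', hd', hwd⟩ := fw
      have hY : G.SetConn (insert s (insert w C)) :=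
        (hconn.insert hd' hwd).insert (Finset.mem_insert_of_mem hd) hsd
      have hs' : s ∉ insert w C := by simp [hsw, hs]
      have h1 := hG.lt_of_setConn (K := insert s (insert w (C.filter (G.Adj x)))) hY
        (Finset.insert_subset_insert _ (Finset.insert_subset_insert _ (Finset.filter_subset _ _)))
        (by
          intro a ha haK b hab
          simp only [Finset.mem_insert, Finset.mem_filter, not_or, not_and] at ha haK ⊢
          have haC : a ∈ C := by tauto
          rcases hcl a haC b hab with h | rfl | rfl | rfl
          · tauto
          · tauto
          · exact absurd hab.symm (haK.2.2 haC)
          · tauto) ⟨x, by simp [hsx.ne', hxw.ne, hx]⟩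
      have h2 : (insert s (insert w (C.filter (G.Adj x)))).card ≤ (C.filter (G.Adj x)).card + 2 :=
        (Finset.card_insert_le _ _).trans (Nat.add_le_add_right (Finset.card_insert_le _ _) 1)
      rw [← ec_singleton_left] at h2
      have c1 := Finset.card_insert_of_notMem hs'
      have c2 := Finset.card_insert_of_notMem hw
      have e1 := ec_insert_self G hs'
      have e2 := ec_insert_self G hw
      have e3 : G.ec {s} (insert w C) = G.ec {s} C := by
        rw [Finset.insert_eq, ec_union_right G _ (by simpa using hw),
          ec_eq_zero G (A := {s}) (B := {w}), zero_add]
        simpa using hnsw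
      obtain ⟨r, hr⟩ := even_ec_self G C
      omega
    · obtain ⟨A, B, hA, hB, hd, rfl, hno⟩ := exists_split_of_not_setConn hconn
      have cu := Finset.card_union_of_disjoint hd
      have hAp := hA.card_pos
      have hBp := hB.card_pos
      simp only [Finset.mem_union, not_or] at hs hx hw
      have i1 := IH A.card (by omega) A rfl hA hs.1 hx.1 hw.1 (fun a ha b hab => by
        rcases hcl a (Finset.mem_union_left _ ha) b hab with h | h
        · exact Or.inl ((Finset.mem_union.1 h).resolve_right fun h' => hno a ha b h' hab)
        · exact Or.inr h)
      have i2 := IH B.card (by omega) B rfl hB hs.2 hx.2 hw.2 (fun a ha b hab => by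
        rcases hcl a (Finset.mem_union_right _ ha) b hab with h | h
        · exact Or.inl ((Finset.mem_union.1 h).resolve_left fun h' => hno b h' a ha hab.symm)
        · exact Or.inr h)
      rw [ec_union_self G hd, ec_eq_zero G hno, ec_union_right G _ hd, ec_union_right G _ hd,
        ec_union_right G _ hd]
      omega
  rintro ⟨C, ⟨c, hc⟩, hCK, ⟨q, hqC, hqK⟩, hcl⟩
  set T : Finset V := {s, x, w} with hT
  set P : Finset V := univ.filter (· ∈ C) with hPdef
  set Q : Finset V := univ.filter (fun v => v ∉ C ∧ v ∉ T) with hQdef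
  have mT : ∀ v, v ∈ T ↔ v = s ∨ v = x ∨ v = w := fun v => by simp [T]
  have mP : ∀ v, v ∈ P ↔ v ∈ C := fun v => by simp [P]
  have mQ : ∀ v, v ∈ Q ↔ v ∉ C ∧ ¬ (v = s ∨ v = x ∨ v = w) := fun v => by simp [Q, T]
  have hCT : ∀ a ∈ C, a ∉ T := fun a ha h => hCK a ha (by simpa [T] using h)
  have hcl' : ∀ a ∈ C, ∀ b, G.Adj a b → b ∈ C ∨ b = s ∨ b = x ∨ b = w := fun a ha b hab => by
    simpa using hcl a ha b hab
  have hno : ∀ a ∈ P, ∀ b ∈ Q, ¬ G.Adj a b := fun a ha b hb hab => by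
    rw [mQ] at hb
    have := hcl' a ((mP a).1 ha) b hab
    tauto
  have hPQ : Disjoint P Q := Finset.disjoint_left.2 fun a ha hb => ((mQ a).1 hb).1 ((mP a).1 ha)
  have hPQT : Disjoint (P ∪ Q) T := Finset.disjoint_left.2 fun a ha haT => by
    rw [Finset.mem_union, mP, mQ, ← mT] at ha
    rcases ha with h | h
    · exact hCT a h haT
    · exact h.2 haT
  have hu : P ∪ Q ∪ T = univ := by
    ext v
    simp only [Finset.mem_union, mP, mQ, mT, Finset.mem_univ, iff_true]
    tauto
  have nP : ∀ v, v = s ∨ v = x ∨ v = w → v ∉ P := fun v hv h => hCT v ((mP v).1 h) ((mT v).2 hv)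
  have nQ : ∀ v, v = s ∨ v = x ∨ v = w → v ∉ Q := fun v hv h => ((mQ v).1 h).2 hv
  have i1 := claim _ P rfl ⟨c, (mP c).2 hc⟩ (nP s (by simp)) (nP x (by simp)) (nP w (by simp))
    (fun a ha b hab => by rw [mP] at ha ⊢; exact hcl' a ha b hab)
  have i2 := claim _ Q rfl ⟨q, (mQ q).2 ⟨hqC, by simpa using hqK⟩⟩ (nQ s (by simp))
    (nQ x (by simp)) (nQ w (by simp)) (fun a ha b hab => by
      have h1 : b ∉ P := fun hb => hno b hb a ha hab.symm
      rw [mP] at h1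
      rw [mQ]
      tauto)
  have hTd : Disjoint ({s} : Finset V) ({x} ∪ {w}) := by simp [hsx.ne, hsw]
  have hxwd : Disjoint ({x} : Finset V) {w} := by simp [hxw.ne]
  have hTeq : T = {s} ∪ ({x} ∪ {w}) := by rw [hT]; rfl
  have e0 : ∀ B, G.ec T B = G.ec {s} B + G.ec {x} B + G.ec {w} B := fun B => by
    rw [hTeq, ec_union_left G _ hTd, ec_union_left G _ hxwd, add_assoc]
  have e1 : G.ec univ univ = G.ec P P + G.ec Q Q + G.ec T T + 2 * (G.ec T P + G.ec T Q) := by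
    rw [← hu, ec_union_self G hPQT, ec_union_self G hPQ, ec_eq_zero G hno, ec_comm G (P ∪ Q) T,
      ec_union_right G _ hPQ]
    ring
  rw [e0 P, e0 Q] at e1
  have a1 : 1 ≤ G.ec {s} {x} := by
    simpa using card_le_ec_singleton G (a := s) (B := {x}) (D := {x}) (by simp) (by simpa using hsx)
  have a2 : 1 ≤ G.ec {x} {w} := by
    simpa using card_le_ec_singleton G (a := x) (B := {w}) (D := {w}) (by simp) (by simpa using hxw)
  have e2 : 4 ≤ G.ec T T := by
    rw [hTeq, ec_union_self G hTd, ec_union_self G hxwd, ec_union_right G _ hxwd]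
    omega
  have c1 : Fintype.card V = P.card + Q.card + 3 := by
    rw [← Finset.card_univ, ← hu, Finset.card_union_of_disjoint hPQT,
      Finset.card_union_of_disjoint hPQ, hTeq, Finset.card_union_of_disjoint hTd,
      Finset.card_union_of_disjoint hxwd]
    simp
  have := hG.edges
  omega

end Crit

/-! ### Rings of triangle edges -/

section
variable {V : Type*} {G : SimpleGraph V}

/-- The edge `uv` exists and lies in a triangle. -/
def TAdj (G : SimpleGraph V) (u v : V) : Prop := G.Adj u v ∧ ∃ w, G.Adj u w ∧ G.Adj v w

theorem TAdj.symm {u v : V} (h : G.TAdj u v) : G.TAdj v u :=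
  ⟨h.1.symm, h.2.imp fun _ hw => ⟨hw.2, hw.1⟩⟩

theorem tAdj_of_triangle {u v w : V} (h1 : G.Adj u v) (h2 : G.Adj u w) (h3 : G.Adj v w) :
    G.TAdj u v := ⟨h1, w, h2, h3⟩

/-- A ring: a cycle of length at least four, given as a list of distinct vertices, such that each
edge between consecutive vertices lies in a triangle. The edge from the last vertex back to the
first need not lie in a triangle, so rings can be reversed but not rotated. -/
def IsRing (G : SimpleGraph V) (l : List V) : Prop :=
  4 ≤ l.length ∧ l.Nodup ∧ l.IsChain G.TAdj ∧ ∀ a ∈ l.head?, ∀ b ∈ l.getLast?, G.Adj a b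

/-- No two vertices at distance two in the list are equal or adjacent, so that consecutive edges
lie in different triangles. -/
def Turning (G : SimpleGraph V) (l : List V) : Prop :=
  ∀ a b c, [a, b, c] <:+: l → a ≠ c ∧ ¬ G.Adj a c

/-- The vertex `v` lies in two triangles. -/
def Multi (G : SimpleGraph V) (v : V) : Prop :=
  ∃ p r, G.TAdj v p ∧ G.TAdj v r ∧ p ≠ r ∧ ¬ G.Adj p r

theorem isChain_reverse_tAdj {l : List V} (h : l.IsChain G.TAdj) : l.reverse.IsChain G.TAdj := by
  rw [List.isChain_reverse]
  exact h.imp fun _ _ h => h.symm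

theorem IsRing.reverse {l : List V} (h : G.IsRing l) : G.IsRing l.reverse := by
  refine ⟨by simpa using h.1, List.nodup_reverse.2 h.2.1, isChain_reverse_tAdj h.2.2.1, ?_⟩
  intro a ha b hb
  rw [List.head?_reverse] at ha
  rw [List.getLast?_reverse] at hb
  exact (h.2.2.2 b hb a ha).symm

theorem Turning.of_infix {l l' : List V} (h : G.Turning l) (hl : l' <:+: l) : G.Turning l' :=
  fun a b c habc => h a b c (habc.trans hl)

theorem Turning.reverse {l : List V} (h : G.Turning l) : G.Turning l.reverse := by
  intro a b c habc
  have := h c b a (by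
    rw [← List.reverse_infix]
    simpa using habc)
  exact ⟨this.1.symm, fun h' => this.2 h'.symm⟩

theorem Turning.cons {u p q : V} {l : List V} (h : G.Turning (p :: q :: l)) (hne : u ≠ q)
    (hna : ¬ G.Adj u q) : G.Turning (u :: p :: q :: l) := by
  intro a b c habc
  rcases List.infix_cons_iff.1 habc with h' | h'
  · simp only [List.cons_prefix_cons] at h'
    obtain ⟨rfl, rfl, rfl, -⟩ := h'
    exact ⟨hne, hna⟩
  · exact h a b c h'

theorem turning_of_length_le_two {l : List V} (h : l.length ≤ 2) : G.Turning l := by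
  intro a b c habc
  have := habc.length_le
  simp at this
  omega

end

/-- Any two vertices have at most one common neighbour. -/
def UniqueCommon {V : Type*} (G : SimpleGraph V) : Prop :=
  ∀ a b c d, a ≠ b → G.Adj a c → G.Adj b c → G.Adj a d → G.Adj b d → c = d

section
variable {V : Type*} {G : SimpleGraph V}

theorem Multi.exists_turn (hU : G.UniqueCommon) {v u : V} (hv : G.Multi v) (hu : G.TAdj v u) :
    ∃ w, G.TAdj v w ∧ w ≠ u ∧ ¬ G.Adj w u := by
  obtain ⟨p, r, hp, hr, hpr, hn⟩ := hv
  by_contra hno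
  push Not at hno
  by_cases h1 : p = u
  · subst h1
    exact hn (hno r hr hpr.symm).symm
  by_cases h2 : r = u
  · subst h2
    exact hn (hno p hp h1)
  exact hpr (hU v u p r hu.1.ne hp.1 (hno p hp h1).symm hr.1 (hno r hr h2).symm)

end

namespace Crit

variable {V : Type u} [Fintype V] [DecidableEq V] {G : SimpleGraph V}

/-- Of two vertices of a triangle, one lies in a second triangle: otherwise the neighbourhood of
the edge between them is stable, and cuts it off. -/
theorem multi_or_multi (hG : G.Crit) (hU : G.UniqueCommon) {x y z : V} (hxy : G.Adj x y)
    (hxz : G.Adj x z) (hyz : G.Adj y z) : G.Multi x ∨ G.Multi y := by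
  by_contra hno
  rw [not_or] at hno
  have single : ∀ {x y z : V}, ¬ G.Multi x → G.Adj x y → G.Adj x z → G.Adj y z →
      ∀ {p q}, G.Adj x p → G.Adj x q → G.Adj p q → p ≠ y → q ≠ y → False := by
    intro x y z hx hxy hxz hyz p q hp hq hpq hpy hqy
    by_cases h : G.Adj p y
    · exact hqy (hU x p q y hp.ne hq hpq hxy h)
    · exact hx ⟨p, y, tAdj_of_triangle hp hq hpq, tAdj_of_triangle hxy hxz hyz, hpy, h⟩
  set K : Set V := {u | (G.Adj x u ∨ G.Adj y u) ∧ u ≠ x ∧ u ≠ y} with hK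
  have hst : ∀ a ∈ K, ∀ b ∈ K, ¬ G.Adj a b := by
    rintro a ⟨ha, hax, hay⟩ b ⟨hb, hbx, hby⟩ hab
    have cross : ∀ {a b}, G.Adj x a → G.Adj y b → G.Adj a b → a ≠ x → a ≠ y → b ≠ x → b ≠ y →
        False := by
      intro a b ha hb hab hax hay hbx hby
      exact hay (hU x b a y hbx.symm ha hab.symm hxy hb.symm)
    rcases ha with ha | ha <;> rcases hb with hb | hb
    · exact single hno.1 hxy hxz hyz ha hb hab hay hby
    · exact cross ha hb hab hax hay hbx hby
    · exact cross hb ha hab.symm hbx hby hax hay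
    · exact single hno.2 hxy.symm hyz hxz ha hb hab hax hbx
  have hz : z ∈ K := ⟨Or.inl hxz, hxz.ne', hyz.ne'⟩
  refine hG.not_separates_of_stable hst ⟨{x, y}, ⟨x, by simp⟩, ?_, ?_, ?_⟩
  · rintro a (rfl | rfl) h
    · exact h.2.1 rfl
    · exact h.2.2 rfl
  · obtain ⟨q, hzq, hqx, hqy⟩ := hG.exists_adj_ne z x y
    exact ⟨q, by simp [hqx, hqy], fun h => hst z hz q h hzq⟩
  · intro a ha b hab
    by_cases h1 : b = x
    · simp [h1]
    by_cases h2 : b = y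
    · simp [h2]
    rcases ha with rfl | rfl
    · exact Or.inr ⟨Or.inl hab, h1, h2⟩
    · exact Or.inr ⟨Or.inr hab, h1, h2⟩

theorem exists_multi_tAdj (hG : G.Crit) (hU : G.UniqueCommon) {v w : V} (h : G.TAdj v w) :
    ∃ u, G.Multi u ∧ G.TAdj v u := by
  obtain ⟨hvw, w', hv', hw'⟩ := h
  rcases hG.multi_or_multi hU hw' hvw.symm hv'.symm with h | h
  · exact ⟨w, h, hvw, w', hv', hw'⟩
  · exact ⟨w', h, hv', w, hvw, hw'.symm⟩

theorem exists_multi_turn (hG : G.Crit) (hU : G.UniqueCommon) {v p : V} (hv : G.Multi v)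
    (hp : G.TAdj v p) : ∃ u, G.Multi u ∧ G.TAdj v u ∧ u ≠ p ∧ ¬ G.Adj u p := by
  obtain ⟨w, ⟨hvw, w', hv', hw'⟩, hwp, hnwp⟩ := hv.exists_turn hU hp
  rcases hG.multi_or_multi hU hw' hvw.symm hv'.symm with h | h
  · exact ⟨w, h, ⟨hvw, w', hv', hw'⟩, hwp, hnwp⟩
  · refine ⟨w', h, ⟨hv', w, hvw, hw'.symm⟩, ?_, ?_⟩
    · rintro rfl
      exact hnwp hw'
    · intro hadj
      exact hwp (hU v w' w p hv'.ne hvw hw'.symm hp.1 hadj)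

/-- A set without rings that contains a vertex in two triangles has an ear: a turning path of
triangle edges with its interior in the set and its ends outside. It extends a longest turning
path of vertices of the set that lie in two triangles. -/
theorem exists_ear (hG : G.Crit) (hU : G.UniqueCommon) (Ω : Finset V)
    (hΩ : ∀ l, G.IsRing l → ∃ v ∈ l, v ∉ Ω) {y : V} (hy : y ∈ Ω) (hym : G.Multi y) :
    ∃ z P z', P ≠ [] ∧ (∀ p ∈ P, p ∈ Ω) ∧ P.Nodup ∧ z ∉ Ω ∧ z' ∉ Ω ∧
      (z :: (P ++ [z'])).IsChain G.TAdj ∧ G.Turning (z :: (P ++ [z'])) := by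
  set Good : List V → Prop := fun P => P ≠ [] ∧ (∀ p ∈ P, p ∈ Ω ∧ G.Multi p) ∧ P.Nodup ∧
    P.IsChain G.TAdj ∧ G.Turning P with hGood
  obtain ⟨P, hP, hmax⟩ : ∃ P, Good P ∧ ∀ Q, Good Q → Q.length ≤ P.length := by
    have hne : {n | ∃ P, Good P ∧ P.length = n}.Nonempty :=
      ⟨1, [y], ⟨by simp, by simpa using ⟨hy, hym⟩, by simp, by simp,
        turning_of_length_le_two (by simp)⟩, rfl⟩
    have hbdd : BddAbove {n | ∃ P, Good P ∧ P.length = n} := by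
      refine ⟨Fintype.card V, ?_⟩
      rintro _ ⟨P, hP, rfl⟩
      exact hP.2.2.1.length_le_card
    obtain ⟨P, hP, hPl⟩ := Nat.sSup_mem hne hbdd
    exact ⟨P, hP, fun Q hQ => hPl ▸ le_csSup hbdd ⟨Q, hQ, rfl⟩⟩
  -- an extension of a longest path leaves `Ω`
  have escape : ∀ P, Good P → (∀ Q, Good Q → Q.length ≤ P.length) → ∀ u, G.Multi u →
      (u :: P).IsChain G.TAdj → G.Turning (u :: P) → u ∉ Ω := by
    intro P hP hmax u hu hch htu huΩ
    by_cases huP : u ∈ P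
    · obtain ⟨l₁, l₂, rfl⟩ := List.append_of_mem huP
      obtain ⟨-, hmem, hnd, hch', -⟩ := hP
      have hring : G.IsRing (l₁ ++ [u]) := by
        refine ⟨?_, hnd.sublist (by simp), ?_, ?_⟩
        · match l₁ with
          | [] => simp [TAdj] at hch
          | [p] => exact absurd rfl (htu u p u ⟨[], l₂, by simp⟩).1
          | [p, q] =>
            have h1 := (htu u p q ⟨[], u :: l₂, by simp⟩).2
            simp only [List.cons_append, List.nil_append, List.isChain_cons_cons] at hch'
            exact absurd hch'.2.1.1.symm h1
          | _ :: _ :: _ :: _ => simp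
        · simp only [List.isChain_append, List.isChain_cons] at hch' ⊢
          simp_all
        · match l₁ with
          | [] => simp [TAdj] at hch
          | p :: l =>
            simp only [List.cons_append, List.isChain_cons_cons] at hch
            intro a ha b hb
            rw [List.getLast?_append] at hb
            simp only [List.cons_append, List.head?_cons, Option.mem_def, Option.some.injEq,
              List.getLast?_singleton, Option.some_or] at ha hb
            subst ha hb
            exact hch.1.1.symm
      obtain ⟨v, hv, hvΩ⟩ := hΩ _ hring
      refine hvΩ (hmem v ?_).1
      simp only [List.mem_append, List.mem_cons, List.not_mem_nil, or_false] at hv ⊢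
      tauto
    · have := hmax (u :: P) ⟨by simp, by
        intro p hp
        rcases List.mem_cons.1 hp with rfl | h
        · exact ⟨huΩ, hu⟩
        · exact hP.2.1 p h, List.nodup_cons.2 ⟨huP, hP.2.2.1⟩, hch, htu⟩
      simp at this
  obtain ⟨z, hz, hzch, hzt⟩ : ∃ z, G.Multi z ∧ (z :: P).IsChain G.TAdj ∧ G.Turning (z :: P) := by
    match P with
    | [] => exact absurd rfl hP.1
    | [p] =>
      obtain ⟨r, -, hr, -⟩ := (hP.2.1 p (by simp)).2
      obtain ⟨u, hu, hpu⟩ := hG.exists_multi_tAdj hU hr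
      exact ⟨u, hu, by simpa using hpu.symm, turning_of_length_le_two (by simp)⟩
    | p :: q :: l =>
      have h1 := hP.2.2.2.1
      obtain ⟨u, hu, hpu, hne, hna⟩ := hG.exists_multi_turn hU (hP.2.1 p (by simp)).2
        (List.isChain_cons_cons.1 h1).1
      exact ⟨u, hu, List.isChain_cons_cons.2 ⟨hpu.symm, h1⟩, hP.2.2.2.2.cons hne hna⟩
  have hzΩ := escape P hP hmax z hz hzch hzt
  obtain ⟨q, hq⟩ : ∃ q, q = (z :: P).reverse := ⟨_, rfl⟩
  have hqch : q.IsChain G.TAdj := hq ▸ isChain_reverse_tAdj hzch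
  have hqt : G.Turning q := hq ▸ hzt.reverse
  have hPr : Good P.reverse := ⟨by simpa using hP.1, by simpa using hP.2.1,
    List.nodup_reverse.2 hP.2.2.1, isChain_reverse_tAdj hP.2.2.2.1, hP.2.2.2.2.reverse⟩
  have hqlen : 2 ≤ q.length := by
    have := List.length_pos_iff.2 hP.1
    rw [hq]; simp; omega
  obtain ⟨z', hz', hzch', hzt'⟩ : ∃ z', G.Multi z' ∧ (z' :: q).IsChain G.TAdj ∧
      G.Turning (z' :: q) := by
    match q, hqlen with
    | a :: b :: l, _ =>
      have ha : a ∈ P := by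
        rw [List.reverse_cons] at hq
        match hPr' : P.reverse with
        | [] => simp at hPr'; exact absurd hPr' hP.1
        | c :: l' =>
          rw [hPr'] at hq
          simp only [List.cons_append, List.cons.injEq] at hq
          rw [hq.1, ← List.mem_reverse, hPr']
          simp
      obtain ⟨u, hu, hpu, hne, hna⟩ := hG.exists_multi_turn hU (hP.2.1 a ha).2
        (List.isChain_cons_cons.1 hqch).1
      exact ⟨u, hu, List.isChain_cons_cons.2 ⟨hpu.symm, hqch⟩, hqt.cons hne hna⟩
  have hinf : z' :: P.reverse <+: z' :: q := by
    rw [hq, List.reverse_cons]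
    exact ⟨[z], by simp⟩
  have hzΩ' := escape P.reverse hPr (by simpa using hmax) z' hz' (hzch'.infix hinf.isInfix)
    (hzt'.of_infix hinf.isInfix)
  have hrev : (z' :: q).reverse = z :: (P ++ [z']) := by simp [hq]
  refine ⟨z, P, z', hP.1, fun p hp => (hP.2.1 p hp).1, hP.2.2.1, hzΩ, hzΩ', ?_, ?_⟩
  · rw [← hrev]; exact isChain_reverse_tAdj hzch'
  · rw [← hrev]; exact hzt'.reverse

theorem exists_isRing (hG : G.Crit) (hU : G.UniqueCommon) : ∃ l, G.IsRing l := by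
  by_contra hno
  push Not at hno
  obtain ⟨v⟩ : Nonempty V := Fintype.card_pos_iff.1 (by have := hG.four_le; omega)
  obtain ⟨p, q, hp, hq, hpq⟩ := hG.exists_triangle v
  obtain ⟨m, hm, -⟩ := hG.exists_multi_tAdj hU (tAdj_of_triangle hp hq hpq)
  obtain ⟨z, -, -, -, -, -, hz, -⟩ := hG.exists_ear hU univ (fun l hl => absurd hl (hno l))
    (Finset.mem_univ m) hm
  exact hz (Finset.mem_univ z)

end Crit

/-! ### Shortest rings -/

section
variable {V : Type*} {G : SimpleGraph V}

/-- A chord of a shortest ring would shorten it. The only edges are those of the ring. -/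
theorem IsRing.chord (hU : G.UniqueCommon) {X : List V} (hX : G.IsRing X)
    (hmin : ∀ W, G.IsRing W → (∀ v ∈ W, v ∈ X) → X.length ≤ W.length) {l₁ l₂ l₃ : List V} {x y : V}
    (heq : X = l₁ ++ x :: (l₂ ++ y :: l₃)) (h2 : l₂ ≠ []) (hxy : G.Adj x y) : l₁ = [] ∧ l₃ = [] := by
  subst heq
  obtain ⟨hlen, hnd, hch, hends⟩ := hX
  match l₂, h2 with
  | [c], _ =>
    by_contra hne
    simp only [List.cons_append, List.nil_append, List.isChain_append, List.isChain_cons,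
      List.head?_cons, Option.mem_def, Option.some.injEq, forall_eq'] at hch
    obtain ⟨ch1, ⟨hxc, hcy, hyl, ch3⟩, hl1⟩ := hch
    -- dropping `c` gives a shorter ring, unless only three vertices remain
    have hW : 4 ≤ (l₁ ++ x :: y :: l₃).length → False := by
      intro h4
      have : G.IsRing (l₁ ++ x :: y :: l₃) := by
        refine ⟨h4, hnd.sublist (by simp), ?_, ?_⟩
        · simp only [List.isChain_append, List.isChain_cons,
            List.head?_cons, Option.mem_def, Option.some.injEq, forall_eq']
          exact ⟨ch1, ⟨tAdj_of_triangle hxy hxc.1 hcy.1.symm, hyl, ch3⟩, hl1⟩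
        · simpa [List.getLast?_cons] using hends
      have := hmin _ this (by
        intro v hv
        simp only [List.mem_append, List.mem_cons] at hv ⊢
        tauto)
      simp at this
    match l₁, l₃ with
    | [], [] => exact hne ⟨rfl, rfl⟩
    | [], [q] =>
      have h1 : G.Adj x q := by simpa using hends
      have h2 : G.TAdj y q := by simpa using hyl
      simp only [List.nil_append, List.cons_append, List.nodup_cons, List.mem_cons] at hnd
      have := hU x y c q hxy.ne hxc.1 hcy.1.symm h1 h2.1
      simp [this] at hnd
    | [p], [] =>
      have h1 : G.Adj p y := by simpa using hends
      have h2 : G.TAdj p x := by simpa using hl1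
      simp only [List.nil_append, List.cons_append, List.nodup_cons, List.mem_cons] at hnd
      have := hU x y c p hxy.ne hxc.1 hcy.1.symm h2.1.symm h1.symm
      simp [this] at hnd
    | [], _ :: _ :: _ => exact hW (by simp)
    | _ :: _ :: _, _ => exact hW (by simp; omega)
    | [_], _ :: _ => exact hW (by simp)
  | c :: d :: l, _ =>
    have : G.IsRing (x :: (c :: d :: l ++ [y])) := by
      refine ⟨by simp, hnd.sublist ?_, ?_, by simpa [List.getLast?_cons] using hxy⟩
      · exact (List.Sublist.cons_cons _ (List.Sublist.append_left (by simp) _)).trans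
          (List.sublist_append_right _ _)
      · refine hch.infix ⟨l₁, l₃, by simp⟩
    have := hmin _ this (by
      intro v hv
      simp only [List.mem_append, List.mem_cons, List.not_mem_nil, or_false] at hv ⊢
      tauto)
    simp at this
    exact ⟨List.length_eq_zero_iff.1 (by omega), List.length_eq_zero_iff.1 (by omega)⟩

/-- The apex of a triangle on an edge of a shortest ring is not on the ring. -/
theorem IsRing.apex_notMem (hU : G.UniqueCommon) {X : List V} (hX : G.IsRing X)
    (hmin : ∀ W, G.IsRing W → (∀ v ∈ W, v ∈ X) → X.length ≤ W.length) {l₁ l₂ : List V} {x y w : V}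
    (heq : X = l₁ ++ x :: y :: l₂) (hxw : G.Adj x w) (hyw : G.Adj y w) : w ∉ X := by
  have hlen := hX.1
  intro hw
  rw [heq] at hw
  simp only [List.mem_append, List.mem_cons] at hw
  rcases hw with h | rfl | rfl | h
  · obtain ⟨m₁, m₂, rfl⟩ := List.append_of_mem h
    obtain ⟨rfl, rfl⟩ := hX.chord hU hmin (l₁ := m₁) (l₂ := m₂ ++ [x]) (l₃ := l₂) (by simp [heq])
      (by simp) hyw.symm
    by_cases hm : m₂ = []
    · simp [heq, hm] at hlen
    · have := (hX.chord hU hmin (l₁ := []) (l₂ := m₂) (l₃ := [y]) (by simp [heq]) hm hxw.symm).2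
      simp at this
  · exact hxw.ne rfl
  · exact hyw.ne rfl
  · obtain ⟨m₁, m₂, rfl⟩ := List.append_of_mem h
    obtain ⟨rfl, rfl⟩ := hX.chord hU hmin (l₁ := l₁) (l₂ := y :: m₁) (l₃ := m₂) (by simp [heq])
      (by simp) hxw
    by_cases hm : m₁ = []
    · simp [heq, hm] at hlen
    · have := (hX.chord hU hmin (l₁ := [x]) (l₂ := m₁) (l₃ := []) (by simp [heq]) hm hyw).1
      simp at this

/-- Adjacent vertices of a shortest ring are consecutive, or the two ends. -/
theorem IsRing.form (hU : G.UniqueCommon) {X : List V} (hX : G.IsRing X)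
    (hmin : ∀ W, G.IsRing W → (∀ v ∈ W, v ∈ X) → X.length ≤ W.length) {x y : V}
    (hx : x ∈ X) (hy : y ∈ X) (hxy : G.Adj x y) :
    (∃ l₁ l₂, X = l₁ ++ x :: y :: l₂ ∨ X = l₁ ++ y :: x :: l₂) ∨
      ∃ m, X = x :: (m ++ [y]) ∨ X = y :: (m ++ [x]) := by
  obtain ⟨s, t, heq⟩ := List.append_of_mem hx
  rw [heq] at hy
  simp only [List.mem_append, List.mem_cons] at hy
  rcases hy with h | rfl | h
  · obtain ⟨m₁, m₂, rfl⟩ := List.append_of_mem h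
    by_cases hm : m₂ = []
    · exact Or.inl ⟨m₁, t, Or.inr (by simp [heq, hm])⟩
    · obtain ⟨rfl, rfl⟩ := hX.chord hU hmin (l₁ := m₁) (l₂ := m₂) (l₃ := t) (by simp [heq]) hm
        hxy.symm
      exact Or.inr ⟨m₂, Or.inr (by simp [heq])⟩
  · exact absurd rfl hxy.ne
  · obtain ⟨m₁, m₂, rfl⟩ := List.append_of_mem h
    by_cases hm : m₁ = []
    · exact Or.inl ⟨s, m₂, Or.inl (by simp [heq, hm])⟩
    · obtain ⟨rfl, rfl⟩ := hX.chord hU hmin (l₁ := s) (l₂ := m₁) (l₃ := m₂) (by simp [heq]) hm hxy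
      exact Or.inr ⟨m₁, Or.inl (by simp [heq])⟩

open Classical in
/-- Consecutive edges of a chain whose apices lie in `Y` make the number of edges to `Y` exceed the
number of neighbours in `Y`. -/
theorem card_add_length_le_ec [DecidableEq V] (Y : Finset V) (l : List V)
    (hnd : l.Nodup) (hch : l.IsChain fun u v => ∃ w ∈ Y, G.Adj u w ∧ G.Adj v w) :
    (Y.filter fun y => ∃ x ∈ l, G.Adj x y).card + l.length ≤ G.ec l.toFinset Y + 1 := by
  induction l with
  | nil => simp
  | cons x l ih =>
    rw [List.nodup_cons] at hnd
    rw [List.isChain_cons] at hch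
    have ih := ih hnd.2 hch.2
    have e1 : G.ec (x :: l).toFinset Y = G.ec {x} Y + G.ec l.toFinset Y := by
      rw [List.toFinset_cons, Finset.insert_eq, ec_union_left G _ (by simpa using hnd.1)]
    have e2 : (Y.filter fun y => ∃ x' ∈ x :: l, G.Adj x' y) =
        Y.filter (fun y => G.Adj x y) ∪ Y.filter (fun y => ∃ x' ∈ l, G.Adj x' y) := by
      ext v
      simp only [Finset.mem_filter, Finset.mem_union, List.mem_cons, exists_eq_or_imp]
      tauto
    have e3 := Finset.card_union_add_card_inter (Y.filter (fun y => G.Adj x y))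
      (Y.filter (fun y => ∃ x' ∈ l, G.Adj x' y))
    have e4 := ec_singleton_left G x Y
    have e5 : (Y.filter (fun y => G.Adj x y)).card = G.ec {x} Y := e4.symm
    match l with
    | [] => simp [e5]
    | x' :: l' =>
      obtain ⟨w, hw, h1, h2⟩ := hch.1 x' (by simp)
      have e6 : 0 < (Y.filter (fun y => G.Adj x y) ∩
          Y.filter (fun y => ∃ z ∈ x' :: l', G.Adj z y)).card := by
        refine Finset.card_pos.2 ⟨w, ?_⟩
        simp [hw, h1, h2]
      rw [e2, e1, List.length_cons]
      omega

theorem IsRing.two_mul_length_le_ec [DecidableEq V] {X : List V} (hX : G.IsRing X) :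
    2 * X.length ≤ G.ec X.toFinset X.toFinset := by
  have chain : ∀ l : List V, l.Nodup → l.IsChain G.TAdj →
      2 * l.length ≤ G.ec l.toFinset l.toFinset + 2 := by
    intro l hnd hch
    induction l with
    | nil => simp
    | cons x l ih =>
      rw [List.nodup_cons] at hnd
      rw [List.isChain_cons] at hch
      have ih := ih hnd.2 hch.2
      rw [List.toFinset_cons, ec_insert_self G (by simpa using hnd.1)]
      match l with
      | [] => simp
      | x' :: l' =>
        have := card_le_ec_singleton G (a := x) (B := (x' :: l').toFinset) (D := {x'}) (by simp)
          (by simpa using (hch.1 x' (by simp)).1)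
        rw [Finset.card_singleton] at this
        simp only [List.length_cons] at ih ⊢
        omega
  obtain ⟨hlen, hnd, hch, hends⟩ := hX
  match X with
  | [] => simp
  | [_] => simp at hlen
  | x :: y :: l =>
    obtain ⟨l, z, rfl⟩ : ∃ l' z, l = l' ++ [z] := by
      rcases List.eq_nil_or_concat l with rfl | ⟨l', z, h⟩
      · simp at hlen
      · exact ⟨l', z, by simpa using h⟩
    have h1 : G.Adj x y := (List.isChain_cons_cons.1 hch).1.1
    have h2 : G.Adj x z := hends x (by simp) z (by simp [List.getLast?_cons])
    have hnd' := List.nodup_cons.1 hnd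
    have hyz : y ≠ z := by
      rintro rfl
      simp at hnd'
    have c1 := chain (y :: (l ++ [z])) hnd'.2 (List.isChain_cons_cons.1 hch).2
    have c2 := card_le_ec_singleton G (a := x) (B := (y :: (l ++ [z])).toFinset) (D := {y, z})
      (by intro v; simp; tauto) (by simp [h1, h2])
    rw [Finset.card_pair hyz] at c2
    rw [List.toFinset_cons, ec_insert_self G (by rw [List.mem_toFinset]; exact hnd'.1),
      List.length_cons]
    omega

end

/-! ### Two vertices with two common neighbours exist -/

section
variable {V : Type*} {G : SimpleGraph V}

/-- A vertex `y` off a ring, seeing consecutive ring vertices `z`, `z'` and a further ring vertex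
`c` after them, gives a shorter ring. -/
theorem IsRing.shortcut {X : List V} (hX : G.IsRing X) {l₁ m₁ m₂ : List V} {y z z' c : V}
    (heq : X = l₁ ++ z :: z' :: (m₁ ++ c :: m₂)) (hy : y ∉ X) (hyz' : G.TAdj y z')
    (hyc : G.Adj y c) (hcz : ¬ G.Adj c z) (hcz' : ¬ G.Adj c z') :
    ∃ W, G.IsRing W ∧ W.length < X.length ∧ ∀ v ∈ W, v = y ∨ v ∈ X := by
  obtain ⟨hlen, hnd, hch, hends⟩ := hX
  subst heq
  have hsub : (z' :: (m₁ ++ [c])).Sublist (l₁ ++ z :: z' :: (m₁ ++ c :: m₂)) :=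
    ((List.Sublist.cons_cons _ (List.Sublist.append_left (by simp) _)).trans
      (List.sublist_cons_self _ _)).trans (List.sublist_append_right _ _)
  have hinf : (z' :: (m₁ ++ [c])) <:+: (l₁ ++ z :: z' :: (m₁ ++ c :: m₂)) :=
    ⟨l₁ ++ [z], m₂, by simp⟩
  have hch' := hch.infix hinf
  have hm : m₁ ≠ [] := by
    rintro rfl
    exact hcz' (List.isChain_cons_cons.1 hch').1.1.symm
  have hmp := List.length_pos_iff.2 hm
  refine ⟨y :: z' :: (m₁ ++ [c]), ⟨by simp; omega, ?_, ?_, ?_⟩, ?_, ?_⟩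
  · exact List.nodup_cons.2 ⟨fun h => hy (hsub.subset h), hnd.sublist hsub⟩
  · exact List.isChain_cons_cons.2 ⟨hyz', hch'⟩
  · simpa [List.getLast?_cons] using hyc
  · by_contra hle
    simp at hle
    have h1 : l₁ = [] := List.length_eq_zero_iff.1 (by omega)
    have h2 : m₂ = [] := List.length_eq_zero_iff.1 (by omega)
    subst h1 h2
    exact hcz (hends z (by simp) c (by simp [List.getLast?_cons])).symm
  · intro v hv
    rcases List.mem_cons.1 hv with h | h
    · exact Or.inl h
    · exact Or.inr (hsub.subset h)

/-- As in `IsRing.shortcut`, when `z` and `z'` are the two ends of the ring. -/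
theorem IsRing.shortcut_ends {X : List V} (hX : G.IsRing X) {m₁ m₂ : List V} {y z z' c : V}
    (heq : X = z :: (m₁ ++ c :: (m₂ ++ [z']))) (hy : y ∉ X) (hyz : G.TAdj y z)
    (hyc : G.Adj y c) (hcz : ¬ G.Adj c z) (hcz' : ¬ G.Adj c z') :
    ∃ W, G.IsRing W ∧ W.length < X.length ∧ ∀ v ∈ W, v = y ∨ v ∈ X := by
  obtain ⟨hlen, hnd, hch, hends⟩ := hX
  subst heq
  have hsub : (z :: (m₁ ++ [c])).Sublist (z :: (m₁ ++ c :: (m₂ ++ [z']))) :=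
    List.Sublist.cons_cons _ (List.Sublist.append_left (by simp) _)
  have hch' : (z :: (m₁ ++ [c])).IsChain G.TAdj := hch.infix ⟨[], m₂ ++ [z'], by simp⟩
  have hm : m₁ ≠ [] := by
    rintro rfl
    exact hcz (List.isChain_cons_cons.1 hch').1.1.symm
  have hmp := List.length_pos_iff.2 hm
  refine ⟨y :: z :: (m₁ ++ [c]), ⟨by simp; omega, ?_, ?_, ?_⟩, ?_, ?_⟩
  · exact List.nodup_cons.2 ⟨fun h => hy (hsub.subset h), hnd.sublist hsub⟩
  · exact List.isChain_cons_cons.2 ⟨hyz, hch'⟩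
  · simpa [List.getLast?_cons] using hyc
  · by_contra hle
    simp at hle
    have h2 : m₂ = [] := List.length_eq_zero_iff.1 (by omega)
    subst h2
    have : [c, z'] <:+: z :: (m₁ ++ c :: ([] ++ [z'])) := ⟨z :: m₁, [], by simp⟩
    exact hcz' (List.isChain_cons_cons.1 (hch.infix this)).1.1
  · intro v hv
    rcases List.mem_cons.1 hv with h | h
    · exact Or.inl h
    · exact Or.inr (hsub.subset h)

/-- Adjacent vertices `y`, `c` off a ring, each forming a triangle with an edge of the ring, give a
shorter ring. -/
theorem IsRing.shortcut₂ (hU : G.UniqueCommon) {X : List V} (hX : G.IsRing X) {l₁ m l₃ : List V}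
    {y z z' c w w' : V} (heq : X = l₁ ++ z :: z' :: (m ++ w :: w' :: l₃)) (hy : y ∉ X) (hc : c ∉ X)
    (hyc : G.Adj y c) (hyz : G.Adj y z) (hyz' : G.TAdj y z') (hcw : G.TAdj c w)
    (hcw' : G.Adj c w') :
    ∃ W, G.IsRing W ∧ W.length < X.length ∧ ∀ v ∈ W, v = y ∨ v = c ∨ v ∈ X := by
  obtain ⟨hlen, hnd, hch, hends⟩ := hX
  subst heq
  have hsub : (z' :: (m ++ [w])).Sublist (l₁ ++ z :: z' :: (m ++ w :: w' :: l₃)) :=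
    ((List.Sublist.cons_cons _ (List.Sublist.append_left (by simp) _)).trans
      (List.sublist_cons_self _ _)).trans (List.sublist_append_right _ _)
  have hch' : (z' :: (m ++ [w])).IsChain G.TAdj := hch.infix ⟨l₁ ++ [z], w' :: l₃, by simp⟩
  refine ⟨y :: z' :: (m ++ [w]) ++ [c], ⟨by simp, ?_, ?_, ?_⟩, ?_, ?_⟩
  · have h1 := hnd.sublist hsub
    have h2 : y ∉ z' :: (m ++ [w]) := fun h => hy (hsub.subset h)
    have h3 : c ∉ z' :: (m ++ [w]) := fun h => hc (hsub.subset h)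
    have h4 := hyc.ne
    rw [List.cons_append, List.nodup_cons, List.nodup_append]
    simp only [List.mem_append, List.mem_cons] at h2 h3 ⊢
    refine ⟨by simp at h2 ⊢; tauto, h1, by simp, ?_⟩
    rintro a ha b (rfl | h) rfl
    · exact h3 (by simpa using ha)
    · simp at h
  · rw [List.isChain_append]
    refine ⟨List.isChain_cons_cons.2 ⟨hyz', hch'⟩, by simp, ?_⟩
    simpa [List.getLast?_cons] using hcw.symm
  · simpa [List.getLast?_cons] using hyc
  · by_contra hle
    simp at hle
    have h1 : l₁ = [] := List.length_eq_zero_iff.1 (by omega)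
    have h2 : l₃ = [] := List.length_eq_zero_iff.1 (by omega)
    subst h1 h2
    have hzw' : G.Adj z w' := hends z (by simp) w' (by simp [List.getLast?_cons])
    have hyw' : y ≠ w' := by rintro rfl; simp at hy
    have := hU y w' z c hyw' hyz hzw'.symm hyc hcw'.symm
    subst this
    simp at hc
  · intro v hv
    simp only [List.cons_append, List.mem_cons, List.mem_append, List.not_mem_nil, or_false] at hv ⊢
    tauto

/-- As in `IsRing.shortcut₂`, when the edge of the ring that `y` sees is the one between the
two ends. -/
theorem IsRing.shortcut₂_ends (hU : G.UniqueCommon) {X : List V} (hX : G.IsRing X)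
    {m₁ m₂ : List V} {y z z' c w w' : V} (heq : X = z :: (m₁ ++ w :: w' :: (m₂ ++ [z'])))
    (hy : y ∉ X) (hc : c ∉ X) (hyc : G.Adj y c) (hyz : G.TAdj y z) (hyz' : G.Adj y z')
    (hcw : G.TAdj c w) (hcw' : G.Adj c w') :
    ∃ W, G.IsRing W ∧ W.length < X.length ∧ ∀ v ∈ W, v = y ∨ v = c ∨ v ∈ X := by
  obtain ⟨hlen, hnd, hch, hends⟩ := hX
  subst heq
  have hsub : (z :: (m₁ ++ [w])).Sublist (z :: (m₁ ++ w :: w' :: (m₂ ++ [z']))) :=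
    List.Sublist.cons_cons _ (List.Sublist.append_left (by simp) _)
  have hch' : (z :: (m₁ ++ [w])).IsChain G.TAdj := hch.infix ⟨[], w' :: (m₂ ++ [z']), by simp⟩
  refine ⟨y :: z :: (m₁ ++ [w]) ++ [c], ⟨by simp, ?_, ?_, ?_⟩, ?_, ?_⟩
  · have h1 := hnd.sublist hsub
    have h2 : y ∉ z :: (m₁ ++ [w]) := fun h => hy (hsub.subset h)
    have h3 : c ∉ z :: (m₁ ++ [w]) := fun h => hc (hsub.subset h)
    have h4 := hyc.ne
    rw [List.cons_append, List.nodup_cons, List.nodup_append]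
    simp only [List.mem_append, List.mem_cons] at h2 h3 ⊢
    refine ⟨by simp at h2 ⊢; tauto, h1, by simp, ?_⟩
    rintro a ha b (rfl | h) rfl
    · exact h3 (by simpa using ha)
    · simp at h
  · rw [List.isChain_append]
    refine ⟨List.isChain_cons_cons.2 ⟨hyz, hch'⟩, by simp, ?_⟩
    simpa [List.getLast?_cons] using hcw.symm
  · simpa [List.getLast?_cons] using hyc
  · by_contra hle
    simp at hle
    have h2 : m₂ = [] := List.length_eq_zero_iff.1 (by omega)
    subst h2
    have : [w', z'] <:+: z :: (m₁ ++ w :: w' :: ([] ++ [z'])) := ⟨z :: (m₁ ++ [w]), [], by simp⟩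
    have hwz := (List.isChain_cons_cons.1 (hch.infix this)).1.1
    have hyw' : y ≠ w' := by rintro rfl; simp at hy
    have := hU y w' z' c hyw' hyz' hwz hyc hcw'.symm
    subst this
    simp at hc
  · intro v hv
    simp only [List.cons_append, List.mem_cons, List.mem_append, List.not_mem_nil, or_false] at hv ⊢
    tauto

/-- A turning path of triangle edges joins two vertices of a shortest ring through vertices off the
ring. Then there are two rings, in the ring together with the path, with only the two attachment
vertices in common on the ring. -/
theorem IsRing.exists_two_of_path {X : List V} (hX : G.IsRing X) {l₁ l₂ l₃ P : List V} {a b : V}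
    (heq : X = l₁ ++ a :: (l₂ ++ b :: l₃)) (hP : P ≠ []) (hPX : ∀ p ∈ P, p ∉ X) (hPn : P.Nodup)
    (hch : (a :: (P ++ [b])).IsChain G.TAdj) (ht : G.Turning (a :: (P ++ [b]))) :
    G.IsRing (a :: (l₂ ++ b :: P.reverse)) ∧ G.IsRing (l₁ ++ a :: (P ++ b :: l₃)) := by
  obtain ⟨hlen, hnd, hXch, hends⟩ := hX
  subst heq
  have hPp := List.length_pos_iff.2 hP
  -- a path with a single interior vertex has nonadjacent ends
  have hna : P.length = 1 → ¬ G.Adj a b := by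
    intro h
    obtain ⟨p, rfl⟩ := List.length_eq_one_iff.1 h
    exact (ht a p b ⟨[], [], by simp⟩).2
  have hmid : (a :: (l₂ ++ [b])).IsChain G.TAdj := hXch.infix ⟨l₁, l₃, by simp⟩
  have hmidnd : (a :: (l₂ ++ [b])).Nodup := hnd.sublist
    ((List.Sublist.cons_cons _ (List.Sublist.append_left (by simp) _)).trans
      (List.sublist_append_right _ _))
  have hPmem : ∀ p ∈ P, p ∉ l₁ ∧ p ≠ a ∧ p ∉ l₂ ∧ p ≠ b ∧ p ∉ l₃ := fun p hp => by
    have := hPX p hp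
    simp only [List.mem_append, List.mem_cons, not_or] at this
    tauto
  constructor
  · refine ⟨?_, ?_, ?_, ?_⟩
    · simp
      by_contra hlt
      have h1 : l₂ = [] := List.length_eq_zero_iff.1 (by omega)
      subst h1
      exact hna (by omega) (List.isChain_cons_cons.1 hmid).1.1
    · have : a :: (l₂ ++ b :: P.reverse) = a :: (l₂ ++ [b]) ++ P.reverse := by simp
      rw [this, List.nodup_append]
      refine ⟨hmidnd, List.nodup_reverse.2 hPn, ?_⟩
      rintro x hx y hy rfl
      have := hPmem x (List.mem_reverse.1 hy)
      simp only [List.mem_cons, List.mem_append, List.not_mem_nil, or_false] at hx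
      tauto
    · have : a :: (l₂ ++ b :: P.reverse) = a :: (l₂ ++ [b]) ++ P.reverse := by simp
      have h2 : (b :: P.reverse).IsChain G.TAdj := by
        have := (isChain_reverse_tAdj hch).infix (l₁ := b :: P.reverse) ⟨[], [a], by simp⟩
        exact this
      rw [this, List.isChain_append]
      refine ⟨hmid, h2.infix ⟨[b], [], by simp⟩, ?_⟩
      intro x hx
      have : x = b := by simpa [List.getLast?_cons] using hx.symm
      subst this
      exact (List.isChain_cons.1 h2).1
    · intro x hx y hy
      have hx : x = a := by simpa using hx.symm
      subst hx
      match P, hP with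
      | p :: P', _ =>
        have : y = p := by simpa [List.getLast?_cons] using hy.symm
        subst this
        exact (List.isChain_cons_cons.1 hch).1.1
  · refine ⟨?_, ?_, ?_, ?_⟩
    · simp
      by_contra hlt
      have h1 : l₁ = [] := List.length_eq_zero_iff.1 (by omega)
      have h3 : l₃ = [] := List.length_eq_zero_iff.1 (by omega)
      subst h1 h3
      exact hna (by omega) (hends a (by simp) b (by simp [List.getLast?_cons]))
    · have h1 : (l₁ ++ a :: b :: l₃).Nodup := hnd.sublist
        (List.Sublist.append_left (List.Sublist.cons_cons _ (List.sublist_append_right _ _)) _)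
      have h2 : (l₁ ++ a :: (P ++ b :: l₃)).Perm (P ++ (l₁ ++ a :: b :: l₃)) := by
        have e : l₁ ++ a :: (P ++ b :: l₃) = (l₁ ++ [a]) ++ (P ++ (b :: l₃)) := by simp
        have e' : P ++ (l₁ ++ a :: b :: l₃) = P ++ ((l₁ ++ [a]) ++ (b :: l₃)) := by simp
        rw [e, e', ← List.append_assoc, ← List.append_assoc]
        exact List.Perm.append_right _ List.perm_append_comm
      rw [h2.nodup_iff, List.nodup_append]
      refine ⟨hPn, h1, ?_⟩
      rintro x hx y hy rfl
      have := hPmem x hx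
      simp only [List.mem_cons, List.mem_append] at hy
      tauto
    · have e : l₁ ++ a :: (P ++ b :: l₃) = (l₁ ++ a :: P) ++ b :: l₃ := by simp
      have h1 : (l₁ ++ [a]).IsChain G.TAdj := hXch.infix ⟨[], l₂ ++ b :: l₃, by simp⟩
      have h3 : (b :: l₃).IsChain G.TAdj := hXch.infix ⟨l₁ ++ a :: l₂, [], by simp⟩
      have h2 := hch
      simp only [List.isChain_append, List.isChain_cons] at h1 h2 h3 ⊢
      simp_all
    · simpa [List.getLast?_cons] using hends

end

namespace Crit

variable {V : Type u} [Fintype V] [DecidableEq V] {G : SimpleGraph V}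

/-- The vertices off a shortest ring do not induce a connected graph: the apices of the triangles
on the ring are counted at least twice as neighbours of the ring, which makes the rest sparse. -/
theorem not_setConn_compl_ring (hG : G.Crit) (hU : G.UniqueCommon) {X : List V} (hX : G.IsRing X)
    (hmin : ∀ W, G.IsRing W → (∀ v ∈ W, v ∈ X) → X.length ≤ W.length) :
    ¬ G.SetConn (univ \ X.toFinset) := by
  classical
  intro hc
  set Y := univ \ X.toFinset with hY
  have mY : ∀ v, v ∈ Y ↔ v ∉ X := fun v => by simp [hY]
  have hlen := hX.1
  have h1 := hG.lt_of_setConn (K := Y.filter fun y => ∃ x ∈ X, G.Adj x y) hc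
    (Finset.filter_subset _ _) (by
      intro a ha haK b hab
      rw [mY]
      intro hb
      exact haK (Finset.mem_filter.2 ⟨ha, b, hb, hab.symm⟩)) (by
      obtain ⟨x, hx⟩ := List.exists_mem_of_length_pos (l := X) (by omega)
      exact ⟨x, by rw [mY]; exact fun h => h hx⟩)
  have h2 := card_add_length_le_ec (G := G) Y X hX.2.1 (by
    have : ∀ l₂ l₁, X = l₁ ++ l₂ → l₂.IsChain fun u v => ∃ w ∈ Y, G.Adj u w ∧ G.Adj v w := by
      intro l₂
      induction l₂ with
      | nil => intros; simp
      | cons x l ih =>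
        intro l₁ heq
        have ih := ih (l₁ ++ [x]) (by simp [heq])
        match l with
        | [] => simp
        | y :: l =>
          refine List.isChain_cons_cons.2 ⟨?_, ih⟩
          obtain ⟨-, w, hxw, hyw⟩ : G.TAdj x y :=
            (List.isChain_cons_cons.1 (hX.2.2.1.infix (l₁ := x :: y :: l)
              ⟨l₁, [], by simp [heq]⟩)).1
          exact ⟨w, (mY w).2 (hX.apex_notMem hU hmin heq hxw hyw), hxw, hyw⟩
    exact this X [] (by simp))
  have h3 := hX.two_mul_length_le_ec
  have hd : Disjoint X.toFinset Y := Finset.disjoint_sdiff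
  have hu : X.toFinset ∪ Y = univ := by rw [hY]; simp
  have h4 := ec_union_self G hd
  have h5 : Fintype.card V = X.length + Y.card := by
    rw [← Finset.card_univ, ← hu, Finset.card_union_of_disjoint hd,
      List.toFinset_card_of_nodup hX.2.1]
  have := hG.edges
  rw [hu] at h4
  omega

/-- If any two vertices have at most one common neighbour, there is a contradiction. A connected
set `M` of maximal size among those disjoint from a ring has all its neighbours on each ring that
avoids it. For a shortest such ring, the vertices that are neither on it nor in `M` provide either
two rings with few common vertices or a shorter ring. -/
theorem not_uniqueCommon (hG : G.Crit) : ¬ G.UniqueCommon := by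
  classical
  intro hU
  obtain ⟨M, hM, hMmax⟩ := Finset.exists_max_image
    (univ.filter fun M : Finset V => G.SetConn M ∧ ∃ l, G.IsRing l ∧ ∀ v ∈ l, v ∉ M) Finset.card
    ⟨∅, by
      obtain ⟨l, hl⟩ := hG.exists_isRing hU
      simp only [Finset.mem_filter, Finset.mem_univ, true_and]
      refine ⟨fun A hA hne _ => ?_, l, hl, by simp⟩
      exact absurd (Finset.subset_empty.1 hA) hne.ne_empty⟩
  simp only [Finset.mem_filter, Finset.mem_univ, true_and] at hM hMmax
  obtain ⟨hMc, hMr⟩ := hM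
  obtain ⟨X, ⟨hX, hXM⟩, hXmin⟩ : ∃ X, (G.IsRing X ∧ ∀ v ∈ X, v ∉ M) ∧
      ∀ W, G.IsRing W → (∀ v ∈ W, v ∉ M) → X.length ≤ W.length := by
    have hex : ∃ n, ∃ l, (G.IsRing l ∧ ∀ v ∈ l, v ∉ M) ∧ l.length = n := by
      obtain ⟨l, hl⟩ := hMr
      exact ⟨_, l, hl, rfl⟩
    obtain ⟨X, hX, hXn⟩ := Nat.find_spec hex
    exact ⟨X, hX, fun W hW hWM => hXn ▸ Nat.find_min' hex ⟨W, ⟨hW, hWM⟩, rfl⟩⟩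
  have hmin : ∀ W, G.IsRing W → (∀ v ∈ W, v ∈ X) → X.length ≤ W.length :=
    fun W hW hWX => hXmin W hW fun v hv => hXM v (hWX v hv)
  have star : ∀ W, G.IsRing W → (∀ v ∈ W, v ∉ M) → ∀ u ∈ M, ∀ v, v ∉ M → G.Adj u v → v ∈ W := by
    intro W hW hWM u hu v hv huv
    by_contra hvW
    have := hMmax (insert v M) ⟨hMc.insert hu huv.symm, W, hW, by
      intro w hw h
      rcases Finset.mem_insert.1 h with rfl | h
      · exact hvW hw
      · exact hWM w hw h⟩
    rw [Finset.card_insert_of_notMem hv] at this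
    omega
  have hlen := hX.1
  have hMne : M.Nonempty := by
    by_contra hne
    rw [Finset.not_nonempty_iff_eq_empty] at hne
    subst hne
    -- the apex of a triangle on the ring is a larger connected set disjoint from the ring
    obtain ⟨x, y, l, rfl⟩ : ∃ x y l, X = x :: y :: l := by
      match X, hlen with
      | x :: y :: l, _ => exact ⟨x, y, l, rfl⟩
    obtain ⟨-, w, hxw, hyw⟩ := (List.isChain_cons_cons.1 hX.2.2.1).1
    have hw := hX.apex_notMem hU hmin (l₁ := []) rfl hxw hyw
    have := hMmax {w} ⟨fun A hA hne _ => (Finset.subset_singleton_iff.1 hA).resolve_left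
      hne.ne_empty, _, hX, by
        intro v hv h
        rw [Finset.mem_singleton] at h
        exact hw (h ▸ hv)⟩
    simp at this
  -- two vertices cannot contain all the neighbours of `M`
  have two : ∀ a b, a ∉ M → b ∉ M → (∀ u ∈ M, ∀ v, v ∉ M → G.Adj u v → v = a ∨ v = b) → False := by
    intro a b ha hb h
    obtain ⟨m, hm⟩ := hMne
    refine hG.not_separates_pair a b ⟨M, ⟨m, hm⟩, ?_, ?_, ?_⟩
    · rintro x hx (rfl | rfl)
      · exact ha hx
      · exact hb hx
    · by_contra hno
      push Not at hno
      have hsub : X.toFinset ⊆ {a, b} := by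
        intro v hv
        have := hno v (hXM v (List.mem_toFinset.1 hv))
        simpa using this
      have h1 := Finset.card_le_card hsub
      rw [List.toFinset_card_of_nodup hX.2.1] at h1
      have := Finset.card_le_two (a := a) (b := b)
      omega
    · intro u hu v huv
      by_cases hv : v ∈ M
      · exact Or.inl hv
      · exact Or.inr (by simpa using h u hu v hv huv)
  -- a vertex outside the ring and `M`
  obtain ⟨y, hyX, hyM⟩ : ∃ y, y ∉ X ∧ y ∉ M := by
    by_contra hno
    push Not at hno
    have : univ \ X.toFinset = M := by
      ext v
      simp only [Finset.mem_sdiff, Finset.mem_univ, List.mem_toFinset, true_and]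
      exact ⟨hno v, fun hv hvX => hXM v hvX hv⟩
    exact hG.not_setConn_compl_ring hU hX hmin (this ▸ hMc)
  have hoff : ∀ y, y ∉ X → y ∉ M → ∀ v, G.Adj y v → v ∉ M := fun y hyX hyM v hyv hv =>
    hyX (star X hX hXM v hv y hyM hyv.symm)
  -- all vertices outside the ring and `M` lie in one triangle only
  have single : ∀ y, y ∉ X → y ∉ M → ¬ G.Multi y := by
    intro y hyX hyM hym
    set Ω : Finset V := univ.filter fun v => v ∉ X ∧ v ∉ M with hΩ
    have mΩ : ∀ v, v ∈ Ω ↔ v ∉ X ∧ v ∉ M := fun v => by simp [hΩ]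
    obtain ⟨z, P, z', hP, hPΩ, hPn, hz, hz', hch, ht⟩ := hG.exists_ear hU Ω (by
      intro l hl
      by_contra hno
      push Not at hno
      have hno' : ∀ v ∈ l, v ∉ X ∧ v ∉ M := fun v hv => (mΩ v).1 (hno v hv)
      obtain ⟨x, hx⟩ := List.exists_mem_of_length_pos (l := X) (by omega)
      refine two x x (hXM x hx) (hXM x hx) fun u hu v hv huv => ?_
      have h1 := star l hl (fun v hv => (hno' v hv).2) u hu v hv huv
      exact absurd (star X hX hXM u hu v hv huv) (hno' v h1).1) ((mΩ y).2 ⟨hyX, hyM⟩) hym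
    have hPΩ' : ∀ p ∈ P, p ∉ X ∧ p ∉ M := fun p hp => (mΩ p).1 (hPΩ p hp)
    have hend : ∀ v, v ∉ Ω → (∃ p ∈ P, G.Adj p v) → v ∈ X := by
      rintro v hv ⟨p, hp, hpv⟩
      by_contra hvX
      exact hv ((mΩ v).2 ⟨hvX, hoff p (hPΩ' p hp).1 (hPΩ' p hp).2 v hpv⟩)
    have hzX : z ∈ X := by
      refine hend z hz ?_
      match P, hP with
      | p :: P', _ => exact ⟨p, by simp, (List.isChain_cons_cons.1 hch).1.1.symm⟩
    have hzX' : z' ∈ X := by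
      refine hend z' hz' ?_
      rcases List.eq_nil_or_concat P with rfl | ⟨P', p, hPe⟩
      · exact absurd rfl hP
      · have : [p, z'] <:+: z :: (P ++ [z']) := ⟨z :: P', [], by simp [hPe]⟩
        exact ⟨p, by simp [hPe], (List.isChain_cons_cons.1 (hch.infix this)).1.1⟩
    have hzP : z ∉ P := fun h => (hPΩ' z h).1 hzX
    by_cases hzz : z = z'
    · subst hzz
      have hring : G.IsRing (z :: P) := by
        refine ⟨?_, List.nodup_cons.2 ⟨hzP, hPn⟩, hch.infix ⟨[], [z], by simp⟩, ?_⟩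
        · match P, hP with
          | [p], _ => exact absurd rfl (ht z p z ⟨[], [], by simp⟩).1
          | [p, q], _ =>
            have h1 := (ht z p q ⟨[], [z], by simp⟩).2
            have h2 : [q, z] <:+: z :: ([p, q] ++ [z]) := ⟨[z, p], [], by simp⟩
            exact absurd (List.isChain_cons_cons.1 (hch.infix h2)).1.1.symm h1
          | _ :: _ :: _ :: _, _ => simp
        · rcases List.eq_nil_or_concat P with rfl | ⟨P', p, hPe⟩
          · exact absurd rfl hP
          · have : [p, z] <:+: z :: (P ++ [z]) := ⟨z :: P', [], by simp [hPe]⟩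
            simpa [hPe, List.getLast?_cons] using
              (List.isChain_cons_cons.1 (hch.infix this)).1.1.symm
      refine two z z (hXM z hzX) (hXM z hzX) fun u hu v hv huv => ?_
      have h1 := star _ hring (by
        intro w hw
        rcases List.mem_cons.1 hw with rfl | h
        · exact hXM w hzX
        · exact (hPΩ' w h).2) u hu v hv huv
      rcases List.mem_cons.1 h1 with h | h
      · exact Or.inl h
      · exact absurd (star X hX hXM u hu v hv huv) (hPΩ' v h).1
    · have fin : ∀ a b P l₁ l₂ l₃, X = l₁ ++ a :: (l₂ ++ b :: l₃) → P ≠ [] →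
          (∀ p ∈ P, p ∉ X ∧ p ∉ M) → P.Nodup → (a :: (P ++ [b])).IsChain G.TAdj →
          G.Turning (a :: (P ++ [b])) → False := by
        intro a b P l₁ l₂ l₃ heq hP hPX hPn hch ht
        obtain ⟨r1, r2⟩ := hX.exists_two_of_path heq hP (fun p hp => (hPX p hp).1) hPn hch ht
        have hnd := hX.2.1
        have hmX : ∀ v, v ∈ X ↔ v ∈ l₁ ∨ v = a ∨ v ∈ l₂ ∨ v = b ∨ v ∈ l₃ := fun v => by
          simp [heq]
        refine two a b (hXM a ((hmX a).2 (by simp))) (hXM b ((hmX b).2 (by simp)))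
          fun u hu v hv huv => ?_
        have m1 := star _ r1 (by
          intro w hw
          simp only [List.mem_cons, List.mem_append, List.mem_reverse] at hw
          by_cases hwP : w ∈ P
          · exact (hPX w hwP).2
          · exact hXM w ((hmX w).2 (by tauto))) u hu v hv huv
        have m2 := star _ r2 (by
          intro w hw
          simp only [List.mem_cons, List.mem_append] at hw
          by_cases hwP : w ∈ P
          · exact (hPX w hwP).2
          · exact hXM w ((hmX w).2 (by tauto))) u hu v hv huv
        have m3 : v ∉ P := fun h => (hPX v h).1 (star X hX hXM u hu v hv huv)
        simp only [List.mem_cons, List.mem_append, List.mem_reverse, m3, or_false, false_or] at m1 m2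
        rw [heq] at hnd
        simp only [List.nodup_append, List.nodup_cons, List.mem_cons, List.mem_append] at hnd
        by_contra hab
        rw [not_or] at hab
        simp only [hab.1, hab.2, false_or, or_false] at m1 m2
        rcases m2 with h | h
        · exact hnd.2.2 v h v (Or.inr (Or.inl m1)) rfl
        · exact hnd.2.1.2.2.2 v m1 v (Or.inr h) rfl
      obtain ⟨s, t, heq⟩ := List.append_of_mem hzX
      rw [heq] at hzX'
      simp only [List.mem_append, List.mem_cons] at hzX'
      rcases hzX' with h | h | h
      · obtain ⟨m₁, m₂, rfl⟩ := List.append_of_mem h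
        refine fin z' z P.reverse m₁ m₂ t (by simp [heq]) (by simpa using hP)
          (by simpa using hPΩ') (List.nodup_reverse.2 hPn) ?_ ?_
        · simpa using isChain_reverse_tAdj hch
        · simpa using ht.reverse
      · exact hzz h.symm
      · obtain ⟨m₁, m₂, rfl⟩ := List.append_of_mem h
        exact fin z z' P s m₁ m₂ heq hP hPΩ' hPn hch ht
  -- the triangle of such a vertex has its other two vertices on the ring
  have base : ∀ y, y ∉ X → y ∉ M → ∃ z z', z ∈ X ∧ z' ∈ X ∧ G.Adj y z ∧ G.Adj y z' ∧ G.Adj z z' := by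
    intro y hyX hyM
    obtain ⟨z, z', hz, hz', hzz⟩ := hG.exists_triangle y
    have h1 := (hG.multi_or_multi hU hz hz' hzz).resolve_left (single y hyX hyM)
    have h2 := (hG.multi_or_multi hU hz' hz hzz.symm).resolve_left (single y hyX hyM)
    have key : ∀ v, G.Multi v → G.Adj y v → v ∈ X := fun v hv hyv => by
      by_contra hvX
      exact single v hvX (hoff y hyX hyM v hyv) hv
    exact ⟨z, z', key z h1 hz, key z' h2 hz', hz, hz', hzz⟩
  -- shorter rings give contradictions
  have short : (∃ W, G.IsRing W ∧ W.length < X.length ∧ ∀ v ∈ W, v ∉ M) → False := by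
    rintro ⟨W, hW, hlt, hWM⟩
    have := hXmin W hW hWM
    omega
  obtain ⟨z, z', hzX, hzX', hyz, hyz', hzz⟩ := base y hyX hyM
  obtain ⟨c, hyc, hcz, hcz'⟩ := hG.exists_adj_ne y z z'
  have hcnz : ¬ G.Adj c z := fun h => hcz' (hU y z c z' hyz.ne hyc h.symm hyz' hzz)
  have hcnz' : ¬ G.Adj c z' := fun h => hcz (hU y z' c z hyz'.ne hyc h.symm hyz hzz.symm)
  have hcM : c ∉ M := hoff y hyX hyM c hyc
  have hXr : G.IsRing X.reverse := hX.reverse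
  by_cases hcX : c ∈ X
  · have fin : ∀ W : List V, (∀ v ∈ W, v = y ∨ v ∈ X) → ∀ v ∈ W, v ∉ M := fun W hW v hv => by
      rcases hW v hv with rfl | h
      · exact hyM
      · exact hXM v h
    have main : ∀ z z', G.Adj y z → G.Adj y z' → G.Adj z z' → ¬ G.Adj c z → ¬ G.Adj c z' →
        c ≠ z → c ≠ z' → (∃ l₁ l₂, X = l₁ ++ z :: z' :: l₂) ∨ (∃ m, X = z :: (m ++ [z'])) →
        False := by
      intro z z' hyz hyz' hzz hcnz hcnz' hcz hcz' hform
      apply short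
      have t1 := tAdj_of_triangle hyz hyz' hzz
      have t2 := tAdj_of_triangle hyz' hyz hzz.symm
      rcases hform with ⟨l₁, l₂, heq⟩ | ⟨m, heq⟩
      · have hc := hcX
        rw [heq] at hc
        simp only [List.mem_append, List.mem_cons, hcz, hcz', false_or] at hc
        rcases hc with h | h
        · obtain ⟨m₁, m₂, rfl⟩ := List.append_of_mem h
          obtain ⟨W, hW, hl, hWX⟩ := hXr.shortcut (l₁ := l₂.reverse) (m₁ := m₂.reverse)
            (m₂ := m₁.reverse) (y := y) (z := z') (z' := z) (c := c) (by simp [heq])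
            (by simpa using hyX) t1 hyc hcnz' hcnz
          exact ⟨W, hW, by simpa using hl, fin W (by simpa using hWX)⟩
        · obtain ⟨m₁, m₂, rfl⟩ := List.append_of_mem h
          obtain ⟨W, hW, hl, hWX⟩ := hX.shortcut heq hyX t2 hyc hcnz hcnz'
          exact ⟨W, hW, hl, fin W hWX⟩
      · have hc := hcX
        rw [heq] at hc
        simp only [List.mem_append, List.mem_cons, hcz, hcz', false_or, List.not_mem_nil,
          or_false] at hc
        obtain ⟨m₁, m₂, rfl⟩ := List.append_of_mem hc
        obtain ⟨W, hW, hl, hWX⟩ := hX.shortcut_ends (m₁ := m₁) (m₂ := m₂) (by simp [heq]) hyX t1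
          hyc hcnz hcnz'
        exact ⟨W, hW, hl, fin W hWX⟩
    rcases hX.form hU hmin hzX hzX' hzz with ⟨l₁, l₂, h | h⟩ | ⟨m, h | h⟩
    · exact main z z' hyz hyz' hzz hcnz hcnz' hcz hcz' (Or.inl ⟨_, _, h⟩)
    · exact main z' z hyz' hyz hzz.symm hcnz' hcnz hcz' hcz (Or.inl ⟨_, _, h⟩)
    · exact main z z' hyz hyz' hzz hcnz hcnz' hcz hcz' (Or.inr ⟨_, h⟩)
    · exact main z' z hyz' hyz hzz.symm hcnz' hcnz hcz' hcz (Or.inr ⟨_, h⟩)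
  · obtain ⟨w, w', hwX, hwX', hcw, hcw', hww⟩ := base c hcX hcM
    have fin : ∀ W : List V, (∀ v ∈ W, v = y ∨ v = c ∨ v ∈ X) → ∀ v ∈ W, v ∉ M := fun W hW v hv => by
      rcases hW v hv with rfl | rfl | h
      · exact hyM
      · exact hcM
      · exact hXM v h
    have hminr : ∀ W, G.IsRing W → (∀ v ∈ W, v ∈ X.reverse) → X.reverse.length ≤ W.length := by
      simpa using hmin
    have hwz : w ≠ z ∧ w ≠ z' := ⟨fun h => hcnz (h ▸ hcw), fun h => hcnz' (h ▸ hcw)⟩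
    have hwz' : w' ≠ z ∧ w' ≠ z' := ⟨fun h => hcnz (h ▸ hcw'), fun h => hcnz' (h ▸ hcw')⟩
    -- `w` and `w'` both after the consecutive vertices `z` and `z'`
    have after : ∀ X : List V, G.IsRing X → (∀ W, G.IsRing W → (∀ v ∈ W, v ∈ X) →
        X.length ≤ W.length) → y ∉ X → c ∉ X → ∀ z z' w w' l₁ l₂, X = l₁ ++ z :: z' :: l₂ →
        G.Adj y z → G.TAdj y z' → G.TAdj c w → G.TAdj c w' → G.Adj w w' → w ∈ l₂ → w' ∈ l₂ →
        ∃ W, G.IsRing W ∧ W.length < X.length ∧ ∀ v ∈ W, v = y ∨ v = c ∨ v ∈ X := by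
      intro X hX hmin hyX hcX z z' w w' l₁ l₂ heq hyz hyz' hcw hcw' hww hw hw'
      have ord : ∀ w w' m t, G.TAdj c w → G.TAdj c w' → G.Adj w w' → l₂ = m ++ w :: t → w' ∈ t →
          ∃ W, G.IsRing W ∧ W.length < X.length ∧ ∀ v ∈ W, v = y ∨ v = c ∨ v ∈ X := by
        intro w w' m t hcw hcw' hww hl hw'
        obtain ⟨k, t', rfl⟩ := List.append_of_mem hw'
        by_cases hk : k = []
        · exact hX.shortcut₂ hU (by simpa [hl, hk] using heq) hyX hcX hyc hyz hyz' hcw hcw'.1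
        · have := (hX.chord hU hmin (l₁ := l₁ ++ z :: z' :: m) (l₂ := k) (l₃ := t')
            (by simp [heq, hl]) hk hww).1
          simp at this
      obtain ⟨m, t, hl⟩ := List.append_of_mem hw
      rw [hl] at hw'
      simp only [List.mem_append, List.mem_cons] at hw'
      rcases hw' with h | h | h
      · obtain ⟨m₁, m₂, rfl⟩ := List.append_of_mem h
        exact ord w' w m₁ (m₂ ++ w :: t) hcw' hcw hww.symm (by simp [hl]) (by simp)
      · exact absurd h hww.ne'
      · exact ord w w' m t hcw hcw' hww hl h
    have main : ∀ z z', G.Adj y z → G.Adj y z' → G.Adj z z' → (w ≠ z ∧ w ≠ z') →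
        (w' ≠ z ∧ w' ≠ z') → (∃ l₁ l₂, X = l₁ ++ z :: z' :: l₂) ∨ (∃ m, X = z :: (m ++ [z'])) →
        False := by
      intro z z' hyz hyz' hzz hwz hwz' hform
      apply short
      have t1 := tAdj_of_triangle hyz hyz' hzz
      have t2 := tAdj_of_triangle hyz' hyz hzz.symm
      have t3 := tAdj_of_triangle hcw hcw' hww
      have t4 := tAdj_of_triangle hcw' hcw hww.symm
      rcases hform with ⟨l₁, l₂, heq⟩ | ⟨m, heq⟩
      · -- one of `w`, `w'` before and one after: they are the ends of the ring
        have across : ∀ w w', G.Adj w w' → G.TAdj c w → G.TAdj c w' → w ∈ l₁ → w' ∈ l₂ →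
            ∃ W, G.IsRing W ∧ W.length < X.length ∧ ∀ v ∈ W, v = c ∨ v = y ∨ v ∈ X := by
          intro w w' hww t3 t4 hw hw'
          obtain ⟨m₁, m₂, rfl⟩ := List.append_of_mem hw
          obtain ⟨m₃, m₄, rfl⟩ := List.append_of_mem hw'
          obtain ⟨rfl, rfl⟩ := hX.chord hU hmin (l₁ := m₁) (l₂ := m₂ ++ z :: z' :: m₃) (l₃ := m₄)
            (by simp [heq]) (by simp) hww
          exact hX.shortcut₂_ends hU (m₁ := m₂) (m₂ := m₃) (by simp [heq]) hcX hyX hyc.symm t3 t4.1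
            t1 hyz'
        have hw := hwX
        have hw' := hwX'
        rw [heq] at hw hw'
        simp only [List.mem_append, List.mem_cons, hwz.1, hwz.2, hwz'.1, hwz'.2,
          false_or] at hw hw'
        rcases hw with hw | hw <;> rcases hw' with hw' | hw'
        · obtain ⟨W, hW, hl, hWX⟩ := after X.reverse hXr hminr (by simpa using hyX)
            (by simpa using hcX) z' z w w' l₂.reverse l₁.reverse (by simp [heq]) hyz' t1 t3 t4 hww
            (by simpa using hw) (by simpa using hw')
          exact ⟨W, hW, by simpa using hl, fin W (by simpa using hWX)⟩
        · obtain ⟨W, hW, hl, hWX⟩ := across w w' hww t3 t4 hw hw'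
          exact ⟨W, hW, hl, fin W fun v hv => or_left_comm.1 (hWX v hv)⟩
        · obtain ⟨W, hW, hl, hWX⟩ := across w' w hww.symm t4 t3 hw' hw
          exact ⟨W, hW, hl, fin W fun v hv => or_left_comm.1 (hWX v hv)⟩
        · obtain ⟨W, hW, hl, hWX⟩ := after X hX hmin hyX hcX z z' w w' l₁ l₂ heq hyz t2 t3 t4 hww
            hw hw'
          exact ⟨W, hW, hl, fin W hWX⟩
      · have ends : ∀ w w' l₁ l₂, G.TAdj c w → G.TAdj c w' → G.Adj w w' → (w ≠ z ∧ w ≠ z') →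
            (w' ≠ z ∧ w' ≠ z') → X = l₁ ++ w :: w' :: l₂ →
            ∃ W, G.IsRing W ∧ W.length < X.length ∧ ∀ v ∈ W, v = y ∨ v = c ∨ v ∈ X := by
          intro w w' l₁ l₂ t3 t4 hww hwz hwz' heq'
          rw [heq] at heq'
          match l₁ with
          | [] =>
            simp only [List.nil_append, List.cons.injEq] at heq'
            exact absurd heq'.1.symm hwz.1
          | x :: l₁ =>
            simp only [List.cons_append, List.cons.injEq] at heq'
            rcases List.eq_nil_or_concat l₂ with rfl | ⟨l₃, x', rfl⟩
            · have := congrArg List.getLast? heq'.2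
              simp at this
              exact absurd this.symm hwz'.2
            · have h2 : m ++ [z'] = (l₁ ++ w :: w' :: l₃) ++ [x'] := by
                simpa using heq'.2
              have h3 := List.append_inj_left' h2 rfl
              exact hX.shortcut₂_ends hU (m₁ := l₁) (m₂ := l₃) (by simp [heq, h3]) hyX hcX hyc t1
                hyz' t3 t4.1
        have hnd := hX.2.1
        rcases hX.form hU hmin hwX hwX' hww with ⟨l₁, l₂, h | h⟩ | ⟨k, h | h⟩
        · obtain ⟨W, hW, hl, hWX⟩ := ends w w' l₁ l₂ t3 t4 hww hwz hwz' h
          exact ⟨W, hW, hl, fin W hWX⟩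
        · obtain ⟨W, hW, hl, hWX⟩ := ends w' w l₁ l₂ t4 t3 hww.symm hwz' hwz h
          exact ⟨W, hW, hl, fin W hWX⟩
        · rw [heq] at h
          simp only [List.cons.injEq] at h
          exact absurd h.1.symm hwz.1
        · rw [heq] at h
          simp only [List.cons.injEq] at h
          exact absurd h.1.symm hwz'.1
    rcases hX.form hU hmin hzX hzX' hzz with ⟨l₁, l₂, h | h⟩ | ⟨m, h | h⟩
    · exact main z z' hyz hyz' hzz hwz hwz' (Or.inl ⟨_, _, h⟩)
    · exact main z' z hyz' hyz hzz.symm hwz.symm hwz'.symm (Or.inl ⟨_, _, h⟩)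
    · exact main z z' hyz hyz' hzz hwz hwz' (Or.inr ⟨_, h⟩)
    · exact main z' z hyz' hyz hzz.symm hwz.symm hwz'.symm (Or.inr ⟨_, h⟩)

end Crit

/-! ### Graphs of the class: leaves, pieces and prisms -/

section
variable {V : Type*} {G : SimpleGraph V}

/-- The vertex `x` has exactly two neighbours `p` and `q`, and these are adjacent. -/
def Leaf (G : SimpleGraph V) (x p q : V) : Prop :=
  G.Adj p q ∧ ∀ v, G.Adj x v ↔ v = p ∨ v = q

/-- The vertices `y₁` and `y₂` of a triangle `y₁ y₂ s` have one further neighbour each, `u` and `w`,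
and these are adjacent, as in a prism. -/
def Piece (G : SimpleGraph V) (y₁ y₂ s u w : V) : Prop :=
  G.Adj u w ∧ (∀ v, G.Adj y₁ v ↔ v = y₂ ∨ v = s ∨ v = u) ∧
    ∀ v, G.Adj y₂ v ↔ v = y₁ ∨ v = s ∨ v = w

/-- A clique on two or three vertices that separates the graph. -/
def CliqueCut (G : SimpleGraph V) (K : Set V) : Prop :=
  (∀ a ∈ K, ∀ b ∈ K, a ≠ b → G.Adj a b) ∧ (K.ncard = 2 ∨ K.ncard = 3) ∧ G.Separates K

/-- Distinct and not adjacent. -/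
def Far (G : SimpleGraph V) (a b : V) : Prop := a ≠ b ∧ ¬ G.Adj a b

/-- The triangles `s t₁ t₂` and `s' t₁' t₂'` with the matching `s s'`, `t₁ t₁'`, `t₂ t₂'` form an
induced prism. -/
structure IsPrismAt (G : SimpleGraph V) (s t₁ t₂ s' t₁' t₂' : V) : Prop where
  a1 : G.Adj s t₁
  a2 : G.Adj s t₂
  a3 : G.Adj t₁ t₂
  b1 : G.Adj s' t₁'
  b2 : G.Adj s' t₂'
  b3 : G.Adj t₁' t₂'
  m0 : G.Adj s s'
  m1 : G.Adj t₁ t₁'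
  m2 : G.Adj t₂ t₂'
  f1 : G.Far s t₁'
  f2 : G.Far s t₂'
  f3 : G.Far t₁ s'
  f4 : G.Far t₂ s'
  f5 : G.Far t₁ t₂'
  f6 : G.Far t₂ t₁'

/-- The vertex `v` has no neighbours besides `a`, `b`, `c`, unless it lies in a clique cutset. -/
def OnlyOrCut (G : SimpleGraph V) (v a b c : V) : Prop :=
  (∀ x, G.Adj v x → x = a ∨ x = b ∨ x = c) ∨ ∃ K, G.CliqueCut K ∧ v ∈ K

/-- How the neighbourhood of `s` looks in a graph of the class. -/
def AtomAt (G : SimpleGraph V) (s : V) : Prop :=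
  (∃ K, G.CliqueCut K ∧ s ∈ K) ∨ (∃ p q, G.Leaf s p q) ∨
    ∃ t₁ t₂ s' t₁' t₂', G.IsPrismAt s t₁ t₂ s' t₁' t₂' ∧
      (∀ x, G.Adj s x → x = t₁ ∨ x = t₂ ∨ x = s') ∧ G.OnlyOrCut t₁ s t₂ t₁' ∧
      G.OnlyOrCut t₂ s t₁ t₂' ∧ G.OnlyOrCut s' s t₁' t₂'

/-- `G` is the union of `A` and `B`, which meet in a clique on two or three vertices. -/
structure Glued (A B : G.Subgraph) : Prop where
  cover : ∀ v, v ∈ A.verts ∨ v ∈ B.verts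
  adj : ∀ a b, G.Adj a b → A.Adj a b ∨ B.Adj a b
  clique : ∀ a b, a ∈ A.verts → a ∈ B.verts → b ∈ A.verts → b ∈ B.verts → a ≠ b →
    A.Adj a b ∧ B.Adj a b
  card : (A.verts ∩ B.verts).ncard = 2 ∨ (A.verts ∩ B.verts).ncard = 3

theorem Glued.symm {A B : G.Subgraph} (h : Glued A B) : Glued B A where
  cover v := (h.cover v).symm
  adj a b hab := (h.adj a b hab).symm
  clique a b h1 h2 h3 h4 hab := (h.clique a b h2 h1 h4 h3 hab).symm
  card := by rw [Set.inter_comm]; exact h.card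

theorem glued_of_iso {A B : G.Subgraph} (hunion : A ⊔ B = ⊤)
    (hinter : Nonempty ((A ⊓ B).coe ≃g completeGraph (Fin 2)) ∨
      Nonempty ((A ⊓ B).coe ≃g completeGraph (Fin 3))) : Glued A B := by
  have hcl : ∀ k, Nonempty ((A ⊓ B).coe ≃g completeGraph (Fin k)) →
      (∀ a b, a ∈ A.verts → a ∈ B.verts → b ∈ A.verts → b ∈ B.verts → a ≠ b →
        A.Adj a b ∧ B.Adj a b) ∧ (A.verts ∩ B.verts).ncard = k := by
    rintro k ⟨e⟩
    refine ⟨fun a b h1 h2 h3 h4 hab => ?_, ?_⟩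
    · have ha : a ∈ (A ⊓ B).verts := ⟨h1, h2⟩
      have hb : b ∈ (A ⊓ B).verts := ⟨h3, h4⟩
      have h : (A ⊓ B).coe.Adj ⟨a, ha⟩ ⟨b, hb⟩ := by
        rw [← e.map_adj_iff]
        simpa [completeGraph] using hab
      exact h
    · have := Nat.card_congr e.toEquiv
      rw [Nat.card_fin, Nat.card_coe_set_eq] at this
      exact this
  refine ⟨fun v => ?_, fun a b hab => ?_, ?_, ?_⟩
  · have : v ∈ (A ⊔ B).verts := by rw [hunion]; trivial
    exact this
  · have : (A ⊔ B).Adj a b := by rw [hunion]; exact hab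
    exact this
  · rcases hinter with h | h
    · exact (hcl _ h).1
    · exact (hcl _ h).1
  · rcases hinter with h | h
    · exact Or.inl (hcl _ h).2
    · exact Or.inr (hcl _ h).2

theorem Glued.adj_left {A B : G.Subgraph} (h : Glued A B) {a b : V} (ha : a ∈ A.verts)
    (hb : b ∈ A.verts) (hab : G.Adj a b) : A.Adj a b := by
  rcases h.adj a b hab with h' | h'
  · exact h'
  · exact (h.clique a b ha (B.edge_vert h') hb (B.edge_vert h'.symm) hab.ne).1

theorem Glued.adj_of_notMem {A B : G.Subgraph} (h : Glued A B) {a : V} (ha : a ∉ B.verts) :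
    ∀ b, G.Adj a b → A.Adj a b := fun b hab =>
  (h.adj a b hab).resolve_right fun h' => ha (B.edge_vert h')

theorem Glued.adj_of_subset {A B : G.Subgraph} (h : Glued A B) (hBA : B.verts ⊆ A.verts) :
    ∀ a b, G.Adj a b → A.Adj a b := fun a b hab =>
  h.adj_left ((h.cover a).elim id fun h' => hBA h') ((h.cover b).elim id fun h' => hBA h') hab

theorem Leaf.of_coe {A : G.Subgraph} {x p q : A.verts} (h : A.coe.Leaf x p q)
    (hx : ∀ v, G.Adj x v → A.Adj x v) : G.Leaf x p q := by
  refine ⟨A.adj_sub h.1, fun v => ⟨fun hv => ?_, ?_⟩⟩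
  · have hA := hx v hv
    have := (h.2 ⟨v, A.edge_vert hA.symm⟩).1 hA
    exact this.imp (congrArg Subtype.val) (congrArg Subtype.val)
  · rintro (rfl | rfl)
    · exact A.adj_sub ((h.2 p).2 (Or.inl rfl))
    · exact A.adj_sub ((h.2 q).2 (Or.inr rfl))

theorem Piece.of_coe {A : G.Subgraph} {y₁ y₂ s u w : A.verts} (h : A.coe.Piece y₁ y₂ s u w)
    (h₁ : ∀ v, G.Adj y₁ v → A.Adj y₁ v) (h₂ : ∀ v, G.Adj y₂ v → A.Adj y₂ v) :
    G.Piece y₁ y₂ s u w := by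
  have key : ∀ {y a b c : A.verts}, (∀ v, A.coe.Adj y v ↔ v = a ∨ v = b ∨ v = c) →
      (∀ v, G.Adj y v → A.Adj y v) → ∀ v, G.Adj y v ↔ v = (a : V) ∨ v = b ∨ v = c := by
    intro y a b c h hy v
    constructor
    · intro hv
      have hA := hy v hv
      have := (h ⟨v, A.edge_vert hA.symm⟩).1 hA
      exact this.imp (congrArg Subtype.val) (Or.imp (congrArg Subtype.val) (congrArg Subtype.val))
    · rintro (rfl | rfl | rfl)
      · exact A.adj_sub ((h a).2 (by simp))
      · exact A.adj_sub ((h b).2 (by simp))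
      · exact A.adj_sub ((h c).2 (by simp))
  exact ⟨A.adj_sub h.1, key h.2.1 h₁, key h.2.2 h₂⟩

theorem prism_adj (i j : Fin 6) :
    (cycleGraph 6)ᶜ.Adj i j ↔ j = i + 2 ∨ j = i + 4 ∨ j = i + 3 := by
  revert i j
  decide

/-- A proper nonempty clique `T` of a graph in the class misses a vertex of degree two in a
triangle, or the two inner vertices of a piece without the given vertex `m ∈ T`. -/
theorem exists_leaf_or_piece {V : Type u} {G : SimpleGraph V} (h : InGsc G) :
    ∀ T : Set V, (∀ a ∈ T, ∀ b ∈ T, a ≠ b → G.Adj a b) → ∀ m ∈ T, (∃ v, v ∉ T) →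
      (∃ x p q, x ∉ T ∧ G.Leaf x p q) ∨ ∃ y₁ y₂ s u w, G.Piece y₁ y₂ s u w ∧ y₁ ∉ T ∧ y₂ ∉ T ∧
        m ≠ y₁ ∧ m ≠ y₂ ∧ m ≠ s ∧ m ≠ u ∧ m ≠ w := by
  induction h with
  | @triangle V G h =>
    rintro T - m - ⟨v, hv⟩
    obtain ⟨e⟩ := h
    have h3 : ∀ i j : Fin 3, i ≠ j ↔ j = i + 1 ∨ j = i + 2 := by decide
    have hadj : ∀ a b, G.Adj a b ↔ e b = e a + 1 ∨ e b = e a + 2 := fun a b => by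
      rw [← h3, ← e.map_adj_iff]
      simp [completeGraph]
    refine Or.inl ⟨v, e.symm (e v + 1), e.symm (e v + 2), hv, ?_, fun x => ?_⟩
    · rw [hadj]
      simp only [RelIso.apply_symm_apply]
      generalize e v = i
      revert i
      decide
    · rw [hadj, ← e.injective.eq_iff, ← e.injective.eq_iff]
      simp
  | @prism V G h =>
    rintro T hT m hm -
    obtain ⟨e⟩ := h
    have hadj : ∀ a b, G.Adj a b ↔ e b = e a + 2 ∨ e b = e a + 4 ∨ e b = e a + 3 := fun a b => by
      rw [← prism_adj, e.map_adj_iff]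
    have hfar : ∀ i, i ≠ 0 → i ≠ 2 → i ≠ 3 → i ≠ 4 → e.symm (e m + i) ∉ T := by
      intro i h0 h2 h3 h4 hi
      have h1 := hT m hm _ hi (fun h => h0 (by
        have := congrArg e h
        simpa using this))
      rw [hadj] at h1
      simp only [RelIso.apply_symm_apply] at h1
      rcases h1 with h1 | h1 | h1
      · exact h2 (add_left_cancel h1)
      · exact h4 (add_left_cancel h1)
      · exact h3 (add_left_cancel h1)
    refine Or.inr ⟨e.symm (e m + 5), e.symm (e m + 1), e.symm (e m + 3), e.symm (e m + 2),
      e.symm (e m + 4), ⟨?_, ?_, ?_⟩, hfar 5 (by decide) (by decide) (by decide) (by decide),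
      hfar 1 (by decide) (by decide) (by decide) (by decide), ?_, ?_, ?_, ?_, ?_⟩
    · rw [hadj]
      simp only [RelIso.apply_symm_apply]
      generalize e m = i
      revert i
      decide
    · intro v
      rw [hadj, ← e.injective.eq_iff, ← e.injective.eq_iff, ← e.injective.eq_iff]
      simp only [RelIso.apply_symm_apply]
      generalize e m = i
      generalize e v = j
      revert i j
      decide
    · intro v
      rw [hadj, ← e.injective.eq_iff, ← e.injective.eq_iff, ← e.injective.eq_iff]
      simp only [RelIso.apply_symm_apply]
      generalize e m = i
      generalize e v = j
      revert i j
      decide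
    all_goals
      intro h
      have := congrArg e h
      simp at this
  | @glue V G A B hA hB hunion hinter ihA ihB =>
    have hg := glued_of_iso hunion hinter
    -- the case in which `T` lies in the first part
    have main : ∀ A B : G.Subgraph, Glued A B →
        (∀ T : Set A.verts, (∀ a ∈ T, ∀ b ∈ T, a ≠ b → A.coe.Adj a b) → ∀ m ∈ T, (∃ v, v ∉ T) →
          (∃ x p q, x ∉ T ∧ A.coe.Leaf x p q) ∨ ∃ y₁ y₂ s u w, A.coe.Piece y₁ y₂ s u w ∧ y₁ ∉ T ∧
            y₂ ∉ T ∧ m ≠ y₁ ∧ m ≠ y₂ ∧ m ≠ s ∧ m ≠ u ∧ m ≠ w) →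
        (∀ T : Set B.verts, (∀ a ∈ T, ∀ b ∈ T, a ≠ b → B.coe.Adj a b) → ∀ m ∈ T, (∃ v, v ∉ T) →
          (∃ x p q, x ∉ T ∧ B.coe.Leaf x p q) ∨ ∃ y₁ y₂ s u w, B.coe.Piece y₁ y₂ s u w ∧ y₁ ∉ T ∧
            y₂ ∉ T ∧ m ≠ y₁ ∧ m ≠ y₂ ∧ m ≠ s ∧ m ≠ u ∧ m ≠ w) →
        ∀ T : Set V, (∀ a ∈ T, ∀ b ∈ T, a ≠ b → G.Adj a b) → T ⊆ A.verts → ∀ m ∈ T, (∃ v, v ∉ T) →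
          (∃ x p q, x ∉ T ∧ G.Leaf x p q) ∨ ∃ y₁ y₂ s u w, G.Piece y₁ y₂ s u w ∧ y₁ ∉ T ∧ y₂ ∉ T ∧
            m ≠ y₁ ∧ m ≠ y₂ ∧ m ≠ s ∧ m ≠ u ∧ m ≠ w := by
      intro A B hg ihA ihB T hT hTA m hm hv
      by_cases hBA : B.verts ⊆ A.verts
      · have hall := hg.adj_of_subset hBA
        obtain ⟨v, hv⟩ := hv
        have hvA : v ∈ A.verts := (hg.cover v).elim id fun h' => hBA h'
        rcases ihA {x | (x : V) ∈ T} (fun a ha b hb hab => hall _ _ (hT a ha b hb fun h =>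
          hab (Subtype.ext h))) ⟨m, hTA hm⟩ hm ⟨⟨v, hvA⟩, hv⟩ with
          ⟨x, p, q, hx, hl⟩ | ⟨y₁, y₂, s, u, w, hp, h1, h2, h3, h4, h5, h6, h7⟩
        · exact Or.inl ⟨x, p, q, hx, hl.of_coe (hall x)⟩
        · exact Or.inr ⟨y₁, y₂, s, u, w, hp.of_coe (hall _) (hall _), h1, h2,
            fun h => h3 (Subtype.ext h), fun h => h4 (Subtype.ext h), fun h => h5 (Subtype.ext h),
            fun h => h6 (Subtype.ext h), fun h => h7 (Subtype.ext h)⟩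
      · obtain ⟨v, hvB, hvA⟩ := Set.not_subset.1 hBA
        obtain ⟨m', hm', hmm⟩ : ∃ m' : B.verts, (m' : V) ∈ A.verts ∧
            ∀ x : B.verts, m' ≠ x → m ≠ (x : V) := by
          by_cases hmB : m ∈ B.verts
          · exact ⟨⟨m, hmB⟩, hTA hm, fun x hx h => hx (Subtype.ext h)⟩
          · obtain ⟨j, hj⟩ : (A.verts ∩ B.verts).Nonempty := by
              rw [Set.nonempty_iff_ne_empty]
              intro h
              have := hg.card
              simp [h] at this
            exact ⟨⟨j, hj.2⟩, hj.1, fun x _ h => hmB (h ▸ x.2)⟩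
        rcases ihB {x | (x : V) ∈ A.verts} (fun a ha b hb hab => (hg.clique a b ha a.2 hb b.2
          fun h => hab (Subtype.ext h)).2) m' hm' ⟨⟨v, hvB⟩, hvA⟩ with
          ⟨x, p, q, hx, hl⟩ | ⟨y₁, y₂, s, u, w, hp, h1, h2, h3, h4, h5, h6, h7⟩
        · exact Or.inl ⟨x, p, q, fun h => hx (hTA h), hl.of_coe (hg.symm.adj_of_notMem hx)⟩
        · exact Or.inr ⟨y₁, y₂, s, u, w, hp.of_coe (hg.symm.adj_of_notMem h1)
            (hg.symm.adj_of_notMem h2), fun h => h1 (hTA h), fun h => h2 (hTA h), hmm _ h3,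
            hmm _ h4, hmm _ h5, hmm _ h6, hmm _ h7⟩
    intro T hT m hm hv
    by_cases hTA : T ⊆ A.verts
    · exact main A B hg ihA ihB T hT hTA m hm hv
    · obtain ⟨t, ht, htA⟩ := Set.not_subset.1 hTA
      refine main B A hg.symm ihB ihA T hT (fun x hx => ?_) m hm hv
      by_cases hxt : x = t
      · exact hxt ▸ (hg.cover t).resolve_left htA
      · exact B.edge_vert (hg.symm.adj_of_notMem htA x (hT t ht x hx (Ne.symm hxt))).symm

theorem CliqueCut.of_coe {A B : G.Subgraph} (hg : Glued A B) {K : Set A.verts}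
    (h : A.coe.CliqueCut K) : G.CliqueCut (Subtype.val '' K) := by
  obtain ⟨hcl, hcard, C, hCne, hCK, hq, hC⟩ := h
  refine ⟨?_, by rwa [Set.ncard_image_of_injective _ Subtype.val_injective], ?_⟩
  · rintro _ ⟨a, ha, rfl⟩ _ ⟨b, hb, rfl⟩ hab
    exact A.adj_sub (hcl a ha b hb fun h => hab (congrArg _ h))
  have hmem : ∀ {x : A.verts} {T : Set A.verts}, (x : V) ∈ (Subtype.val '' T : Set V) ↔ x ∈ T :=
    fun {x T} => Subtype.val_injective.mem_set_image
  -- one side of the cut avoids the other part of the glueing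
  have main : ∀ C : Set A.verts, C.Nonempty → (∀ a ∈ C, a ∉ K) → (∃ q, q ∉ C ∧ q ∉ K) →
      (∀ a ∈ C, ∀ b, A.coe.Adj a b → b ∈ C ∨ b ∈ K) → (∀ a ∈ C, (a : V) ∉ B.verts) →
      G.Separates (Subtype.val '' K) := by
    rintro C ⟨c, hc⟩ hCK ⟨q, hq, hqK⟩ hC hCB
    refine ⟨Subtype.val '' C, ⟨c, hmem.2 hc⟩, ?_, ⟨q, fun h => hq (hmem.1 h),
      fun h => hqK (hmem.1 h)⟩, ?_⟩
    · rintro _ ⟨a, ha, rfl⟩ h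
      exact hCK a ha (hmem.1 h)
    · rintro _ ⟨a, ha, rfl⟩ b hab
      have hA := hg.adj_of_notMem (hCB a ha) b hab
      exact (hC a ha ⟨b, A.edge_vert hA.symm⟩ hA).imp (fun h => ⟨_, h, rfl⟩) fun h => ⟨_, h, rfl⟩
  by_cases hCB : ∀ a ∈ C, (a : V) ∉ B.verts
  · exact main C hCne hCK hq hC hCB
  · push Not at hCB
    obtain ⟨a, ha, haB⟩ := hCB
    refine main {x | x ∉ C ∧ x ∉ K} hq (fun x hx => hx.2) ?_ ?_ ?_
    · obtain ⟨c, hc⟩ := hCne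
      exact ⟨c, fun h => h.1 hc, hCK c hc⟩
    · intro x hx y hxy
      by_cases hyK : y ∈ K
      · exact Or.inr hyK
      · exact Or.inl ⟨fun hyC => (hC y hyC x hxy.symm).elim hx.1 hx.2, hyK⟩
    · intro x hx hxB
      have hax : (a : V) ≠ x := fun h => hx.1 (Subtype.ext h ▸ ha)
      exact (hC a ha x (hg.clique a x a.2 haB x.2 hxB hax).1).elim hx.1 hx.2

theorem OnlyOrCut.of_coe {A B : G.Subgraph} (hg : Glued A B) {v a b c : A.verts}
    (hv : (∀ x, G.Adj v x → A.Adj v x) ∨ ∃ K, G.CliqueCut K ∧ (v : V) ∈ K)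
    (h : A.coe.OnlyOrCut v a b c) : G.OnlyOrCut v a b c := by
  rcases h with h | ⟨K, hK, hvK⟩
  · rcases hv with hv | hv
    · refine Or.inl fun x hx => ?_
      have hA := hv x hx
      have := h ⟨x, A.edge_vert hA.symm⟩ hA
      exact this.imp (congrArg Subtype.val) (Or.imp (congrArg Subtype.val) (congrArg Subtype.val))
    · exact Or.inr hv
  · exact Or.inr ⟨_, hK.of_coe hg, v, hvK, rfl⟩

theorem AtomAt.of_coe {A B : G.Subgraph} (hg : Glued A B) {s : A.verts} (h : A.coe.AtomAt s)
    (hs : ∀ x, G.Adj s x → A.Adj s x)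
    (hv : ∀ v : A.verts, (∀ x, G.Adj v x → A.Adj v x) ∨ ∃ K, G.CliqueCut K ∧ (v : V) ∈ K) :
    G.AtomAt s := by
  rcases h with ⟨K, hK, hsK⟩ | ⟨p, q, hl⟩ | ⟨t₁, t₂, s', t₁', t₂', hp, hsn, h1, h2, h3⟩
  · exact Or.inl ⟨_, hK.of_coe hg, s, hsK, rfl⟩
  · exact Or.inr (Or.inl ⟨p, q, hl.of_coe hs⟩)
  · refine Or.inr (Or.inr ⟨t₁, t₂, s', t₁', t₂', ?_, ?_, h1.of_coe hg (hv _), h2.of_coe hg (hv _),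
      h3.of_coe hg (hv _)⟩)
    · have far : ∀ {a b : A.verts}, A.coe.Far a b → G.Far a b := fun {a b} h =>
        ⟨fun h' => h.1 (Subtype.ext h'), fun h' => h.2 (hg.adj_left a.2 b.2 h')⟩
      exact ⟨A.adj_sub hp.a1, A.adj_sub hp.a2, A.adj_sub hp.a3, A.adj_sub hp.b1, A.adj_sub hp.b2,
        A.adj_sub hp.b3, A.adj_sub hp.m0, A.adj_sub hp.m1, A.adj_sub hp.m2, far hp.f1, far hp.f2,
        far hp.f3, far hp.f4, far hp.f5, far hp.f6⟩
    · intro x hx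
      have hA := hs x hx
      have := hsn ⟨x, A.edge_vert hA.symm⟩ hA
      exact this.imp (congrArg Subtype.val) (Or.imp (congrArg Subtype.val) (congrArg Subtype.val))

theorem Glued.cliqueCut {A B : G.Subgraph} (hg : Glued A B) (hA : ¬ A.verts ⊆ B.verts)
    (hB : ¬ B.verts ⊆ A.verts) : G.CliqueCut (A.verts ∩ B.verts) := by
  obtain ⟨a, haA, haB⟩ := Set.not_subset.1 hA
  obtain ⟨b, hbB, hbA⟩ := Set.not_subset.1 hB
  refine ⟨fun x hx y hy hxy => A.adj_sub (hg.clique x y hx.1 hx.2 hy.1 hy.2 hxy).1, hg.card,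
    A.verts \ B.verts, ⟨a, haA, haB⟩, fun x hx h => hx.2 h.2,
    ⟨b, fun h => hbA h.1, fun h => hbA h.1⟩, fun x hx y hxy => ?_⟩
  have hyA := A.edge_vert (hg.adj_of_notMem hx.2 y hxy).symm
  by_cases hyB : y ∈ B.verts
  · exact Or.inr ⟨hyA, hyB⟩
  · exact Or.inl ⟨hyA, hyB⟩

/-- Each vertex of a graph in the class has one of the three kinds of neighbourhoods. In a proper
glueing, only the vertices of the common clique gain neighbours, and this clique is a cutset; hence
the exemption in `OnlyOrCut`. -/
theorem atomAt_of_inGsc {V : Type u} {G : SimpleGraph V} (h : InGsc G) : ∀ s, G.AtomAt s := by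
  induction h with
  | @triangle V G h =>
    intro v
    obtain ⟨e⟩ := h
    have h3 : ∀ i j : Fin 3, i ≠ j ↔ j = i + 1 ∨ j = i + 2 := by decide
    have hadj : ∀ a b, G.Adj a b ↔ e b = e a + 1 ∨ e b = e a + 2 := fun a b => by
      rw [← h3, ← e.map_adj_iff]
      simp [completeGraph]
    refine Or.inr (Or.inl ⟨e.symm (e v + 1), e.symm (e v + 2), ?_, fun x => ?_⟩)
    · rw [hadj]
      simp only [RelIso.apply_symm_apply]
      generalize e v = i
      revert i
      decide
    · rw [hadj, ← e.injective.eq_iff, ← e.injective.eq_iff]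
      simp
  | @prism V G h =>
    intro s
    obtain ⟨e⟩ := h
    have hadj : ∀ a b, G.Adj a b ↔ e b = e a + 2 ∨ e b = e a + 4 ∨ e b = e a + 3 := fun a b => by
      rw [← prism_adj, e.map_adj_iff]
    have hs : ∀ i j, G.Adj (e.symm (e s + i)) (e.symm (e s + j)) ↔
        j = i + 2 ∨ j = i + 4 ∨ j = i + 3 := fun i j => by
      rw [hadj]
      simp only [RelIso.apply_symm_apply, add_assoc, add_right_inj]
    have hne : ∀ i j, e.symm (e s + i) ≠ e.symm (e s + j) ↔ i ≠ j := fun i j => by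
      rw [Ne, e.symm.injective.eq_iff, add_right_inj]
    obtain ⟨σ, hσ⟩ : ∃ σ : Fin 6 → V, ∀ i, σ i = e.symm (e s + i) := ⟨_, fun i => rfl⟩
    have h0 : s = σ 0 := by rw [hσ]; simp
    have hσs : ∀ x, ∃ i, x = σ i := fun x => ⟨e x - e s, by rw [hσ]; simp⟩
    simp only [← hσ] at hs hne
    have far : ∀ i j, i ≠ j → ¬ (j = i + 2 ∨ j = i + 4 ∨ j = i + 3) → G.Far (σ i) (σ j) :=
      fun i j h h' => ⟨(hne i j).2 h, fun h'' => h' ((hs i j).1 h'')⟩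
    have only : ∀ i j, G.Adj (σ i) j → j = σ (i + 2) ∨ j = σ (i + 4) ∨ j = σ (i + 3) := by
      intro i x hx
      obtain ⟨j, rfl⟩ := hσs x
      rcases (hs i j).1 hx with rfl | rfl | rfl <;> simp
    refine Or.inr (Or.inr ⟨σ 2, σ 4, σ 3, σ 5, σ 1, ?_, ?_, Or.inl ?_, Or.inl ?_, Or.inl ?_⟩)
    · rw [h0]
      exact ⟨(hs _ _).2 (by decide), (hs _ _).2 (by decide), (hs _ _).2 (by decide),
        (hs _ _).2 (by decide), (hs _ _).2 (by decide), (hs _ _).2 (by decide),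
        (hs _ _).2 (by decide), (hs _ _).2 (by decide), (hs _ _).2 (by decide),
        far _ _ (by decide) (by decide), far _ _ (by decide) (by decide),
        far _ _ (by decide) (by decide), far _ _ (by decide) (by decide),
        far _ _ (by decide) (by decide), far _ _ (by decide) (by decide)⟩
    · intro x hx
      rw [h0] at hx
      exact only 0 x hx
    · intro x hx
      rw [h0]
      have := only 2 x hx
      change x = σ 4 ∨ x = σ 0 ∨ x = σ 5 at this
      tauto
    · intro x hx
      rw [h0]
      have := only 4 x hx
      change x = σ 0 ∨ x = σ 2 ∨ x = σ 1 at this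
      tauto
    · intro x hx
      rw [h0]
      have := only 3 x hx
      change x = σ 5 ∨ x = σ 1 ∨ x = σ 0 at this
      tauto
  | @glue V G A B hA hB hunion hinter ihA ihB =>
    have hg := glued_of_iso hunion hinter
    have sub : ∀ A B : G.Subgraph, Glued A B → (∀ s, A.coe.AtomAt s) → B.verts ⊆ A.verts →
        ∀ s, G.AtomAt s := by
      intro A B hg ih hBA s
      have hall := hg.adj_of_subset hBA
      exact AtomAt.of_coe hg (ih ⟨s, (hg.cover s).elim id fun h' => hBA h'⟩) (hall s)
        fun v => Or.inl (hall v)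
    intro s
    by_cases hBA : B.verts ⊆ A.verts
    · exact sub A B hg ihA hBA s
    by_cases hAB : A.verts ⊆ B.verts
    · exact sub B A hg.symm ihB hAB s
    have hcut := hg.cliqueCut hAB hBA
    have main : ∀ A B : G.Subgraph, Glued A B → (∀ s, A.coe.AtomAt s) →
        G.CliqueCut (A.verts ∩ B.verts) → s ∉ B.verts → G.AtomAt s := by
      intro A B hg ih hcut hsB
      refine AtomAt.of_coe hg (ih ⟨s, (hg.cover s).resolve_right hsB⟩) (hg.adj_of_notMem hsB) ?_
      intro v
      by_cases hvB : (v : V) ∈ B.verts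
      · exact Or.inr ⟨_, hcut, v.2, hvB⟩
      · exact Or.inl (hg.adj_of_notMem hvB)
    by_cases hsB : s ∈ B.verts
    · by_cases hsA : s ∈ A.verts
      · exact Or.inl ⟨_, hcut, hsA, hsB⟩
      · exact main B A hg.symm ihB (by rwa [Set.inter_comm]) hsA
    · exact main A B hg ihA hcut hsB

end

/-! ### A minimal counterexample contains no piece -/

section
variable {V : Type*} {G : SimpleGraph V}

theorem Far.symm {a b : V} (h : G.Far a b) : G.Far b a :=
  ⟨h.1.symm, fun h' => h.2 h'.symm⟩

theorem IsPrismAt.swap {s t₁ t₂ s' t₁' t₂' : V} (h : G.IsPrismAt s t₁ t₂ s' t₁' t₂') :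
    G.IsPrismAt s t₂ t₁ s' t₂' t₁' :=
  ⟨h.a2, h.a1, h.a3.symm, h.b2, h.b1, h.b3.symm, h.m0, h.m2, h.m1, h.f2, h.f1, h.f4, h.f3, h.f6,
    h.f5⟩

/-- An induced prism that exhausts the graph is the graph. -/
theorem IsPrismAt.nonempty_iso {s t₁ t₂ s' t₁' t₂' : V} (h : G.IsPrismAt s t₁ t₂ s' t₁' t₂')
    (hall : ∀ v, v = s ∨ v = t₁ ∨ v = t₂ ∨ v = s' ∨ v = t₁' ∨ v = t₂') :
    Nonempty (G ≃g (cycleGraph 6)ᶜ) := by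
  obtain ⟨a1, a2, a3, b1, b2, b3, m0, m1, m2, f1, f2, f3, f4, f5, f6⟩ := h
  set σ : Fin 6 → V := ![s, t₂', t₁, s', t₂, t₁'] with hσ
  have hadj : ∀ i j, G.Adj (σ i) (σ j) ↔ (cycleGraph 6)ᶜ.Adj i j := by
    intro i j
    rw [prism_adj]
    fin_cases i <;> fin_cases j <;>
      simp [hσ, a1, a2, a3, b1, b2, b3, m0, m1, m2, a1.symm, a2.symm, a3.symm, b1.symm, b2.symm,
        b3.symm, m0.symm, m1.symm, m2.symm, f1.2, f2.2, f3.2, f4.2, f5.2, f6.2, f1.symm.2,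
        f2.symm.2, f3.symm.2, f4.symm.2, f5.symm.2, f6.symm.2]
  have hinj : Function.Injective σ := by
    intro i j
    fin_cases i <;> fin_cases j <;>
      simp [hσ, a1.ne, a2.ne, a3.ne, b1.ne, b2.ne, b3.ne, m0.ne, m1.ne, m2.ne, a1.ne', a2.ne',
        a3.ne', b1.ne', b2.ne', b3.ne', m0.ne', m1.ne', m2.ne', f1.1, f2.1, f3.1, f4.1, f5.1, f6.1,
        f1.symm.1, f2.symm.1, f3.symm.1, f4.symm.1, f5.symm.1, f6.symm.1]
  have hsurj : Function.Surjective σ := by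
    intro v
    rcases hall v with rfl | rfl | rfl | rfl | rfl | rfl
    · exact ⟨0, rfl⟩
    · exact ⟨2, rfl⟩
    · exact ⟨4, rfl⟩
    · exact ⟨3, rfl⟩
    · exact ⟨5, rfl⟩
    · exact ⟨1, rfl⟩
  exact ⟨RelIso.symm ⟨Equiv.ofBijective σ ⟨hinj, hsurj⟩, fun {i j} => hadj i j⟩⟩

/-- The two sides of a separator of an induced subgraph, as sets of vertices of the whole graph. -/
theorem Separates.exists_sides {R : Set V} {K : Set R} (h : (G.induce R).Separates K) :
    ∃ C D : Set V, C.Nonempty ∧ D.Nonempty ∧ C ⊆ R ∧ D ⊆ R ∧ (∀ v ∈ C, v ∉ D) ∧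
      (∀ v ∈ C, v ∉ (Subtype.val '' K : Set V)) ∧ (∀ v ∈ D, v ∉ (Subtype.val '' K : Set V)) ∧
      (∀ v ∈ R, v ∈ C ∨ v ∈ D ∨ v ∈ (Subtype.val '' K : Set V)) ∧
      ∀ a ∈ C, ∀ b ∈ D, ¬ G.Adj a b := by
  obtain ⟨C, ⟨c, hc⟩, hCK, ⟨q, hqC, hqK⟩, hcl⟩ := h
  have hmem : ∀ {x : R} {T : Set R}, (x : V) ∈ (Subtype.val '' T : Set V) ↔ x ∈ T :=
    fun {x T} => Subtype.val_injective.mem_set_image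
  refine ⟨Subtype.val '' C, Subtype.val '' {x | x ∉ C ∧ x ∉ K}, ⟨c, hmem.2 hc⟩,
    ⟨q, hmem.2 ⟨hqC, hqK⟩⟩, ?_, ?_, ?_, ?_, ?_, ?_, ?_⟩
  · rintro _ ⟨x, -, rfl⟩; exact x.2
  · rintro _ ⟨x, -, rfl⟩; exact x.2
  · rintro _ ⟨x, hx, rfl⟩ h
    exact (hmem.1 h).1 hx
  · rintro _ ⟨x, hx, rfl⟩ h
    exact hCK x hx (hmem.1 h)
  · rintro _ ⟨x, hx, rfl⟩ h
    exact hx.2 (hmem.1 h)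
  · intro v hv
    by_cases h1 : (⟨v, hv⟩ : R) ∈ C
    · exact Or.inl ⟨_, h1, rfl⟩
    by_cases h2 : (⟨v, hv⟩ : R) ∈ K
    · exact Or.inr (Or.inr ⟨_, h2, rfl⟩)
    · exact Or.inr (Or.inl ⟨_, ⟨h1, h2⟩, rfl⟩)
  · rintro _ ⟨a, ha, rfl⟩ _ ⟨b, hb, rfl⟩ hab
    exact (hcl a ha b hab).elim hb.1 hb.2

theorem Piece.symm {y₁ y₂ s u w : V} (h : G.Piece y₁ y₂ s u w) : G.Piece y₂ y₁ s w u :=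
  ⟨h.1.symm, h.2.2, h.2.1⟩

end

namespace Crit

variable {V : Type u} [Fintype V] [DecidableEq V] {G : SimpleGraph V}

theorem piece_facts (hG : G.Crit) {y₁ y₂ s u w : V} (hp : G.Piece y₁ y₂ s u w) :
    G.Adj y₁ y₂ ∧ G.Adj y₁ s ∧ G.Adj y₁ u ∧ G.Adj y₂ s ∧ G.Adj y₂ w ∧ G.Adj u w ∧ G.Far s w ∧
      G.Far s u ∧ y₁ ≠ w ∧ y₂ ≠ u := by
  have aux : ∀ {y₁ y₂ s u w : V}, G.Piece y₁ y₂ s u w → G.Far s w ∧ y₁ ≠ w := by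
    intro y₁ y₂ s u w hp
    obtain ⟨v, hv, hv1, hv2⟩ := hG.exists_adj_ne y₂ y₁ s
    have hvw : v = w := (((hp.2.2 v).1 hv).resolve_left hv1).resolve_left hv2
    subst hvw
    refine ⟨⟨hv2.symm, fun h => hv1 ?_⟩, hv1.symm⟩
    have e1 : G.Adj y₂ s := (hp.2.2 s).2 (by simp)
    have e2 : G.Adj y₂ y₁ := (hp.2.2 y₁).2 (by simp)
    have e3 : G.Adj y₁ s := (hp.2.1 s).2 (by simp)
    exact hG.eq_of_common_of_adj e1 hv h e2 e3.symm
  exact ⟨(hp.2.1 _).2 (by simp), (hp.2.1 _).2 (by simp), (hp.2.1 _).2 (by simp),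
    (hp.2.2 _).2 (by simp), (hp.2.2 _).2 (by simp), hp.1, (aux hp).1, (aux hp.symm).1, (aux hp).2,
    (aux hp.symm).2⟩

/-- `G` without the inner vertices of a piece, with the edge `sw` added. -/
abbrev pieceReduct (G : SimpleGraph V) (y₁ y₂ s w : V) :
    SimpleGraph (((univ.erase y₁).erase y₂ : Finset V) : Set V) :=
  (G ⊔ edge s w).induce _

theorem mem_reduct {y₁ y₂ v : V} : v ∈ (((univ.erase y₁).erase y₂ : Finset V) : Set V) ↔
    v ≠ y₁ ∧ v ≠ y₂ := by
  rw [Finset.mem_coe, Finset.mem_erase, Finset.mem_erase]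
  exact ⟨fun h => ⟨h.2.1, h.1⟩, fun h => ⟨h.2, h.1, Finset.mem_univ _⟩⟩

theorem sup_edge_adj {s w a b : V} :
    (G ⊔ edge s w).Adj a b ↔ G.Adj a b ∨ ((a = s ∧ b = w ∨ a = w ∧ b = s) ∧ a ≠ b) := by
  rw [sup_adj, edge_adj]

/-- Replacing the inner vertices of a piece by the edge `sw` creates no stable cutset. -/
theorem not_hasStableCut_pieceReduct (hG : G.Crit) {y₁ y₂ s u w : V}
    (hp : G.Piece y₁ y₂ s u w) : ¬ (pieceReduct G y₁ y₂ s w).HasStableCut := by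
  rintro ⟨S₀, hS₀, hsep⟩
  obtain ⟨h12, h1s, h1u, h2s, h2w, huw, hsw, hsu, h1w, h2u⟩ := hG.piece_facts hp
  obtain ⟨C, D, hC, hD, hCR, hDR, hCD, hCS, hDS, hcov, hno⟩ := hsep.exists_sides
  set S : Set V := Subtype.val '' S₀ with hS
  have hSR : ∀ v ∈ S, v ≠ y₁ ∧ v ≠ y₂ := by
    rintro _ ⟨x, -, rfl⟩
    exact mem_reduct.1 x.2
  have hSH : ∀ a ∈ S, ∀ b ∈ S, ¬ (G ⊔ edge s w).Adj a b := by
    rintro _ ⟨a, ha, rfl⟩ _ ⟨b, hb, rfl⟩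
    exact hS₀.not_adj ha hb
  have hSs : ∀ a ∈ S, ∀ b ∈ S, ¬ G.Adj a b := fun a ha b hb h =>
    hSH a ha b hb (sup_edge_adj.2 (Or.inl h))
  have hswH : (G ⊔ edge s w).Adj s w := sup_edge_adj.2 (Or.inr ⟨Or.inl ⟨rfl, rfl⟩, hsw.1⟩)
  -- `C` is the side of `s`, or of `w` if `s` belongs to the cutset
  have main : ∀ C D : Set V, D.Nonempty → (∀ v ∈ C, v ≠ y₁ ∧ v ≠ y₂) →
      (∀ v ∈ D, v ≠ y₁ ∧ v ≠ y₂) → (∀ v ∈ C, v ∉ D) → (∀ v ∈ C, v ∉ S) → (∀ v ∈ D, v ∉ S) →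
      (∀ v, v ≠ y₁ → v ≠ y₂ → v ∈ C ∨ v ∈ D ∨ v ∈ S) →
      (∀ a ∈ C, ∀ b ∈ D, ¬ (G ⊔ edge s w).Adj a b) → (s ∈ C ∨ (s ∈ S ∧ w ∈ C)) → False := by
    rintro C D ⟨d, hd⟩ hCR hDR hCD hCS hDS hcov hno hbase
    have hnoG : ∀ a ∈ C, ∀ b ∈ D, ¬ G.Adj a b := fun a ha b hb h =>
      hno a ha b hb (sup_edge_adj.2 (Or.inl h))
    have hwD : w ∉ D := by
      intro hw
      rcases hbase with h | h
      · exact hno s h w hw hswH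
      · exact hCD w h.2 hw
    have hsD : s ∉ D := by
      intro hs
      rcases hbase with h | h
      · exact hCD s h hs
      · exact hDS s hs h.1
    have hwCS : w ∈ C ∨ w ∈ S := (hcov w h1w.symm h2w.ne').imp_right fun h => h.resolve_left hwD
    have hsCS : s ∈ C ∨ s ∈ S := hbase.imp_right And.left
    by_cases huD : u ∈ D
    · have hwS : w ∈ S := hwCS.resolve_left fun h => hnoG w h u huD huw.symm
      have hsC : s ∈ C := hsCS.resolve_right fun h => hSH s h w hwS hswH
      refine hG.not_cut ⟨insert y₁ S, isIndepSet_of_forall ?_, insert y₂ C, ⟨y₂, by simp⟩, ?_,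
        ⟨d, ?_, ?_⟩, ?_⟩
      · have hy : ∀ a ∈ S, ¬ G.Adj y₁ a := by
          intro a ha h
          rcases (hp.2.1 a).1 h with rfl | rfl | rfl
          · exact (hSR _ ha).2 rfl
          · exact hCS _ hsC ha
          · exact hDS _ huD ha
        rintro a (rfl | ha) b (rfl | hb) hab
        · exact hab.ne rfl
        · exact hy b hb hab
        · exact hy a ha hab.symm
        · exact hSs a ha b hb hab
      · rintro a (rfl | ha) (rfl | h)
        · exact h12.ne rfl
        · exact (hSR _ h).2 rfl
        · exact (hCR _ ha).1 rfl
        · exact hCS a ha h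
      · rintro (rfl | h)
        · exact (hDR _ hd).2 rfl
        · exact hCD d h hd
      · rintro (rfl | h)
        · exact (hDR _ hd).1 rfl
        · exact hDS d hd h
      · rintro a (rfl | ha) b hab
        · rcases (hp.2.2 b).1 hab with rfl | rfl | rfl
          · exact Or.inr (Or.inl rfl)
          · exact Or.inl (Or.inr hsC)
          · exact Or.inr (Or.inr hwS)
        · by_cases h1 : b = y₁
          · exact Or.inr (Or.inl h1)
          by_cases h2 : b = y₂
          · exact Or.inl (Or.inl h2)
          rcases hcov b h1 h2 with h | h | h
          · exact Or.inl (Or.inr h)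
          · exact absurd hab (hnoG a ha b h)
          · exact Or.inr (Or.inr h)
    · have huCS : u ∈ C ∨ u ∈ S := (hcov u h1u.ne' h2u.symm).imp_right fun h => h.resolve_left huD
      have up : ∀ {b}, b ∈ C ∨ b ∈ S → (b = y₁ ∨ b = y₂ ∨ b ∈ C) ∨ b ∈ S := fun h =>
        h.imp_left fun h => Or.inr (Or.inr h)
      refine hG.not_cut ⟨S, isIndepSet_of_forall hSs, insert y₁ (insert y₂ C), ⟨y₁, by simp⟩, ?_,
        ⟨d, ?_, hDS d hd⟩, ?_⟩
      · rintro a (rfl | rfl | ha) h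
        · exact (hSR _ h).1 rfl
        · exact (hSR _ h).2 rfl
        · exact hCS a ha h
      · rintro (rfl | rfl | h)
        · exact (hDR _ hd).1 rfl
        · exact (hDR _ hd).2 rfl
        · exact hCD d h hd
      · simp only [Set.mem_insert_iff]
        rintro a (rfl | rfl | ha) b hab
        · rcases (hp.2.1 b).1 hab with rfl | rfl | rfl
          · exact Or.inl (Or.inr (Or.inl rfl))
          · exact up hsCS
          · exact up huCS
        · rcases (hp.2.2 b).1 hab with rfl | rfl | rfl
          · exact Or.inl (Or.inl rfl)
          · exact up hsCS
          · exact up hwCS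
        · by_cases h1 : b = y₁
          · exact Or.inl (Or.inl h1)
          by_cases h2 : b = y₂
          · exact Or.inl (Or.inr (Or.inl h2))
          rcases hcov b h1 h2 with h | h | h
          · exact up (Or.inl h)
          · exact absurd hab (hnoG a ha b h)
          · exact Or.inr h
  have hCR' : ∀ v ∈ C, v ≠ y₁ ∧ v ≠ y₂ := fun v hv => mem_reduct.1 (hCR hv)
  have hDR' : ∀ v ∈ D, v ≠ y₁ ∧ v ≠ y₂ := fun v hv => mem_reduct.1 (hDR hv)
  have hcov' : ∀ v, v ≠ y₁ → v ≠ y₂ → v ∈ C ∨ v ∈ D ∨ v ∈ S := fun v h1 h2 =>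
    hcov v (mem_reduct.2 ⟨h1, h2⟩)
  have m1 := main C D hD hCR' hDR' hCD hCS hDS hcov' hno
  have m2 := main D C hC hDR' hCR' (fun v h h' => hCD v h' h) hDS hCS
    (fun v h1 h2 => or_left_comm.1 (hcov' v h1 h2)) (fun a ha b hb h => hno b hb a ha h.symm)
  have hsplit := hcov' s h1s.ne' h2s.ne'
  have hwplit := hcov' w h1w.symm h2w.ne'
  rcases hsplit with h | h | h
  · exact m1 (Or.inl h)
  · exact m2 (Or.inl h)
  · rcases hwplit with h' | h' | h'
    · exact m1 (Or.inr ⟨h, h'⟩)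
    · exact m2 (Or.inr ⟨h, h'⟩)
    · exact hSH s h w h' hswH

theorem pieceReduct_inGsc (hG : G.Crit) {y₁ y₂ s u w : V} (hp : G.Piece y₁ y₂ s u w) :
    InGsc (pieceReduct G y₁ y₂ s w) := by
  classical
  obtain ⟨h12, h1s, h1u, h2s, h2w, huw, hsw, hsu, h1w, h2u⟩ := hG.piece_facts hp
  set R : Finset V := (univ.erase y₁).erase y₂ with hR
  have h2 : y₂ ∉ R := Finset.notMem_erase _ _
  have e0 : insert y₂ R = univ.erase y₁ := Finset.insert_erase (by simpa using h12.ne')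
  have h1 : y₁ ∉ insert y₂ R := by rw [e0]; exact Finset.notMem_erase _ _
  have hu : insert y₁ (insert y₂ R) = univ := by
    rw [e0]; exact Finset.insert_erase (Finset.mem_univ _)
  have mR : ∀ v, v ∈ R ↔ v ≠ y₁ ∧ v ≠ y₂ := fun v => by simp [hR, and_comm]
  have c1 := Finset.card_insert_of_notMem h2
  have c2 := Finset.card_insert_of_notMem h1
  rw [hu, Finset.card_univ] at c2
  have c3 : 3 ≤ R.card := by
    rw [← Finset.card_eq_three.2 ⟨s, u, w, hsu.1, hsw.1, huw.ne, rfl⟩]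
    refine Finset.card_le_card fun v hv => ?_
    simp only [Finset.mem_insert, Finset.mem_singleton] at hv
    rw [mR]
    rcases hv with rfl | rfl | rfl
    · exact ⟨h1s.ne', h2s.ne'⟩
    · exact ⟨h1u.ne', h2u.symm⟩
    · exact ⟨h1w.symm, h2w.ne'⟩
  have e1 := ec_insert_self G h1
  have e2 := ec_insert_self G h2
  rw [hu] at e1
  have e3 : 3 ≤ G.ec {y₁} (insert y₂ R) := by
    rw [← Finset.card_eq_three.2 ⟨y₂, s, u, h2s.ne, h2u, hsu.1, rfl⟩]
    refine card_le_ec_singleton G (fun v hv => ?_) (fun v hv => ?_)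
    · simp only [Finset.mem_insert, Finset.mem_singleton] at hv
      rw [Finset.mem_insert, mR]
      rcases hv with rfl | rfl | rfl
      · exact Or.inl rfl
      · exact Or.inr ⟨h1s.ne', h2s.ne'⟩
      · exact Or.inr ⟨h1u.ne', h2u.symm⟩
    · simp only [Finset.mem_insert, Finset.mem_singleton] at hv
      exact (hp.2.1 v).2 hv
  have e4 : 2 ≤ G.ec {y₂} R := by
    rw [← Finset.card_pair hsw.1]
    refine card_le_ec_singleton G (fun v hv => ?_) (fun v hv => ?_)
    · simp only [Finset.mem_insert, Finset.mem_singleton] at hv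
      rw [mR]
      rcases hv with rfl | rfl
      · exact ⟨h1s.ne', h2s.ne'⟩
      · exact ⟨h1w.symm, h2w.ne'⟩
    · simp only [Finset.mem_insert, Finset.mem_singleton] at hv
      exact (hp.2.2 v).2 (Or.inr hv)
  have e5 : (G ⊔ edge s w).ec R R ≤ G.ec R R + (edge s w).ec R R := by
    unfold ec
    rw [← Finset.sum_add_distrib]
    refine Finset.sum_le_sum fun a _ => ?_
    rw [← Finset.sum_add_distrib]
    refine Finset.sum_le_sum fun b _ => ?_
    by_cases ha : G.Adj a b <;> by_cases hb : (edge s w).Adj a b <;> simp [ha, hb]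
  have e6 : (edge s w).ec R R ≤ 2 := by
    have h : (edge s w).ec R R ≤ (edge s w).ec univ univ :=
      (Finset.sum_le_sum_of_subset (Finset.subset_univ R)).trans
        (Finset.sum_le_sum fun a _ => Finset.sum_le_sum_of_subset (Finset.subset_univ R)) |>.trans'
        (le_refl _)
    rw [ec_univ, edgeSet_edge_of_ne hsw.1, Set.ncard_singleton] at h
    exact h
  have hcard : Fintype.card ((R : Finset V) : Set V) = R.card := by simp
  have := hG.edges
  refine hG.min _ _ (by rw [hcard]; omega) (by rw [hcard]; omega)
    (hG.not_hasStableCut_pieceReduct hp) ?_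
  rw [ec_induce, hcard, ← hR]
  omega

/-- Clique cutsets of the reduct contain `w` and not `s`: otherwise they lead to a cutset of `G`
that is a clique, or the path `s x w`, or the stable set `{s, w}`. -/
theorem cliqueCut_pieceReduct (hG : G.Crit) {y₁ y₂ s u w : V} (hp : G.Piece y₁ y₂ s u w)
    {K₀ : Set (((univ.erase y₁).erase y₂ : Finset V) : Set V)}
    (hK₀ : (pieceReduct G y₁ y₂ s w).CliqueCut K₀) :
    w ∈ (Subtype.val '' K₀ : Set V) ∧ s ∉ (Subtype.val '' K₀ : Set V) := by
  classical
  obtain ⟨h12, h1s, h1u, h2s, h2w, huw, hsw, hsu, h1w, h2u⟩ := hG.piece_facts hp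
  obtain ⟨hcl, hcard, hsep⟩ := hK₀
  obtain ⟨C, D, hC, hD, hCR, hDR, hCD, hCS, hDS, hcov, hno⟩ := hsep.exists_sides
  rw [← Set.ncard_image_of_injective _ Subtype.val_injective] at hcard
  set K : Set V := Subtype.val '' K₀ with hK
  have hKR : ∀ v ∈ K, v ≠ y₁ ∧ v ≠ y₂ := by
    rintro _ ⟨x, -, rfl⟩
    exact mem_reduct.1 x.2
  have hKH : ∀ a ∈ K, ∀ b ∈ K, a ≠ b → (G ⊔ edge s w).Adj a b := by
    rintro _ ⟨a, ha, rfl⟩ _ ⟨b, hb, rfl⟩ hab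
    exact hcl a ha b hb fun h => hab (congrArg _ h)
  have hKG : ∀ a ∈ K, ∀ b ∈ K, a ≠ b → ¬ (a = s ∧ b = w) → ¬ (a = w ∧ b = s) → G.Adj a b := by
    intro a ha b hb hab h1 h2
    exact (sup_edge_adj.1 (hKH a ha b hb hab)).resolve_right fun h => h.1.elim h1 h2
  have hswH : (G ⊔ edge s w).Adj s w := sup_edge_adj.2 (Or.inr ⟨Or.inl ⟨rfl, rfl⟩, hsw.1⟩)
  have huwH : (G ⊔ edge s w).Adj u w := sup_edge_adj.2 (Or.inl huw)
  have lift : ∀ C D : Set V, D.Nonempty → (∀ v ∈ C, v ≠ y₁ ∧ v ≠ y₂) →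
      (∀ v ∈ D, v ≠ y₁ ∧ v ≠ y₂) → (∀ v ∈ C, v ∉ D) → (∀ v ∈ C, v ∉ K) → (∀ v ∈ D, v ∉ K) →
      (∀ v, v ≠ y₁ → v ≠ y₂ → v ∈ C ∨ v ∈ D ∨ v ∈ K) →
      (∀ a ∈ C, ∀ b ∈ D, ¬ (G ⊔ edge s w).Adj a b) → s ∉ D → u ∉ D → w ∉ D → G.Separates K := by
    rintro C D ⟨d, hd⟩ hCR hDR hCD hCS hDS hcov hno hsD huD hwD
    have c1 := (hcov s h1s.ne' h2s.ne').imp_right fun h => h.resolve_left hsD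
    have c2 := (hcov u h1u.ne' h2u.symm).imp_right fun h => h.resolve_left huD
    have c3 := (hcov w h1w.symm h2w.ne').imp_right fun h => h.resolve_left hwD
    have up : ∀ {b}, b ∈ C ∨ b ∈ K → (b = y₁ ∨ b = y₂ ∨ b ∈ C) ∨ b ∈ K := fun h =>
      h.imp_left fun h => Or.inr (Or.inr h)
    refine ⟨insert y₁ (insert y₂ C), ⟨y₁, by simp⟩, ?_, ⟨d, ?_, hDS d hd⟩, ?_⟩
    · rintro a (rfl | rfl | ha) h
      · exact (hKR _ h).1 rfl
      · exact (hKR _ h).2 rfl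
      · exact hCS a ha h
    · rintro (rfl | rfl | h)
      · exact (hDR _ hd).1 rfl
      · exact (hDR _ hd).2 rfl
      · exact hCD d h hd
    · simp only [Set.mem_insert_iff]
      rintro a (rfl | rfl | ha) b hab
      · rcases (hp.2.1 b).1 hab with rfl | rfl | rfl
        · exact Or.inl (Or.inr (Or.inl rfl))
        · exact up c1
        · exact up c2
      · rcases (hp.2.2 b).1 hab with rfl | rfl | rfl
        · exact Or.inl (Or.inl rfl)
        · exact up c1
        · exact up c3
      · by_cases h1 : b = y₁
        · exact Or.inl (Or.inl h1)
        by_cases h2 : b = y₂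
        · exact Or.inl (Or.inr (Or.inl h2))
        rcases hcov b h1 h2 with h | h | h
        · exact up (Or.inl h)
        · exact absurd (sup_edge_adj.2 (Or.inl hab)) (hno a ha b h)
        · exact Or.inr h
  have hCR' : ∀ v ∈ C, v ≠ y₁ ∧ v ≠ y₂ := fun v hv => mem_reduct.1 (hCR hv)
  have hDR' : ∀ v ∈ D, v ≠ y₁ ∧ v ≠ y₂ := fun v hv => mem_reduct.1 (hDR hv)
  have hcov' : ∀ v, v ≠ y₁ → v ≠ y₂ → v ∈ C ∨ v ∈ D ∨ v ∈ K := fun v h1 h2 =>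
    hcov v (mem_reduct.2 ⟨h1, h2⟩)
  have l1 := lift C D hD hCR' hDR' hCD hCS hDS hcov' hno
  have l2 := lift D C hC hDR' hCR' (fun v h h' => hCD v h' h) hDS hCS
    (fun v h1 h2 => or_left_comm.1 (hcov' v h1 h2)) (fun a ha b hb h => hno b hb a ha h.symm)
  have hKfin : K.Finite := Set.toFinite K
  by_cases hw : w ∈ K
  · refine ⟨hw, fun hs => ?_⟩
    have huK : u ∉ K := fun hu => by
      refine hsu.2 (hKG s hs u hu hsu.1 ?_ ?_)
      · exact fun h => huw.ne h.2
      · exact fun h => hsw.1 h.1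
    have hsepG : G.Separates K := by
      rcases hcov' u h1u.ne' h2u.symm with h | h | h
      · exact l1 (fun h' => hDS s h' hs) (hCD u h) (fun h' => hDS w h' hw)
      · exact l2 (fun h' => hCS s h' hs) (fun h' => hCD u h' h) (fun h' => hCS w h' hw)
      · exact absurd h huK
    have hsub : {s, w} ⊆ K := by
      rintro v (rfl | rfl)
      · exact hs
      · exact hw
    rcases hcard with hc | hc
    · have : ({s, w} : Set V) = K := Set.eq_of_subset_of_ncard_le hsub
        (by rw [hc, Set.ncard_pair hsw.1]) hKfin
      exact hG.not_separates_pair s w (this ▸ hsepG)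
    · obtain ⟨x, hxK, hx⟩ : ∃ x ∈ K, x ∉ ({s, w} : Set V) := by
        by_contra hno'
        push Not at hno'
        have := Set.ncard_le_ncard (s := K) (t := {s, w}) hno' (Set.toFinite _)
        rw [hc, Set.ncard_pair hsw.1] at this
        omega
      have hxs : x ≠ s := fun h => hx (by simp [h])
      have hxw : x ≠ w := fun h => hx (by simp [h])
      have : ({s, x, w} : Set V) = K := by
        refine Set.eq_of_subset_of_ncard_le ?_ ?_ hKfin
        · rintro v (rfl | rfl | rfl)
          · exact hs
          · exact hxK
          · exact hw
        · rw [hc, Set.ncard_eq_three.2 ⟨s, x, w, hxs.symm, hsw.1, hxw, rfl⟩]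
      exact hG.not_separates_path (hKG s hs x hxK hxs.symm (fun h => hxw h.2) fun h => hsw.1 h.1)
        (hKG x hxK w hw hxw (fun h => hxs h.1) fun h => hxw h.1) hsw.1 hsw.2 (this ▸ hsepG)
  · exfalso
    have hsepG : G.Separates K := by
      rcases hcov' w h1w.symm h2w.ne' with h | h | h
      · exact l1 (fun h' => hno w h s h' hswH.symm) (fun h' => hno w h u h' huwH.symm) (hCD w h)
      · exact l2 (fun h' => hno s h' w h hswH) (fun h' => hno u h' w h huwH) (fun h' => hCD w h' h)
      · exact absurd h hw
    have hcoe : (hKfin.toFinset : Set V) = K := by simp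
    refine hG.not_separates_of_clique (K := hKfin.toFinset) ?_ ?_ (hcoe.symm ▸ hsepG)
    · intro a ha b hb hab
      rw [Set.Finite.mem_toFinset] at ha hb
      exact hKG a ha b hb hab (fun h => hw (h.2 ▸ hb)) fun h => hw (h.1 ▸ ha)
    · rwa [← Set.ncard_eq_toFinset_card K hKfin]

end Crit

/-- The neighbourhood of `s` apart from `y₁` and `y₂` is a vertex `x`, adjacent to `w`. -/
def OutcomeOne {V : Type*} (G : SimpleGraph V) (y₁ y₂ s w x : V) : Prop :=
  G.Adj s x ∧ G.Adj w x ∧ x ≠ y₁ ∧ x ≠ y₂ ∧ ∀ v, G.Adj s v → v = y₁ ∨ v = y₂ ∨ v = x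

/-- The neighbourhood of `s` apart from `y₁` and `y₂` consists of `x` and `r`. -/
def TwoNbrs {V : Type*} (G : SimpleGraph V) (y₁ y₂ s x r : V) : Prop :=
  G.Adj s x ∧ G.Adj s r ∧ x ≠ y₁ ∧ x ≠ y₂ ∧ r ≠ y₁ ∧ r ≠ y₂ ∧ x ≠ r ∧
    ∀ v, G.Adj s v → v = y₁ ∨ v = y₂ ∨ v = x ∨ v = r

/-- What remains in `G` of the prism with triangles `s x r` and `w x' r'` of the reduct with the edge
`s w`, when this edge joins the two triangles. -/
def OutcomeFar {V : Type*} (G : SimpleGraph V) (s w x r x' r' : V) : Prop :=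
  G.Adj x r ∧ G.Adj x x' ∧ G.Adj r r' ∧ G.Adj x' r' ∧ G.Adj w x' ∧ G.Adj w r' ∧ x' ≠ s ∧ r' ≠ s ∧
    x' ≠ r ∧ r' ≠ x ∧ (∀ v, G.Adj x v → v = s ∨ v = r ∨ v = x') ∧
    ∀ v, G.Adj r v → v = s ∨ v = x ∨ v = r'

/-- What remains in `G` of the prism with triangles `s w x` and `r w' x'` of the reduct with the edge
`s w`, when this edge lies in one of the triangles. -/
def OutcomeNear {V : Type*} (G : SimpleGraph V) (s w x r w' x' : V) : Prop :=
  G.Adj w x ∧ G.Adj r w' ∧ G.Adj r x' ∧ G.Adj w' x' ∧ G.Adj w w' ∧ G.Adj x x' ∧ w' ≠ s ∧ x' ≠ s ∧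
    G.Far x r ∧ G.Far w x' ∧ G.Far x w' ∧ ∀ v, G.Adj r v → v = s ∨ v = w' ∨ v = x'

namespace Crit

variable {V : Type u} [Fintype V] [DecidableEq V] {G : SimpleGraph V}

/-- The structure of the class at `s`, applied to the reduct and translated to `G`. -/
theorem piece_outcome (hG : G.Crit) {y₁ y₂ s u w : V} (hp : G.Piece y₁ y₂ s u w) :
    (∃ x, G.OutcomeOne y₁ y₂ s w x) ∨
      (∃ x r x' r', G.TwoNbrs y₁ y₂ s x r ∧ G.OutcomeFar s w x r x' r') ∨
      ∃ x r w' x', G.TwoNbrs y₁ y₂ s x r ∧ G.OutcomeNear s w x r w' x' := by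
  obtain ⟨h12, h1s, h1u, h2s, h2w, huw, hsw, hsu, h1w, h2u⟩ := hG.piece_facts hp
  set R : Set V := (((univ.erase y₁).erase y₂ : Finset V) : Set V) with hR
  have mR : ∀ v, v ∈ R ↔ v ≠ y₁ ∧ v ≠ y₂ := fun v => mem_reduct
  have hs : s ∈ R := (mR s).2 ⟨h1s.ne', h2s.ne'⟩
  have hw : w ∈ R := (mR w).2 ⟨h1w.symm, h2w.ne'⟩
  set H := pieceReduct G y₁ y₂ s w with hH
  have hadj : ∀ a b : R, H.Adj a b ↔
      G.Adj a b ∨ (((a : V) = s ∧ (b : V) = w ∨ (a : V) = w ∧ (b : V) = s) ∧ (a : V) ≠ b) :=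
    fun a b => sup_edge_adj
  have down : ∀ a b : R, H.Adj a b → (a : V) ≠ s → (b : V) ≠ s → G.Adj a b := by
    intro a b h ha hb
    rcases (hadj a b).1 h with h | ⟨⟨h, -⟩ | ⟨-, h⟩, -⟩
    · exact h
    · exact absurd h ha
    · exact absurd h hb
  have downs : ∀ b : R, H.Adj ⟨s, hs⟩ b → (b : V) ≠ w → G.Adj s b := by
    intro b h hb
    rcases (hadj ⟨s, hs⟩ b).1 h with h | ⟨⟨-, h⟩ | ⟨h, -⟩, -⟩
    · exact h
    · exact absurd h hb
    · exact absurd h hsw.1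
  have upadj : ∀ a b : R, G.Adj a b → H.Adj a b := fun a b h => (hadj a b).2 (Or.inl h)
  have far : ∀ {a b : R}, H.Far a b → G.Far (a : V) b := fun {a b} h =>
    ⟨fun h' => h.1 (Subtype.ext h'), fun h' => h.2 (upadj a b h')⟩
  have hsw' : H.Adj ⟨s, hs⟩ ⟨w, hw⟩ := (hadj _ _).2 (Or.inr ⟨Or.inl ⟨rfl, rfl⟩, hsw.1⟩)
  have ne : ∀ {a b : R}, a ≠ b → (a : V) ≠ b := fun h h' => h (Subtype.ext h')
  have hnw : ∀ v, G.Adj s v → v ≠ w := fun v hv h => hsw.2 (h ▸ hv)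
  -- further neighbours of `s` are not adjacent to `y₁` or `y₂`
  have away : ∀ x v, G.Adj s x → x ≠ y₁ → x ≠ y₂ → G.Adj x v → v ∈ R := by
    intro x v hsx hx1 hx2 hxv
    refine (mR v).2 ⟨?_, ?_⟩
    · rintro rfl
      rcases (hp.2.1 x).1 hxv.symm with h | h | h
      · exact hx2 h
      · exact hsx.ne' h
      · exact hsu.2 (h ▸ hsx)
    · rintro rfl
      rcases (hp.2.2 x).1 hxv.symm with h | h | h
      · exact hx1 h
      · exact hsx.ne' h
      · exact hsw.2 (h ▸ hsx)
  -- a vertex far from `w` is in no clique cutset of the reduct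
  have nocut : ∀ {v a b c : R}, H.Far v ⟨w, hw⟩ → H.OnlyOrCut v a b c →
      ∀ x, H.Adj v x → x = a ∨ x = b ∨ x = c := by
    intro v a b c hv h
    rcases h with h | ⟨K, hK, hvK⟩
    · exact h
    · exfalso
      obtain ⟨⟨x, hx, hxw⟩, -⟩ := hG.cliqueCut_pieceReduct hp hK
      have hxw' : x = ⟨w, hw⟩ := Subtype.ext hxw
      subst hxw'
      exact hv.2 (hK.1 v hvK _ hx hv.1)
  have only : ∀ {x a b c : R}, G.Adj s x → (∀ y, H.Adj x y → y = a ∨ y = b ∨ y = c) →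
      ∀ v, G.Adj x v → v = (a : V) ∨ v = b ∨ v = c := by
    intro x a b c hsx h v hv
    have hvR := away x v hsx ((mR x).1 x.2).1 ((mR x).1 x.2).2 hv
    exact (h ⟨v, hvR⟩ (upadj x ⟨v, hvR⟩ hv)).imp (congrArg Subtype.val)
      (Or.imp (congrArg Subtype.val) (congrArg Subtype.val))
  have hsn : ∀ {a b c : R}, (∀ y, H.Adj ⟨s, hs⟩ y → y = a ∨ y = b ∨ y = c) →
      ∀ v, G.Adj s v → v = y₁ ∨ v = y₂ ∨ v = (a : V) ∨ v = b ∨ v = c := by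
    intro a b c h v hv
    by_cases h1 : v = y₁
    · exact Or.inl h1
    by_cases h2 : v = y₂
    · exact Or.inr (Or.inl h2)
    exact Or.inr (Or.inr ((h ⟨v, (mR v).2 ⟨h1, h2⟩⟩ (upadj _ _ hv)).imp (congrArg Subtype.val)
      (Or.imp (congrArg Subtype.val) (congrArg Subtype.val))))
  rcases atomAt_of_inGsc (hG.pieceReduct_inGsc hp) ⟨s, hs⟩ with
    ⟨K, hK, hsK⟩ | ⟨p, q, hpq, hl⟩ | ⟨t₁, t₂, s', t₁', t₂', hpr, hn, o1, o2, o3⟩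
  · exact absurd ⟨_, hsK, rfl⟩ (hG.cliqueCut_pieceReduct hp hK).2
  · left
    have main : ∀ q : R, H.Adj ⟨w, hw⟩ q → (∀ v, H.Adj ⟨s, hs⟩ v ↔ v = ⟨w, hw⟩ ∨ v = q) →
        ∃ x, G.OutcomeOne y₁ y₂ s w x := by
      intro q hwq h
      have hsq := (h q).2 (Or.inr rfl)
      have hqw : (q : V) ≠ w := ne hwq.ne'
      have hqs : (q : V) ≠ s := ne hsq.ne'
      refine ⟨q, downs q hsq hqw, down _ q hwq hsw.1.symm hqs, ((mR q).1 q.2).1, ((mR q).1 q.2).2,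
        fun v hv => ?_⟩
      rcases hsn (a := ⟨w, hw⟩) (b := ⟨w, hw⟩) (c := q) (fun y hy => Or.inr ((h y).1 hy)) v hv with
        h' | h' | h' | h' | h'
      · exact Or.inl h'
      · exact Or.inr (Or.inl h')
      · exact absurd h' (hnw v hv)
      · exact absurd h' (hnw v hv)
      · exact Or.inr (Or.inr h')
    rcases (hl ⟨w, hw⟩).1 hsw' with h | h
    · subst h
      exact main q hpq hl
    · subst h
      exact main p hpq.symm fun v => by rw [hl v, or_comm]
  · right
    have near : ∀ t₁ t₂ s' t₁' t₂' : R, H.IsPrismAt ⟨s, hs⟩ t₁ t₂ s' t₁' t₂' →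
        (∀ x, H.Adj ⟨s, hs⟩ x → x = t₁ ∨ x = t₂ ∨ x = s') →
        H.OnlyOrCut s' ⟨s, hs⟩ t₁' t₂' → t₁ = ⟨w, hw⟩ →
        ∃ x r w' x', G.TwoNbrs y₁ y₂ s x r ∧ G.OutcomeNear s w x r w' x' := by
      rintro t₁ t₂ s' t₁' t₂' hpr hn o3 rfl
      have e2 := downs t₂ hpr.a2 (ne hpr.a3.ne')
      have e3 := downs s' hpr.m0 (ne hpr.f3.1.symm)
      have n2 : (t₂ : V) ≠ s := ne hpr.a2.ne'
      have n3 : (s' : V) ≠ s := ne hpr.m0.ne'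
      have n4 : (t₁' : V) ≠ s := ne hpr.f1.1.symm
      have n5 : (t₂' : V) ≠ s := ne hpr.f2.1.symm
      refine ⟨t₂, s', t₁', t₂', ⟨e2, e3, ((mR t₂).1 t₂.2).1, ((mR t₂).1 t₂.2).2,
        ((mR s').1 s'.2).1, ((mR s').1 s'.2).2, ne hpr.f4.1, fun v hv => ?_⟩,
        down _ _ hpr.a3 hsw.1.symm n2, down _ _ hpr.b1 n3 n4, down _ _ hpr.b2 n3 n5,
        down _ _ hpr.b3 n4 n5, down _ _ hpr.m1 hsw.1.symm n4, down _ _ hpr.m2 n2 n5, n4, n5,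
        far hpr.f4, far hpr.f5, far hpr.f6, only e3 (nocut hpr.f3.symm o3)⟩
      rcases hsn hn v hv with h | h | h | h | h
      · exact Or.inl h
      · exact Or.inr (Or.inl h)
      · exact absurd h (hnw v hv)
      · exact Or.inr (Or.inr (Or.inl h))
      · exact Or.inr (Or.inr (Or.inr h))
    rcases hn ⟨w, hw⟩ hsw' with h | h | h
    · exact Or.inr (near _ _ _ _ _ hpr hn o3 h.symm)
    · refine Or.inr (near _ _ _ _ _ hpr.swap (fun x hx => or_left_comm.1 (hn x hx)) ?_ h.symm)
      rcases o3 with o3 | o3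
      · exact Or.inl fun x hx => (o3 x hx).imp_right Or.symm
      · exact Or.inr o3
    · left
      subst h
      have e1 := downs t₁ hpr.a1 (ne hpr.f3.1)
      have e2 := downs t₂ hpr.a2 (ne hpr.f4.1)
      have n1 : (t₁ : V) ≠ s := ne hpr.a1.ne'
      have n2 : (t₂ : V) ≠ s := ne hpr.a2.ne'
      have n4 : (t₁' : V) ≠ s := ne hpr.f1.1.symm
      have n5 : (t₂' : V) ≠ s := ne hpr.f2.1.symm
      refine ⟨t₁, t₂, t₁', t₂', ⟨e1, e2, ((mR t₁).1 t₁.2).1, ((mR t₁).1 t₁.2).2,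
        ((mR t₂).1 t₂.2).1, ((mR t₂).1 t₂.2).2, ne hpr.a3.ne, fun v hv => ?_⟩,
        down _ _ hpr.a3 n1 n2, down _ _ hpr.m1 n1 n4, down _ _ hpr.m2 n2 n5, down _ _ hpr.b3 n4 n5,
        down _ _ hpr.b1 hsw.1.symm n4, down _ _ hpr.b2 hsw.1.symm n5, n4, n5, ne hpr.f6.1.symm,
        ne hpr.f5.1.symm, only e1 (nocut hpr.f3 o1), only e2 (nocut hpr.f4 o2)⟩
      rcases hsn hn v hv with h | h | h | h | h
      · exact Or.inl h
      · exact Or.inr (Or.inl h)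
      · exact Or.inr (Or.inr (Or.inl h))
      · exact Or.inr (Or.inr (Or.inr h))
      · exact absurd h (hnw v hv)

theorem eq_or_swap_of_twoNbrs {y₁ y₂ s x r x₂ r₂ : V} (h : G.TwoNbrs y₁ y₂ s x r)
    (h' : G.TwoNbrs y₂ y₁ s x₂ r₂) : (x₂ = x ∧ r₂ = r) ∨ (x₂ = r ∧ r₂ = x) := by
  obtain ⟨-, -, -, -, -, -, hne, hn⟩ := h
  obtain ⟨hx, hr, hx2, hx1, hr2, hr1, hne', -⟩ := h'
  have a := ((hn x₂ hx).resolve_left hx1).resolve_left hx2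
  have b := ((hn r₂ hr).resolve_left hr1).resolve_left hr2
  rcases a with a | a <;> rcases b with b | b
  · exact absurd (a.trans b.symm) hne'
  · exact Or.inl ⟨a, b⟩
  · exact Or.inr ⟨a, b⟩
  · exact absurd (a.trans b.symm) hne'

theorem not_outcomeOne_of_twoNbrs {y₁ y₂ s w x x₂ r₂ : V} (h : G.OutcomeOne y₁ y₂ s w x)
    (h' : G.TwoNbrs y₂ y₁ s x₂ r₂) : False := by
  obtain ⟨hx, hr, hx2, hx1, hr2, hr1, hne', -⟩ := h'
  have a := ((h.2.2.2.2 x₂ hx).resolve_left hx1).resolve_left hx2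
  have b := ((h.2.2.2.2 r₂ hr).resolve_left hr1).resolve_left hr2
  exact hne' (a.trans b.symm)

/-- A minimal counterexample contains no piece: the reductions to `w` and to `u` restrict the
neighbourhood of `s` in incompatible ways, unless the piece is part of a prism. -/
theorem not_piece (hG : G.Crit) {y₁ y₂ s u w : V} (hp : G.Piece y₁ y₂ s u w) : False := by
  obtain ⟨h12, h1s, h1u, h2s, h2w, huw, hsw, hsu, h1w, h2u⟩ := hG.piece_facts hp
  rcases hG.piece_outcome hp with ⟨x, h⟩ | ⟨x, r, x', r', ht, h⟩ | ⟨x, r, w', x', ht, h⟩ <;>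
    rcases hG.piece_outcome hp.symm with ⟨x₂, k⟩ | ⟨x₂, r₂, x₂', r₂', kt, k⟩ |
      ⟨x₂, r₂, u', x₂', kt, k⟩
  · obtain ⟨hsx, hwx, hx1, hx2, hn⟩ := h
    obtain ⟨hsx₂, hux, hx12, hx22, -⟩ := k
    obtain rfl : x₂ = x := ((hn x₂ hsx₂).resolve_left hx22).resolve_left hx12
    have hpr : G.IsPrismAt s y₁ y₂ x₂ u w := by
      have f : ∀ {v}, v ≠ y₂ → v ≠ s → v ≠ u → ¬ G.Adj y₁ v := fun h1 h2 h3 h => by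
        rcases (hp.2.1 _).1 h with h | h | h
        · exact h1 h
        · exact h2 h
        · exact h3 h
      have f' : ∀ {v}, v ≠ y₁ → v ≠ s → v ≠ w → ¬ G.Adj y₂ v := fun h1 h2 h3 h => by
        rcases (hp.2.2 _).1 h with h | h | h
        · exact h1 h
        · exact h2 h
        · exact h3 h
      exact ⟨h1s.symm, h2s.symm, h12, hux.symm, hwx.symm, huw, hsx, h1u, h2w, hsu, hsw,
        ⟨hx1.symm, f hx2 hsx.ne' hux.ne'⟩, ⟨hx2.symm, f' hx1 hsx.ne' hwx.ne'⟩,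
        ⟨h1w, f h2w.ne' hsw.1.symm huw.ne'⟩, ⟨h2u, f' h1u.ne' hsu.1.symm huw.ne⟩⟩
    by_cases hall : ∀ v, v = s ∨ v = y₁ ∨ v = y₂ ∨ v = x₂ ∨ v = u ∨ v = w
    · exact hG.not_gsc (InGsc.prism (hpr.nonempty_iso hall))
    · push Not at hall
      obtain ⟨v, v1, v2, v3, v4, v5, v6⟩ := hall
      refine hG.not_separates_of_clique (K := {u, w, x₂}) ?_ (Or.inr (Finset.card_eq_three.2
        ⟨u, w, x₂, huw.ne, hux.ne, hwx.ne, rfl⟩)) ⟨{s, y₁, y₂}, ⟨s, by simp⟩, ?_, ⟨v, ?_, ?_⟩, ?_⟩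
      · intro a ha b hb hab
        simp only [Finset.mem_insert, Finset.mem_singleton] at ha hb
        rcases ha with rfl | rfl | rfl <;> rcases hb with rfl | rfl | rfl
        · exact absurd rfl hab
        · exact huw
        · exact hux
        · exact huw.symm
        · exact absurd rfl hab
        · exact hwx
        · exact hux.symm
        · exact hwx.symm
        · exact absurd rfl hab
      · intro a ha hb
        simp only [Set.mem_insert_iff, Set.mem_singleton_iff] at ha
        simp only [Finset.coe_insert, Finset.coe_singleton, Set.mem_insert_iff,
          Set.mem_singleton_iff] at hb
        rcases ha with rfl | rfl | rfl <;> rcases hb with h | h | h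
        · exact hsu.1 h
        · exact hsw.1 h
        · exact hsx.ne h
        · exact h1u.ne h
        · exact h1w h
        · exact hx1 h.symm
        · exact h2u h
        · exact h2w.ne h
        · exact hx2 h.symm
      · simp [v1, v2, v3]
      · simp [v4, v5, v6]
      · intro a ha b hab
        simp only [Set.mem_insert_iff, Set.mem_singleton_iff, Finset.coe_insert,
          Finset.coe_singleton] at ha ⊢
        rcases ha with rfl | rfl | rfl
        · rcases hn b hab with h | h | h <;> simp [h]
        · rcases (hp.2.1 b).1 hab with h | h | h <;> simp [h]
        · rcases (hp.2.2 b).1 hab with h | h | h <;> simp [h]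
  · exact not_outcomeOne_of_twoNbrs h kt
  · exact not_outcomeOne_of_twoNbrs h kt
  · exact not_outcomeOne_of_twoNbrs k ht
  · -- `u` and `w` have the adjacent common neighbours `x'` and `r'`
    obtain ⟨hxr, hxx, hrr, hxr', hwx, hwr, hxs, hrs, hxr1, hrx1, hnx, hnr⟩ := h
    obtain ⟨kxr, kxx, krr, kxr', kux, kur, kxs, krs, kxr1, krx1, knx, knr⟩ := k
    have fin : G.Adj u x' → G.Adj u r' → False := fun h1 h2 =>
      huw.ne (hG.eq_of_common_of_adj hxr' h1.symm h2.symm hwx.symm hwr.symm)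
    rcases eq_or_swap_of_twoNbrs ht kt with ⟨rfl, rfl⟩ | ⟨rfl, rfl⟩
    · have e1 : x₂' = x' := ((hnx _ kxx).resolve_left kxs).resolve_left kxr1
      have e2 : r₂' = r' := ((hnr _ krr).resolve_left krs).resolve_left krx1
      exact fin (e1 ▸ kux) (e2 ▸ kur)
    · have e1 : x₂' = r' := ((hnr _ kxx).resolve_left kxs).resolve_left kxr1
      have e2 : r₂' = x' := ((hnx _ krr).resolve_left krs).resolve_left krx1
      exact fin (e2 ▸ kur) (e1 ▸ kux)
  · rcases eq_or_swap_of_twoNbrs ht kt with ⟨rfl, rfl⟩ | ⟨rfl, rfl⟩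
    · exact k.2.2.2.2.2.2.2.2.1.2 h.1
    · exact k.2.2.2.2.2.2.2.2.1.2 h.1.symm
  · exact not_outcomeOne_of_twoNbrs k ht
  · rcases eq_or_swap_of_twoNbrs ht kt with ⟨rfl, rfl⟩ | ⟨rfl, rfl⟩
    · exact h.2.2.2.2.2.2.2.2.1.2 k.1
    · exact h.2.2.2.2.2.2.2.2.1.2 k.1.symm
  · obtain ⟨hwx, hrw, hrx, hwx', hww, hxx, hws, hxs, fxr, fwx, fxw, hnr⟩ := h
    obtain ⟨kux, kru, krx, kux', kuu, kxx, kus, kxs, fxr', fux, fxu, knr⟩ := k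
    rcases eq_or_swap_of_twoNbrs ht kt with ⟨rfl, rfl⟩ | ⟨rfl, rfl⟩
    · rcases (hnr x₂' krx).resolve_left kxs with e | e
      · exact fxw.2 (e ▸ kxx)
      · have e' : u' = w' := ((hnr u' kru).resolve_left kus).resolve_right fun h =>
          kux'.ne (h.trans e.symm)
        subst e'
        exact fxw.1 (hG.eq_of_common_of_adj huw kux hwx kuu hww)
    · have hu : u = w' := ((hnr u kux.symm).resolve_left hsu.1.symm).resolve_right fun h =>
        fwx.2 (h ▸ huw.symm)
      have hx₂ : x₂' = x' := ((hnr x₂' kxx).resolve_left kxs).resolve_left fun h =>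
        fux.1 (hu.trans h.symm)
      have hw : w = u' := ((knr w hwx.symm).resolve_left hsw.1.symm).resolve_right fun h =>
        fwx.1 (h.trans hx₂)
      exact fwx.2 (hw ▸ hx₂ ▸ kux')

end Crit

/-! ### Identifying two vertices -/

/-- The neighbours of `x` are `a`, `z` and `y`, where `y` is adjacent to `a` or to `z`. -/
def ThirdNbr {V : Type*} (G : SimpleGraph V) (a z x y : V) : Prop :=
  G.Adj x a ∧ G.Adj x z ∧ G.Adj x y ∧ y ≠ a ∧ y ≠ z ∧ (G.Adj a y ∨ G.Adj z y) ∧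
    ∀ v, G.Adj x v → v = a ∨ v = z ∨ v = y

namespace Crit

variable {V : Type u} [Fintype V] [DecidableEq V] {G : SimpleGraph V}

theorem merge_inGsc (hG : G.Crit) {a z b p : V} (haz : a ≠ z) (hna : ¬ G.Adj a z) (hbp : b ≠ p)
    (hab : G.Adj a b) (hzb : G.Adj z b) (hap : G.Adj a p) (hzp : G.Adj z p) :
    InGsc ((G.mergeInto a z).induce ((univ.erase z : Finset V) : Set V)) := by
  have h1 := ec_merge (G := G) haz hna (D := {b, p}) (by
    intro d hd
    simp only [Finset.mem_insert, Finset.mem_singleton] at hd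
    rcases hd with rfl | rfl
    · exact ⟨hab, hzb⟩
    · exact ⟨hap, hzp⟩)
  rw [Finset.card_pair hbp] at h1
  have h2 := hG.edges
  have h3 := hG.four_le
  have h4 : Fintype.card ((univ.erase z : Finset V) : Set V) + 1 = Fintype.card V := by
    rw [← Finset.card_univ (α := V), ← Finset.card_erase_add_one (Finset.mem_univ z)]
    simp
  refine hG.min _ _ (by omega) (by omega) (not_hasStableCut_merge hG.not_cut haz hna) ?_
  rw [ec_induce]
  omega

/-- If two nonadjacent vertices `a`, `z` have two common neighbours, then identifying `a` and `z`
gives a graph of the class, and its leaves show that both common neighbours have degree three and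
lie in a triangle with `a` or `z`. -/
theorem exists_thirdNbr (hG : G.Crit) {a z b p : V} (haz : a ≠ z) (hna : ¬ G.Adj a z) (hbp : b ≠ p)
    (hab : G.Adj a b) (hzb : G.Adj z b) (hap : G.Adj a p) (hzp : G.Adj z p) :
    (∃ y, G.ThirdNbr a z b y) ∧ ∃ y, G.ThirdNbr a z p y := by
  have hnbp : ¬ G.Adj b p := fun h =>
    haz (hG.eq_of_common_of_adj h hab.symm hap.symm hzb.symm hzp.symm)
  set R : Set V := ((univ.erase z : Finset V) : Set V) with hR
  have mR : ∀ v, v ∈ R ↔ v ≠ z := fun v => by simp [hR]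
  set H := (G.mergeInto a z).induce R with hH
  have hHG : InGsc H := hG.merge_inGsc haz hna hbp hab hzb hap hzp
  have haR : a ∈ R := (mR a).2 haz
  have up : ∀ x y : R, G.Adj x y → H.Adj x y := fun x y h => ⟨h.ne, Or.inl h⟩
  have upz : ∀ x : R, (x : V) ≠ a → G.Adj z x → H.Adj x ⟨a, haR⟩ := fun x hx h =>
    ⟨hx, Or.inr (Or.inr ⟨rfl, h⟩)⟩
  have down : ∀ x y : R, H.Adj x y → (x : V) ≠ a → (y : V) ≠ a → G.Adj x y := by
    rintro x y ⟨-, h | h | h⟩ hx hy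
    · exact h
    · exact absurd h.1 hx
    · exact absurd h.1 hy
  have downa : ∀ y : R, H.Adj ⟨a, haR⟩ y → G.Adj a y ∨ G.Adj z y := by
    rintro y ⟨hne, h | h | h⟩
    · exact Or.inl h
    · exact Or.inr h.2
    · exact absurd h.1.symm hne
  -- a clique of `H` through `a` misses a vertex of degree two, which is `b` or `p`
  have step : ∀ T : Set R, (∀ x ∈ T, ∀ y ∈ T, x ≠ y → H.Adj x y) → ⟨a, haR⟩ ∈ T → (∃ v, v ∉ T) →
      ∃ x y : R, x ∉ T ∧ (x = b ∨ (x : V) = p) ∧ G.ThirdNbr a z x y ∧ H.Adj ⟨a, haR⟩ y := by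
    intro T hT haT hv
    rcases exists_leaf_or_piece hHG T hT _ haT hv with
      ⟨x, c, d, hx, hcd, hn⟩ | ⟨y₁, y₂, s, u, w, ⟨huw, h1, h2⟩, -, -, n1, n2, n3, n4, n5⟩
    · have hxa : (x : V) ≠ a := fun h => hx ((Subtype.ext h : x = ⟨a, haR⟩) ▸ haT)
      have hnG : ∀ v, G.Adj x v → v = c ∨ v = d ∨ v = z := by
        intro v hv
        by_cases hvz : v = z
        · exact Or.inr (Or.inr hvz)
        · exact ((hn ⟨v, (mR v).2 hvz⟩).1 (up _ _ hv)).imp (congrArg Subtype.val)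
            fun h => Or.inl (congrArg Subtype.val h)
      obtain ⟨v, hv, hvc, hvd⟩ := hG.exists_adj_ne x c d
      obtain rfl : v = z := ((hnG v hv).resolve_left hvc).resolve_left hvd
      have main : ∀ d : R, H.Adj ⟨a, haR⟩ d → H.Adj x d →
          (∀ u, G.Adj x u → u = a ∨ u = d ∨ u = v) →
          ∃ x y : R, x ∉ T ∧ (x = b ∨ (x : V) = p) ∧ G.ThirdNbr a v x y ∧ H.Adj ⟨a, haR⟩ y := by
        intro d had hxd hn
        have hda : (d : V) ≠ a := fun h => had.ne (Subtype.ext h.symm)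
        obtain ⟨u, hu, hud, huv⟩ := hG.exists_adj_ne x d v
        obtain rfl : u = a := ((hn u hu).resolve_right fun h => h.elim hud huv)
        refine ⟨x, d, hx, ?_, ⟨hu, hv, down x d hxd hxa hda, hda, (mR _).1 d.2, downa d had,
          fun t ht => ?_⟩, had⟩
        · by_contra hno
          rw [not_or] at hno
          have := hG.card_common_le haz hna (D := {b, p, (x : V)}) (by
            intro t ht
            simp only [Finset.mem_insert, Finset.mem_singleton] at ht
            rcases ht with rfl | rfl | rfl
            · exact ⟨hab, hzb⟩
            · exact ⟨hap, hzp⟩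
            · exact ⟨hu.symm, hv.symm⟩)
          rw [Finset.card_eq_three.2 ⟨b, p, x, hbp, Ne.symm hno.1, Ne.symm hno.2, rfl⟩] at this
          omega
        · exact (hn t ht).imp_right Or.symm
      rcases (hn ⟨a, haR⟩).1 (upz x hxa hv.symm) with h | h
      · subst h
        exact main d hcd ((hn d).2 (Or.inr rfl)) hnG
      · subst h
        exact main c hcd.symm ((hn c).2 (Or.inl rfl)) fun u hu => or_left_comm.1 (hnG u hu)
    · have ne : ∀ {v : R}, ⟨a, haR⟩ ≠ v → (v : V) ≠ a := fun h h' => h (Subtype.ext h'.symm)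
      have key : ∀ {y c d e : R}, ⟨a, haR⟩ ≠ y → ⟨a, haR⟩ ≠ c → ⟨a, haR⟩ ≠ d → ⟨a, haR⟩ ≠ e →
          (∀ v, H.Adj y v ↔ v = c ∨ v = d ∨ v = e) →
          ∀ v, G.Adj y v ↔ v = (c : V) ∨ v = d ∨ v = e := by
        intro y c d e hy hc hd he h v
        constructor
        · intro hv
          have hvz : v ≠ z := by
            rintro rfl
            rcases (h _).1 (upz y (ne hy) hv.symm) with h' | h' | h'
            · exact hc h'
            · exact hd h'
            · exact he h'
          exact ((h ⟨v, (mR v).2 hvz⟩).1 (up _ _ hv)).imp (congrArg Subtype.val)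
            (Or.imp (congrArg Subtype.val) (congrArg Subtype.val))
        · rintro (rfl | rfl | rfl)
          · exact down _ _ ((h c).2 (by simp)) (ne hy) (ne hc)
          · exact down _ _ ((h d).2 (by simp)) (ne hy) (ne hd)
          · exact down _ _ ((h e).2 (by simp)) (ne hy) (ne he)
      exact (hG.not_piece (y₁ := y₁) (y₂ := y₂) (s := s) (u := u) (w := w)
        ⟨down u w huw (ne n4) (ne n5), key n1 n2 n3 n4 h1, key n2 n1 n3 n5 h2⟩).elim
  have hbR : b ∈ R := (mR b).2 hzb.ne'
  have hpR : p ∈ R := (mR p).2 hzp.ne'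
  obtain ⟨x₁, y₁, hx₁, hbp₁, t₁, hay₁⟩ := step {⟨a, haR⟩} (by
    rintro x rfl y rfl h
    exact absurd rfl h) rfl ⟨⟨b, hbR⟩, fun h => hab.ne (congrArg Subtype.val h).symm⟩
  obtain ⟨x₂, y₂, hx₂, hbp₂, t₂, -⟩ := step {⟨a, haR⟩, x₁, y₁} (by
    have e1 : H.Adj ⟨a, haR⟩ x₁ := up _ _ t₁.1.symm
    have e2 : H.Adj x₁ y₁ := up _ _ t₁.2.2.1
    rintro x (rfl | rfl | rfl) y (rfl | rfl | rfl) h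
    · exact absurd rfl h
    · exact e1
    · exact hay₁
    · exact e1.symm
    · exact absurd rfl h
    · exact e2
    · exact hay₁.symm
    · exact e2.symm
    · exact absurd rfl h) (by simp) (by
    have e2 := t₁.2.2.1
    rcases hbp₁ with h | h
    · refine ⟨⟨p, hpR⟩, ?_⟩
      rintro (h' | h' | h')
      · exact hap.ne (congrArg Subtype.val h').symm
      · exact hbp ((congrArg Subtype.val h').trans h).symm
      · have : p = (y₁ : V) := congrArg Subtype.val h'
        rw [h, ← this] at e2
        exact hnbp e2
    · refine ⟨⟨b, hbR⟩, ?_⟩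
      rintro (h' | h' | h')
      · exact hab.ne (congrArg Subtype.val h').symm
      · exact hbp ((congrArg Subtype.val h').trans h)
      · have : b = (y₁ : V) := congrArg Subtype.val h'
        rw [h, ← this] at e2
        exact hnbp e2.symm)
  have hne : (x₁ : V) ≠ x₂ := fun h => hx₂ (by simp [Subtype.ext h])
  rcases hbp₁ with h | h <;> rcases hbp₂ with h' | h'
  · exact absurd (h.trans h'.symm) hne
  · exact ⟨⟨_, h ▸ t₁⟩, ⟨_, h' ▸ t₂⟩⟩
  · exact ⟨⟨_, h' ▸ t₂⟩, ⟨_, h ▸ t₁⟩⟩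
  · exact absurd (h.trans h'.symm) hne

/-- There is no minimal counterexample: four vertices `a`, `b`, `z`, `p` of degree three as above
are cut off by two further vertices, or complete a prism with them. -/
theorem false (hG : G.Crit) : False := by
  have h := hG.not_uniqueCommon
  unfold UniqueCommon at h
  push Not at h
  obtain ⟨a, z, b, p, haz, hab, hzb, hap, hzp, hbp⟩ := h
  have hna : ¬ G.Adj a z := fun h => hbp (hG.eq_of_common_of_adj h hab hzb hap hzp)
  have hnb : ¬ G.Adj b p := fun h =>
    haz (hG.eq_of_common_of_adj h hab.symm hap.symm hzb.symm hzp.symm)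
  obtain ⟨⟨y, hby⟩, ⟨y', hpy⟩⟩ := hG.exists_thirdNbr haz hna hbp hab hzb hap hzp
  obtain ⟨⟨r, har⟩, ⟨r', hzr⟩⟩ :=
    hG.exists_thirdNbr hbp hnb haz hab.symm hap.symm hzb.symm hzp.symm
  -- up to exchanging `a` and `z`, the third neighbour of `b` is adjacent to `a`
  have main : ∀ a z r r', a ≠ z → ¬ G.Adj a z → G.ThirdNbr a z b y → G.ThirdNbr a z p y' →
      G.ThirdNbr b p a r → G.ThirdNbr b p z r' → G.Adj a y → False := by
    rintro a z r r' haz hna ⟨hba, hbz, hby, hya, hyz, -, hbn⟩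
      ⟨hpa, hpz, hpy, hya', hyz', hpy', hpn⟩ ⟨-, -, har, hrb, hrp, -, han⟩
      ⟨-, -, hzr, hrb', hrp', -, hzn⟩ hay
    have hyb : y ≠ b := hby.ne'
    have hyp : y ≠ p := fun h => hnb (h ▸ hby)
    have hyb' : y' ≠ b := fun h => hnb (h ▸ hpy).symm
    have hyp' : y' ≠ p := hpy.ne'
    have hyr : y = r := ((han y hay).resolve_left hyb).resolve_left hyp
    have hpyn : ¬ G.Adj p y := fun h =>
      hbp (hG.eq_of_common_of_adj hay hba.symm hby.symm hpa.symm h.symm)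
    have hzy' : G.Adj z y' := hpy'.resolve_left fun h => by
      have : y' = r := ((han y' h).resolve_left hyb').resolve_left hyp'
      exact hpyn (hyr.trans this.symm ▸ hpy)
    have hyr' : y' = r' := ((hzn y' hzy').resolve_left hyb').resolve_left hyp'
    have hyy : y ≠ y' := fun h => hpyn (h ▸ hpy)
    have hzyn : ¬ G.Adj z y := fun h =>
      hyy ((((hzn y h).resolve_left hyb).resolve_left hyp).trans hyr'.symm)
    have hayn' : ¬ G.Adj a y' := fun h =>
      hyy (hyr.trans ((((han y' h).resolve_left hyb').resolve_left hyp')).symm)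
    have hbyn' : ¬ G.Adj b y' := fun h => by
      rcases hbn y' h with h | h | h
      · exact hya' h
      · exact hyz' h
      · exact hyy h.symm
    by_cases hall : ∀ v, v = y ∨ v = a ∨ v = b ∨ v = y' ∨ v = p ∨ v = z
    · have hyy' : G.Adj y y' := by
        obtain ⟨v, hv, hva, hvb⟩ := hG.exists_adj_ne y a b
        rcases hall v with rfl | rfl | rfl | rfl | rfl | rfl
        · exact absurd rfl hv.ne
        · exact absurd rfl hva
        · exact absurd rfl hvb
        · exact hv
        · exact absurd hv.symm hpyn
        · exact absurd hv.symm hzyn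
      have hpr : G.IsPrismAt y a b y' p z :=
        ⟨hay.symm, hby.symm, hba.symm, hpy.symm, hzy'.symm, hpz, hyy', hpa.symm, hbz,
          ⟨hyp, fun h => hpyn h.symm⟩, ⟨hyz, fun h => hzyn h.symm⟩, ⟨hya'.symm, hayn'⟩,
          ⟨hyb'.symm, hbyn'⟩, ⟨haz, hna⟩, ⟨hbp, hnb⟩⟩
      exact hG.not_gsc (InGsc.prism (hpr.nonempty_iso hall))
    · push Not at hall
      obtain ⟨v, v1, v2, v3, v4, v5, v6⟩ := hall
      refine hG.not_separates_pair y y' ⟨{a, b, z, p}, ⟨a, by simp⟩, ?_,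
        ⟨v, by simp [v2, v3, v5, v6], by simp [v1, v4]⟩, ?_⟩
      · rintro x hx hx'
        simp only [Set.mem_insert_iff, Set.mem_singleton_iff] at hx hx'
        rcases hx with rfl | rfl | rfl | rfl <;> rcases hx' with h | h
        · exact hya h.symm
        · exact hya' h.symm
        · exact hyb h.symm
        · exact hyb' h.symm
        · exact hyz h.symm
        · exact hyz' h.symm
        · exact hyp h.symm
        · exact hyp' h.symm
      · intro x hx t hxt
        simp only [Set.mem_insert_iff, Set.mem_singleton_iff] at hx ⊢
        rcases hx with rfl | rfl | rfl | rfl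
        · rcases han t hxt with h | h | h <;> simp [h, hyr]
        · rcases hbn t hxt with h | h | h <;> simp [h]
        · rcases hzn t hxt with h | h | h <;> simp [h, hyr']
        · rcases hpn t hxt with h | h | h <;> simp [h]
  have flip : ∀ {x y}, G.ThirdNbr a z x y → G.ThirdNbr z a x y := fun h =>
    ⟨h.2.1, h.1, h.2.2.1, h.2.2.2.2.1, h.2.2.2.1, h.2.2.2.2.2.1.symm,
      fun v hv => or_left_comm.1 (h.2.2.2.2.2.2 v hv)⟩
  rcases hby.2.2.2.2.2.1 with h | h
  · exact main a z r r' haz hna hby hpy har hzr h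
  · exact main z a r' r haz.symm (fun h => hna h.symm) (flip hby) (flip hpy) hzr har h

end Crit

/-! ### The theorem -/

/-- A graph without a stable cutset on at most three vertices is complete. -/
theorem eq_completeGraph_of_card_le {V : Type*} [Fintype V] {G : SimpleGraph V}
    (hcut : ¬ G.HasStableCut) (hV : Fintype.card V ≤ 3) : G = completeGraph V := by
  classical
  ext a b
  simp only [completeGraph, top_adj]
  refine ⟨fun h => h.ne, fun hab => ?_⟩
  by_contra hnab
  -- the at most one vertex besides `a` and `b` is a stable cutset
  refine hcut ⟨{v | v ≠ a ∧ v ≠ b}, isIndepSet_of_forall ?_, {a}, ⟨a, rfl⟩, ?_,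
    ⟨b, fun h => hab (Set.mem_singleton_iff.1 h).symm, fun h => h.2 rfl⟩, ?_⟩
  · rintro c ⟨hca, hcb⟩ d ⟨hda, hdb⟩ hcd
    have h1 : ({a, b, c, d} : Finset V).card = 4 := by
      rw [Finset.card_insert_of_notMem (by simp [hab, hca.symm, hda.symm]),
        Finset.card_eq_three.2 ⟨b, c, d, hcb.symm, hdb.symm, hcd.ne, rfl⟩]
    have h2 := Finset.card_le_univ ({a, b, c, d} : Finset V)
    omega
  · rintro x rfl h
    exact h.1 rfl
  · rintro x rfl y hxy
    exact Or.inr ⟨hxy.ne', fun h => hnab (h ▸ hxy)⟩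

theorem inGsc_of_not_hasStableCut {V : Type u} [Fintype V] (G : SimpleGraph V)
    (hcut : ¬ G.HasStableCut) (hV : 3 ≤ Fintype.card V)
    (hedges : G.ec univ univ + 6 ≤ 4 * Fintype.card V) : InGsc G := by
  classical
  induction hn : Fintype.card V using Nat.strong_induction_on generalizing V with
  | _ n ih =>
  subst hn
  by_contra hno
  by_cases h3 : Fintype.card V = 3
  · rw [eq_completeGraph_of_card_le hcut h3.le] at hno
    exact hno (InGsc.triangle ⟨Iso.completeGraph (Fintype.equivFinOfCardEq h3)⟩)
  · have hG : G.Crit := ⟨hcut, hno, hedges, by omega,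
      fun W _ H hW hW3 hH hHe => ih _ hW H hH hW3 hHe rfl⟩
    exact hG.false

end SimpleGraph

theorem theorem2 {V : Type*} [Finite V] (G : SimpleGraph V) (n : ℕ) (hn : Nat.card V = n)
    (hK₂ : ¬ Nonempty (G ≃g SimpleGraph.completeGraph (Fin 2)))
    (hedges : (G.edgeSet.ncard : ℤ) ≤ 2 * (n : ℤ) - 3) :
    (∃ S : Set V, IsStableCutset G S) ∨ InGsc G := by
  classical
  have := Fintype.ofFinite V
  rw [Nat.card_eq_fintype_card] at hn
  by_cases hcut : G.HasStableCut
  · obtain ⟨S, hS, hsep⟩ := hcut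
    exact Or.inl ⟨S, hsep.isStableCutset hS⟩
  · have hec := G.ec_univ
    by_cases h2 : n = 2
    · rw [SimpleGraph.eq_completeGraph_of_card_le hcut (by omega)] at hK₂
      exact absurd ⟨SimpleGraph.Iso.completeGraph (Fintype.equivFinOfCardEq (hn.trans h2))⟩ hK₂
    · exact Or.inr (SimpleGraph.inGsc_of_not_hasStableCut G hcut (by omega) (by omega))
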